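/- **Conventions.** NP-hardness is under polynomial-time many-one reductions (Turing machines). A gap problem (YES, NO) is NP-hard if for every $L\in\mathsf{NP}$ there is a polynomial-time computable $f$ that maps every $x\in L$ to a YES instance and every $x\notin L$ to a NO instance. **Johnson Coverage\*.** Let $z>y\ge 1$ be integers and $\alpha\in\mathbb R$. An instance of $(\alpha,z,y)$-Johnson Coverage is a triple $(U,E,k)$ with $U=[n]$, a nonempty $E\subseteq\binom{[n]}{z}$ (given by its incidence matrix), and an integer $k\ge 1$ (in unary). For $S\subseteq U$ let $\mathrm{cov}(S,E)=\{T\in E: S\subseteq T\}$. The instance is YES if there are $S_1,\dots,S_k\in\binom{[n]}{y}$ with $\bigcup_i \mathrm{cov}(S_i,E)=E$, and NO if $|\bigcup_i\mathrm{cov}(S_i,E)|\le\alpha|E|$ for all $S_1,\dots,S_k\in\binom{[n]}{y}$. We say that $(\alpha,z,y)$-Johnson Coverage\* is NP-hard if this gap problem is NP-hard on instances with $|E|=\omega(k\cdot|U|^{z-y-1})$, i.e. there is $g:\mathbb N\to\mathbb R$ with $g(n)\to\infty$ such that the gap problem restricted to instances with $|E|\ge g(|U|)\cdot k\cdot|U|^{z-y-1}$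 is NP-hard. The Dense Johnson Coverage Hypothesis $\mathsf{JCH}^*$ states that for every $\varepsilon>0$ there is an integer $z\ge2$ such that $(1-\tfrac1e+\varepsilon,z,z-1)$-Johnson Coverage\* is NP-hard. **Continuous $k$-median in $\ell_1$.** For real $F$, we say that *continuous $k$-median in $O(\log n)$-dimensional $\ell_1$ is NP-hard to approximate within $F$* if there are constants $K,\rho>0$ such that the following gap problem is NP-hard. Given a set $P\subseteq\{0,1\}^d$ of $n\ge2$ points (as a list of bit vectors), where $d\le K\log n$, and an integer $k\ge1$ (in unary), distinguish - YES: there are $c_1,\dots,c_k\in\mathbb R^d$ and $\sigma:P\to\{c_1,\dots,c_k\}$ with $\sum_{a\in P}\|a-\sigma(a)\|_1\le\rho\, n\log n$; - NO: for all $c_1,\dots,c_k\in\mathbb R^d$ and all $\sigma:P\to\{c_1,\dots,c_k\}$, $\sum_{a\in P}\|a-\sigma(a)\|_1\ge F\cdot\rho\, n\log n$. **Theorem.** 1. Let $0\le\alpha<1$ and let $z>y\ge1$ be integers. If $(\alpha,z,y)$-Johnson Coverage\* is NP-hard, then for every $\varepsilon>0$ continuous $k$-median in $O(\log n)$-dimensional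 $\ell_1$ is NP-hard to approximate within $1+\frac{1-\alpha}{z-y}-\varepsilon$. 2. If $\mathsf{JCH}^*$ holds, then for every $\varepsilon>0$ continuous $k$-median in $O(\log n)$-dimensional $\ell_1$ is NP-hard to approximate within $1+\frac1e-\varepsilon$. 3. For every $d$ and every finite $P\subseteq\{0,1\}^d$ there is $c\in\{0,1\}^d$ such that each coordinate $c_i$ is a median of the values $a_i$, $a\in P$ (with multiplicity), and $\sum_{a\in P}\|a-c\|_1\le\sum_{a\in P}\|a-x\|_1$ for all $x\in\mathbb R^d$. -/

import Mathlib

namespace KMedianL1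

/-! ### Polynomial time, NP, and NP-hardness of promise problems -/

/-- A string function is polynomial-time computable if some multi-stack Turing machine computes it
within a number of steps that is polynomial in the length of the input. -/
def PolyTime (f : List Bool → List Bool) : Prop :=
  Nonempty (Turing.TM2ComputableInPolyTime (id : List Bool → List Bool)
    (id : List Bool → List Bool) f)

/-- A predicate on pairs (input, certificate) decided in polynomial time. -/
def PolyTimeVerifier (V : List Bool × List Bool → Bool) : Prop :=
  Nonempty (Turing.TM2ComputableInPolyTime
    (Computability.encodingProd (Computability.encodingList Bool)
      (Computability.encodingList Bool)).encode
    Computability.encodeBool V)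

/-- The class NP: membership has certificates of polynomial length that can be verified in
polynomial time. -/
def InNP (L : Set (List Bool)) : Prop :=
  ∃ (V : List Bool × List Bool → Bool) (p : Polynomial ℕ), PolyTimeVerifier V ∧
    ∀ x, x ∈ L ↔ ∃ w : List Bool, w.length ≤ p.eval x.length ∧ V (x, w) = true

/-- A promise (gap) problem: distinguish the strings in `yes` from the strings in `no`. -/
structure PromiseProblem where
  yes : Set (List Bool)
  no : Set (List Bool)

/-- NP-hardness under polynomial-time many-one (Karp) reductions: every language in NP reduces
to the task of distinguishing `yes` from `no`. -/
def NPHard (Q : PromiseProblem) : Prop :=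
  ∀ L : Set (List Bool), InNP L → ∃ f : List Bool → List Bool, PolyTime f ∧
    ∀ x, (x ∈ L → f x ∈ Q.yes) ∧ (x ∉ L → f x ∈ Q.no)

/-! ### Strings for a number and a 0/1 matrix -/

/-- A row of bits: each bit is preceded by a `1`, and the row is closed by a `0`. -/
def encodeRow (r : List Bool) : List Bool :=
  r.flatMap (fun b => [true, b]) ++ [false]

/-- The number `k` in unary, closed by a `0`, followed by the rows of a 0/1 matrix. -/
def encode (k : ℕ) (rows : List (List Bool)) : List Bool :=
  List.replicate k true ++ [false] ++ rows.flatMap encodeRow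

/-- The string `w` describes the number `k` and the finite set `P` of points of `{0,1}^d`,
listed without repetition in some order. -/
def Describes {d : ℕ} (w : List Bool) (k : ℕ) (P : Finset (Fin d → Bool)) : Prop :=
  ∃ pts : List (Fin d → Bool), pts.Nodup ∧ pts.toFinset = P ∧
    w = encode k (pts.map List.ofFn)

/-! ### Johnson Coverage -/

/-- An instance `(U, E, k)` with universe `U = Fin n` and a collection `E` of subsets of `U`. -/
structure CoverageInstance where
  n : ℕ
  E : Finset (Finset (Fin n))
  k : ℕ

namespace CoverageInstance

/-- The members of `E` that contain `S`. -/
def cov (I : CoverageInstance) (S : Finset (Fin I.n)) : Finset (Finset (Fin I.n)) :=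
  I.E.filter (fun T => S ⊆ T)

/-- The members of `E` that contain one of the sets `S 1, …, S k`. -/
def covUnion (I : CoverageInstance) (S : Fin I.k → Finset (Fin I.n)) :
    Finset (Finset (Fin I.n)) :=
  Finset.univ.biUnion (fun i => I.cov (S i))

/-- `E` is a nonempty collection of `z`-element sets, and `k` is positive. -/
def Valid (I : CoverageInstance) (z : ℕ) : Prop :=
  I.E.Nonempty ∧ (∀ T ∈ I.E, T.card = z) ∧ 1 ≤ I.k

/-- Completeness: some `k` sets of size `y` cover all of `E`. -/
def Complete (I : CoverageInstance) (y : ℕ) : Prop :=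
  ∃ S : Fin I.k → Finset (Fin I.n), (∀ i, (S i).card = y) ∧ I.covUnion S = I.E

/-- Soundness: any `k` sets of size `y` cover at most an `α` fraction of `E`. -/
def Sound (I : CoverageInstance) (α : ℝ) (y : ℕ) : Prop :=
  ∀ S : Fin I.k → Finset (Fin I.n), (∀ i, (S i).card = y) →
    ((I.covUnion S).card : ℝ) ≤ α * I.E.card

/-- `|E| ≥ g(|U|) · k · |U|^(z-y-1)`. -/
def Dense (I : CoverageInstance) (g : ℕ → ℝ) (z y : ℕ) : Prop :=
  g I.n * (I.k * (I.n : ℝ) ^ (z - y - 1)) ≤ I.E.card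

/-- The string `w` describes the instance: the parameter `k` and the incidence matrix of `E`. -/
def DescribedBy (I : CoverageInstance) (w : List Bool) : Prop :=
  Describes w I.k (I.E.image (fun T => fun i => decide (i ∈ T)))

end CoverageInstance

/-- The `(α, z, y)`-Johnson Coverage problem restricted to the instances that satisfy
`|E| ≥ g(|U|) · k · |U|^(z-y-1)`. -/
def johnsonCoverage (α : ℝ) (z y : ℕ) (g : ℕ → ℝ) : PromiseProblem where
  yes := {w | ∃ I : CoverageInstance, I.Valid z ∧ I.Dense g z y ∧ I.DescribedBy w ∧ I.Complete y}
  no := {w | ∃ I : CoverageInstance, I.Valid z ∧ I.Dense g z y ∧ I.DescribedBy w ∧ I.Sound α y}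

/-- `(α, z, y)`-Johnson Coverage* is NP-hard: the `(α, z, y)`-Johnson Coverage problem is NP-hard on
instances that satisfy `|E| = ω(k · |U|^(z-y-1))`. -/
def JohnsonCoverageStarNPHard (α : ℝ) (z y : ℕ) : Prop :=
  ∃ g : ℕ → ℝ, Filter.Tendsto g Filter.atTop Filter.atTop ∧ NPHard (johnsonCoverage α z y g)

/-- The Dense Johnson Coverage Hypothesis JCH*. -/
def JCHStar : Prop :=
  ∀ ε : ℝ, 0 < ε → ∃ z : ℕ, 2 ≤ z ∧
    JohnsonCoverageStarNPHard (1 - 1 / Real.exp 1 + ε) z (z - 1)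

/-! ### Continuous `k`-median of Boolean points in the `ℓ₁`-metric -/

/-- `ℝ^d` with the `ℓ₁`-norm. -/
abbrev L1 (d : ℕ) : Type := PiLp 1 (fun _ : Fin d => ℝ)

/-- A point of `{0,1}^d` as a point of `ℝ^d`. -/
noncomputable def boolPoint {d : ℕ} (a : Fin d → Bool) : L1 d :=
  WithLp.toLp 1 (fun i => if a i then (1 : ℝ) else 0)

/-- The cost of `P ⊆ {0,1}^d` for the centers `c 1, …, c k` in `ℝ^d` when each point `a` is
assigned to the center with index `σ a`. -/
noncomputable def cost {d k : ℕ} (P : Finset (Fin d → Bool)) (c : Fin k → L1 d)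
    (σ : (Fin d → Bool) → Fin k) : ℝ :=
  ∑ a ∈ P, ‖boolPoint a - c (σ a)‖

/-- The gap problem for continuous `k`-median in the `ℓ₁`-metric, on sets of `n ≥ 2` points of
`{0,1}^d` with `d ≤ K log n`: distinguish cost at most `ρ n log n` for some choice of `k` centers
in `ℝ^d` from cost at least `F · ρ n log n` for every choice of `k` centers in `ℝ^d`. -/
def kMedianGap (K ρ F : ℝ) : PromiseProblem where
  yes := {w | ∃ (d k : ℕ) (P : Finset (Fin d → Bool)), 2 ≤ P.card ∧ 1 ≤ k ∧
    (d : ℝ) ≤ K * Real.log P.card ∧ Describes w k P ∧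
    ∃ (c : Fin k → L1 d) (σ : (Fin d → Bool) → Fin k),
      cost P c σ ≤ ρ * P.card * Real.log P.card}
  no := {w | ∃ (d k : ℕ) (P : Finset (Fin d → Bool)), 2 ≤ P.card ∧ 1 ≤ k ∧
    (d : ℝ) ≤ K * Real.log P.card ∧ Describes w k P ∧
    ∀ (c : Fin k → L1 d) (σ : (Fin d → Bool) → Fin k),
      F * (ρ * P.card * Real.log P.card) ≤ cost P c σ}

/-- Continuous `k`-median in `O(log n)`-dimensional `ℓ₁`-metric is NP-hard to approximate within
the factor `F`. -/
def KMedianNPHardToApprox (F : ℝ) : Prop :=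
  ∃ K ρ : ℝ, 0 < K ∧ 0 < ρ ∧ NPHard (kMedianGap K ρ F)

/-- `m` is a median of the values `f a`, `a ∈ s` (counted with multiplicity). -/
def IsMedian {ι : Type*} (s : Finset ι) (f : ι → ℝ) (m : ℝ) : Prop :=
  2 * {a ∈ s | f a < m}.card ≤ s.card ∧ 2 * {a ∈ s | m < f a}.card ≤ s.card

end KMedianL1

open KMedianL1

namespace KMedianL1

open Turing

/-! The reduction gives every vertex `u` that lies in some edge a codeword `C u`, a set of `m =
Nat.size |E|` positions out of `d = q * m` with `q` constant, such that two codewords share at most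
`m / D` positions. An edge `T` becomes the point whose support is the union of its codewords.
Distances between 0/1 points are sizes of symmetric differences. If `S ⊆ T` has `y` elements, the
union of the codewords of `S` is within `(z - y) * m` of the point of `T`, so a complete cover gives
cost at most `(z - y) * m * |E|`.

For soundness, centers may be taken Boolean, because a coordinatewise majority is an optimal center
of a cluster (`exists_bool_median`, which is also the third claim). A Boolean center of size `O(m)`
has a substantial intersection with boundedly many codewords only; let `N` be the set of their
vertices. Edges with more than `y` vertices in `N` are at most `O(n ^ (z - y - 1))` many, hence
negligible by density even after summing over the `k` centers. Every other edge is at distance at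
least about `(z - y) * m`. Two of them that meet `N` in different `y`-sets cannot both be much
closer than `(z - y + 1) * m`: the two `y`-sets compete for the same ones of the center. So each
center serves, up to negligible terms, only the edges through one `y`-set at the low price `(z - y)
* m`, and all others cost `(z - y + 1) * m` (`Codewords.exists_best`, `Codewords.le_sum_diffCard`).
If at most `α * |E|` edges are covered, the total is about `(z - y + 1 - α) * m * |E|`, which gives
the ratio `1 + (1 - α) / (z - y)`.

The codewords are chosen greedily among concatenations of `m` one-hot blocks of length `q`. All `q ^
m` words can be enumerated because `m` is logarithmic in `|E|`, and an exponential-moment count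
shows that the greedy choice yields at least `z * 2 ^ m` words, which exceeds the number `≤ z * |E|`
of used vertices (`pow_le_length_code`).

Density says something only when the number of vertices is large. Instances with at most `N₀`
vertices are solved outright: if `k ≥ 2 ^ N₀` they are complete, and otherwise only finitely many
words remain, which are looked up in a table.

The hypothesis supplies Turing machines, so the map on strings must be appended to an arbitrary
machine. For this a structured language on four stacks is compiled to `TM2` statements
(`Exec.stepsTo`) and run after the given machine (`PolyTime.after`). The predicate `PolyT` collects
functions computed by such programs in polynomial time; its closure properties, above all under
folds with small intermediate results, make `PolyT.reduction` a composition of list operations.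

The second claim is the case `y = z - 1`, `α = 1 - 1/e + δ` of the first. -/

/-! ### Stack programs and their compilation to `TM2` machines -/

/-- The stacks of a stack program. -/
inductive Reg
  | main | left | right | depth
  deriving DecidableEq

instance : Fintype Reg where
  elems := {.main, .left, .right, .depth}
  complete := by intro r; cases r <;> decide

/-- The symbols on the stacks: `some true` and `some false` are data, `none` is a separator. -/
abbrev Sym : Type := Option Bool

/-- The contents of the stacks. -/
abbrev Store : Type := Reg → List Sym

/-- Structured programs over the stacks. -/
inductive Prog
  | push (r : Reg) (a : Sym)
  | pop (r : Reg)
  | seq (p q : Prog)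
  | ite (r : Reg) (c : Option Sym → Bool) (p q : Prog)
  | while (r : Reg) (c : Option Sym → Bool) (p : Prog)

/-- Big-step semantics: the program leads from one store to another in the given number of steps. -/
inductive Exec : Prog → Store → Store → ℕ → Prop
  | push (r a s) : Exec (.push r a) s (Function.update s r (a :: s r)) 1
  | pop (r s) : Exec (.pop r) s (Function.update s r (s r).tail) 1
  | seq {p q s s' s'' t t'} : Exec p s s' t → Exec q s' s'' t' → Exec (.seq p q) s s'' (t + t')
  | ite_true {r c p q s s' t} : c (s r).head? = true → Exec p s s' t →
      Exec (.ite r c p q) s s' (1 + t)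
  | ite_false {r c p q s s' t} : c (s r).head? = false → Exec q s s' t →
      Exec (.ite r c p q) s s' (1 + t)
  | while_false {r c p s} : c (s r).head? = false → Exec (.while r c p) s s 1
  | while_true {r c p s s' s'' t t'} : c (s r).head? = true → Exec p s s' t →
      Exec (.while r c p) s' s'' t' → Exec (.while r c p) s s'' (1 + t + t')

namespace Prog

/-- The labels of the compiled program. -/
def Label : Prog → Type
  | push _ _ => Unit
  | pop _ => Unit
  | seq p q => p.Label ⊕ q.Label
  | ite _ _ p q => Option (p.Label ⊕ q.Label)
  | .while _ _ p => Option p.Label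

noncomputable instance fintypeLabel : (p : Prog) → Fintype p.Label
  | push _ _ => inferInstanceAs (Fintype Unit)
  | pop _ => inferInstanceAs (Fintype Unit)
  | seq p q =>
    letI := fintypeLabel p
    letI := fintypeLabel q
    inferInstanceAs (Fintype (p.Label ⊕ q.Label))
  | ite _ _ p q =>
    letI := fintypeLabel p
    letI := fintypeLabel q
    inferInstanceAs (Fintype (Option (p.Label ⊕ q.Label)))
  | .while _ _ p =>
    letI := fintypeLabel p
    inferInstanceAs (Fintype (Option p.Label))

/-- The label at which the compiled program starts. -/
def entry : (p : Prog) → p.Label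
  | push _ _ => ()
  | pop _ => ()
  | seq p _ => Sum.inl p.entry
  | ite _ _ _ _ => (none : Option _)
  | .while _ _ _ => (none : Option _)

variable {κ : Type} {Γ : κ → Type} {σ Λ : Type}

/-- The alphabets of a machine with additional stacks for a stack program. -/
abbrev Alphabet (Γ : κ → Type) : κ ⊕ Reg → Type
  | Sum.inl k => Γ k
  | Sum.inr _ => Sym

/-- The statements of the compiled program, which is left to `exit`. -/
def code : (p : Prog) → (p.Label → Λ) → Λ → p.Label →
    TM2.Stmt (Alphabet Γ) Λ (σ × Option Sym)
  | push r a, _, exit, _ => .push (Sum.inr r) (fun _ => a) (.goto fun _ => exit)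
  | pop r, _, exit, _ => .pop (Sum.inr r) (fun s _ => s) (.goto fun _ => exit)
  | seq p q, emb, exit, l =>
    Sum.elim (code p (fun l => emb (Sum.inl l)) (emb (Sum.inr q.entry)))
      (code q (fun l => emb (Sum.inr l)) exit) l
  | ite r c p q, emb, exit, l =>
    Option.elim (α := p.Label ⊕ q.Label) l
      (.peek (Sum.inr r) (fun s x => (s.1, x)) (.branch (fun s => c s.2)
        (.goto fun _ => emb (some (Sum.inl p.entry)))
        (.goto fun _ => emb (some (Sum.inr q.entry)))))
      (Sum.elim (code p (fun l => emb (some (Sum.inl l))) exit)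
        (code q (fun l => emb (some (Sum.inr l))) exit))
  | .while r c p, emb, exit, l =>
    Option.elim (α := p.Label) l
      (.peek (Sum.inr r) (fun s x => (s.1, x)) (.branch (fun s => c s.2)
        (.goto fun _ => emb (some p.entry)) (.goto fun _ => exit)))
      (code p (fun l => emb (some l)) (emb none))

end Prog

/-- The machine `M` leads from `c` to `c'` in `n` steps. -/
def StepsTo {K : Type} [DecidableEq K] {Γ : K → Type} {Λ σ : Type} (M : Λ → TM2.Stmt Γ Λ σ)
    (n : ℕ) (c c' : TM2.Cfg Γ Λ σ) : Prop :=
  (flip bind (TM2.step M))^[n] (some c) = some c'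

section StepsTo

variable {K : Type} [DecidableEq K] {Γ : K → Type} {Λ σ : Type} {M : Λ → TM2.Stmt Γ Λ σ}

theorem StepsTo.trans {n n' : ℕ} {c c' c'' : TM2.Cfg Γ Λ σ} (h : StepsTo M n c c')
    (h' : StepsTo M n' c' c'') : StepsTo M (n + n') c c'' := by
  unfold StepsTo at *
  rw [add_comm, Function.iterate_add_apply, h, h']

theorem StepsTo.one {l : Λ} {v : σ} {S : ∀ k, List (Γ k)} {c : TM2.Cfg Γ Λ σ}
    (h : TM2.stepAux (M l) v S = c) : StepsTo M 1 ⟨some l, v, S⟩ c := by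
  subst h; rfl

end StepsTo

/-- A store of the program together with the contents of the other stacks. -/
def combine {κ : Type} {Γ : κ → Type} (S : ∀ k, List (Γ k)) (s : Store) :
    ∀ k, List (Prog.Alphabet Γ k)
  | Sum.inl k => S k
  | Sum.inr r => s r

section combine

variable {κ : Type} [DecidableEq κ] {Γ : κ → Type} (S : ∀ k, List (Γ k)) (s : Store)

theorem update_combine_inr (r : Reg) (x : List Sym) :
    Function.update (combine S s) (Sum.inr r) x = combine S (Function.update s r x) := by
  funext k
  rcases k with k | r'
  · simp [combine]
  · by_cases h : r' = r
    · subst h; simp [combine]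
    · simp [combine, h]

theorem update_combine_inl (k : κ) (x : List (Γ k)) :
    Function.update (combine S s) (Sum.inl k) x = combine (Function.update S k x) s := by
  funext k'
  rcases k' with k' | r'
  · by_cases h : k' = k
    · subst h; simp [combine]
    · simp [combine, h]
  · simp [combine]

end combine

/-- The compiled program simulates the big-step semantics. -/
theorem Exec.stepsTo {κ : Type} [DecidableEq κ] {Γ : κ → Type} {σ Λ : Type}
    {M : Λ → TM2.Stmt (Prog.Alphabet Γ) Λ (σ × Option Sym)} (S : ∀ k, List (Γ k)) (v : σ)
    {p : Prog} {s s' : Store} {t : ℕ} (h : Exec p s s' t) :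
    ∀ (emb : p.Label → Λ) (exit : Λ), (∀ l, M (emb l) = p.code emb exit l) →
      ∀ b, ∃ b', StepsTo M t ⟨some (emb p.entry), (v, b), combine S s⟩
        ⟨some exit, (v, b'), combine S s'⟩ := by
  induction h with
  | push r a s =>
    intro emb exit hM b
    refine ⟨b, StepsTo.one ?_⟩
    rw [hM]
    simp only [Prog.code, TM2.stepAux]
    rw [update_combine_inr]
    rfl
  | pop r s =>
    intro emb exit hM b
    refine ⟨b, StepsTo.one ?_⟩
    rw [hM]
    simp only [Prog.code, TM2.stepAux]
    rw [update_combine_inr]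
    rfl
  | seq _ _ ih₁ ih₂ =>
    intro emb exit hM b
    obtain ⟨b₁, h₁⟩ := ih₁ _ _ (fun l => hM (Sum.inl l)) b
    obtain ⟨b₂, h₂⟩ := ih₂ _ _ (fun l => hM (Sum.inr l)) b₁
    exact ⟨b₂, h₁.trans h₂⟩
  | @ite_true r c p q s s' t hc _ ih =>
    intro emb exit hM b
    -- The test leaves the inspected symbol in the register, so the branch starts with that register
    -- content; this is why the claim holds for every `b`.
    obtain ⟨b₁, h₁⟩ := ih _ _ (fun l => hM (some (Sum.inl l))) (s r).head?
    refine ⟨b₁, StepsTo.trans (StepsTo.one ?_) h₁⟩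
    have := hM none
    simp only [Prog.entry]
    rw [this]
    simp only [Prog.code, Option.elim, TM2.stepAux, combine, hc, cond_true]
  | @ite_false r c p q s s' t hc _ ih =>
    intro emb exit hM b
    obtain ⟨b₁, h₁⟩ := ih _ _ (fun l => hM (some (Sum.inr l))) (s r).head?
    refine ⟨b₁, StepsTo.trans (StepsTo.one ?_) h₁⟩
    have := hM none
    simp only [Prog.entry]
    rw [this]
    simp only [Prog.code, Option.elim, TM2.stepAux, combine, hc, cond_false]
  | @while_false r c p s hc =>
    intro emb exit hM b
    refine ⟨(s r).head?, StepsTo.one ?_⟩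
    have := hM none
    simp only [Prog.entry]
    rw [this]
    simp only [Prog.code, Option.elim, TM2.stepAux, combine, hc, cond_false]
  | @while_true r c p s s' s'' t t' hc _ _ ih₁ ih₂ =>
    intro emb exit hM b
    obtain ⟨b₁, h₁⟩ := ih₁ _ _ (fun l => hM (some l)) (s r).head?
    obtain ⟨b₂, h₂⟩ := ih₂ _ _ hM b₁
    refine ⟨b₂, StepsTo.trans (StepsTo.trans (StepsTo.one ?_) h₁) h₂⟩
    have := hM none
    simp only [Prog.entry]
    rw [this]
    simp only [Prog.code, Option.elim, TM2.stepAux, combine, hc, cond_true]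

/-! ### Running a stack program after a machine -/

section lift

variable {κ : Type} {Γ : κ → Type} {σ Λ Λ' : Type}

/-- A statement on a machine with additional stacks that goes to `start` instead of halting. -/
def liftStmt (start : Λ') : TM2.Stmt Γ Λ σ → TM2.Stmt (Prog.Alphabet Γ) (Λ ⊕ Λ') (σ × Option Sym)
  | .push k f q => .push (Sum.inl k) (fun s => f s.1) (liftStmt start q)
  | .peek k f q => .peek (Sum.inl k) (fun s x => (f s.1 x, s.2)) (liftStmt start q)
  | .pop k f q => .pop (Sum.inl k) (fun s x => (f s.1 x, s.2)) (liftStmt start q)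
  | .load f q => .load (fun s => (f s.1, s.2)) (liftStmt start q)
  | .branch c q q' => .branch (fun s => c s.1) (liftStmt start q) (liftStmt start q')
  | .goto l => .goto (fun s => Sum.inl (l s.1))
  | .halt => .goto (fun _ => Sum.inr start)

/-- A configuration on a machine with additional stacks. -/
def liftCfg (start : Λ') (s : Store) (b : Option Sym) (c : TM2.Cfg Γ Λ σ) :
    TM2.Cfg (Prog.Alphabet Γ) (Λ ⊕ Λ') (σ × Option Sym) :=
  ⟨some (c.l.elim (Sum.inr start) Sum.inl), (c.var, b), combine c.stk s⟩

variable [DecidableEq κ]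

/-- Lifted statements never touch the additional stacks or the additional register. Halting becomes
a jump to `start`, and `liftCfg` accordingly displays a halted configuration as one at the label
`start`. -/
theorem stepAux_liftStmt (start : Λ') (s : Store) (b : Option Sym) (q : TM2.Stmt Γ Λ σ) :
    ∀ (v : σ) (S : ∀ k, List (Γ k)),
      TM2.stepAux (liftStmt start q) (v, b) (combine S s) =
        liftCfg start s b (TM2.stepAux q v S) := by
  induction q with
  | push k f q ih =>
    intro v S
    simp only [liftStmt, TM2.stepAux]
    rw [update_combine_inl, ← ih]
    rfl
  | peek k f q ih => intro v S; simp only [liftStmt, TM2.stepAux]; rw [← ih]; rfl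
  | pop k f q ih =>
    intro v S
    simp only [liftStmt, TM2.stepAux]
    rw [update_combine_inl, ← ih]
    rfl
  | load f q ih => intro v S; simp only [liftStmt, TM2.stepAux]; rw [← ih]
  | branch c q q' ih ih' =>
    intro v S
    simp only [liftStmt, TM2.stepAux]
    cases c v
    · exact ih' v S
    · exact ih v S
  | goto l => intro v S; rfl
  | halt => intro v S; rfl

theorem stepsTo_lift {start : Λ'} {M : Λ → TM2.Stmt Γ Λ σ}
    {M' : Λ ⊕ Λ' → TM2.Stmt (Prog.Alphabet Γ) (Λ ⊕ Λ') (σ × Option Sym)}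
    (hM : ∀ l, M' (Sum.inl l) = liftStmt start (M l)) (s : Store) (b : Option Sym) (n : ℕ) :
    ∀ {c c' : TM2.Cfg Γ Λ σ}, StepsTo M n c c' →
      StepsTo M' n (liftCfg start s b c) (liftCfg start s b c') := by
  induction n with
  | zero =>
    intro c c' h
    cases Option.some.inj h
    rfl
  | succ n ih =>
    intro c c' h
    obtain ⟨l, v, S⟩ := c
    cases l with
    | none =>
      -- A halted configuration has no successor, so it cannot be the start of `n + 1` steps.
      exfalso
      unfold StepsTo at h
      rw [Function.iterate_succ_apply] at h
      have hn : ∀ n, (flip bind (TM2.step M))^[n] none = none := by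
        intro n
        induction n with
        | zero => rfl
        | succ n ih => rw [Function.iterate_succ_apply]; exact ih
      have : flip bind (TM2.step M) (some ⟨none, v, S⟩) = none := rfl
      rw [this, hn] at h
      cases h
    | some l =>
      have h' : StepsTo M n (TM2.stepAux (M l) v S) c' := h
      have h1 : StepsTo M' 1 (liftCfg start s b ⟨some l, v, S⟩)
          (liftCfg start s b (TM2.stepAux (M l) v S)) := by
        refine StepsTo.one ?_
        rw [show (Option.elim (some l) (Sum.inr start) Sum.inl : Λ ⊕ Λ') = Sum.inl l from rfl, hM,
          stepAux_liftStmt]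
      rw [add_comm]
      exact h1.trans (ih h')

end lift

/-- The store with the given stacks. -/
def st (a b c d : List Sym) : Store
  | .main => a
  | .left => b
  | .right => c
  | .depth => d

section st

variable (a b c d x : List Sym)

@[simp] theorem st_main : st a b c d .main = a := rfl
@[simp] theorem st_left : st a b c d .left = b := rfl
@[simp] theorem st_right : st a b c d .right = c := rfl
@[simp] theorem st_depth : st a b c d .depth = d := rfl

@[simp] theorem update_main : Function.update (st a b c d) .main x = st x b c d := by
  funext r; cases r <;> simp

@[simp] theorem update_left : Function.update (st a b c d) .left x = st a x c d := by
  funext r; cases r <;> simp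

@[simp] theorem update_right : Function.update (st a b c d) .right x = st a b x d := by
  funext r; cases r <;> simp

@[simp] theorem update_depth : Function.update (st a b c d) .depth x = st a b c x := by
  funext r; cases r <;> simp

end st

/-- The program computes the string function: strings are stored in reverse on `Reg.left`. -/
def Computes (p : Prog) (g : List Bool → List Bool) (T : ℕ → ℕ) : Prop :=
  ∀ w, ∃ t ≤ T w.length, Exec p (st [] (w.reverse.map some) [] [])
    (st [] ((g w).reverse.map some) [] []) t

section after

variable (tm : FinTM2) (e : tm.Γ tm.k₁ ≃ Bool) (p : Prog)

/-- The labels of the machine `tm` followed by the program `p`: the labels `none` and `some none`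
belong to the transfer of the string to and from the stacks of `p`. -/
abbrev AfterLabel : Type := tm.Λ ⊕ Option (Option p.Label)

/-- The statements of the machine `tm` followed by the program `p`. -/
def afterCode : AfterLabel tm p →
    TM2.Stmt (Prog.Alphabet tm.Γ) (AfterLabel tm p) (tm.σ × Option Sym)
  | Sum.inl l => liftStmt none (tm.m l)
  | Sum.inr none =>
    .pop (Sum.inl tm.k₁) (fun s x => (s.1, x.map fun a => some (e a)))
      (.branch (fun s => s.2.isSome)
        (.push (Sum.inr Reg.left) (fun s => s.2.getD none) (.goto fun _ => Sum.inr none))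
        (.goto fun _ => Sum.inr (some (some p.entry))))
  | Sum.inr (some none) =>
    .pop (Sum.inr Reg.left) (fun s x => (s.1, x))
      (.branch (fun s => s.2.isSome)
        (.push (Sum.inl tm.k₁) (fun s => e.symm ((s.2.getD none).getD false))
          (.goto fun _ => Sum.inr (some none)))
        (.load (fun _ => (tm.initialState, none)) .halt))
  | Sum.inr (some (some l)) =>
    p.code (fun l => Sum.inr (some (some l))) (Sum.inr (some none)) l

/-- The machine `tm` followed by the program `p`. -/
noncomputable def after : FinTM2 where
  K := tm.K ⊕ Reg
  kDecidableEq := inferInstance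
  kFin := letI := tm.kFin; inferInstance
  k₀ := Sum.inl tm.k₀
  k₁ := Sum.inl tm.k₁
  Γ := Prog.Alphabet tm.Γ
  Λ := AfterLabel tm p
  main := Sum.inl tm.main
  ΛFin := letI := tm.ΛFin; inferInstance
  σ := tm.σ × Option Sym
  initialState := (tm.initialState, none)
  σFin := letI := tm.σFin; inferInstance
  Γk₀Fin := tm.Γk₀Fin
  m := afterCode tm e p

/-- The stacks of `tm` that are empty except for the output stack. -/
def outStk (l : List (tm.Γ tm.k₁)) : ∀ k, List (tm.Γ k) :=
  Function.update (fun _ => []) tm.k₁ l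

theorem haltList_stk (l : List (tm.Γ tm.k₁)) : (haltList tm l).stk = outStk tm l := by
  funext k
  by_cases h : k = tm.k₁
  · subst h; simp [haltList, outStk]
  · simp [haltList, outStk, h]

theorem length_initList_le (l : List (tm.Γ tm.k₀)) (k : tm.K) :
    ((initList tm l).stk k).length ≤ l.length := by
  by_cases h : k = tm.k₀
  · subst h
    exact le_of_eq (congrArg List.length (by simp [initList]))
  · simp [initList, h]

theorem haltList_after (l : List (tm.Γ tm.k₁)) :
    haltList (after tm e p) l =
      (⟨none, (tm.initialState, none), combine (outStk tm l) (st [] [] [] [])⟩ :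
        TM2.Cfg (Prog.Alphabet tm.Γ) (AfterLabel tm p) (tm.σ × Option Sym)) := by
  unfold haltList
  congr 1
  funext k
  rcases k with k | r
  · by_cases h : k = tm.k₁
    · subst h; simp [after, outStk, combine]; rfl
    · simp [after, outStk, combine, h]
  · cases r <;> simp [after, combine]

theorem initList_after (l : List (tm.Γ tm.k₀)) :
    initList (after tm e p) l = liftCfg none (st [] [] [] []) none (initList tm l) := by
  unfold initList
  simp only [liftCfg, Option.elim]
  congr 1
  funext k
  rcases k with k | r
  · by_cases h : k = tm.k₀
    · subst h; simp [after, combine]; rfl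
    · simp [after, combine, h]
  · cases r <;> simp [after, combine]

/-- Popping from one stack and pushing on another reverses the string; this is the origin of the
reversed strings in `Computes`. -/
theorem stepsTo_transfer_in (v : tm.σ) (l : List (tm.Γ tm.k₁)) :
    ∀ (b : List Sym) (o : Option Sym), StepsTo (afterCode tm e p) (l.length + 1)
      ⟨some (Sum.inr none), (v, o), combine (outStk tm l) (st [] b [] [])⟩
      ⟨some (Sum.inr (some (some p.entry))), (v, none),
        combine (outStk tm []) (st [] ((l.map fun a => some (e a)).reverse ++ b) [] [])⟩ := by
  induction l with
  | nil =>
    intro b o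
    refine StepsTo.one ?_
    simp only [afterCode, TM2.stepAux]
    rw [update_combine_inl]
    simp [combine, outStk]
  | cons a l ih =>
    intro b o
    have h1 := ih (some (e a) :: b) (some (some (e a)))
    rw [List.length_cons, add_comm (l.length + 1)]
    simp only [List.map_cons, List.reverse_cons, List.append_assoc, List.singleton_append]
    refine StepsTo.trans (StepsTo.one ?_) h1
    simp only [afterCode, TM2.stepAux]
    rw [update_combine_inl]
    simp only [combine, outStk, Function.update_self, List.head?_cons, Option.map_some,
      Option.isSome_some, cond_true, Option.getD_some, List.tail_cons, Function.update_idem]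
    erw [update_combine_inr]
    simp

/-- The second transfer undoes the reversal. The registers are reset because `haltList` prescribes
the initial state. -/
theorem stepsTo_transfer_out (v : tm.σ) (w : List Bool) :
    ∀ (l : List (tm.Γ tm.k₁)) (o : Option Sym), StepsTo (afterCode tm e p) (w.length + 1)
      ⟨some (Sum.inr (some none)), (v, o), combine (outStk tm l) (st [] (w.map some) [] [])⟩
      ⟨none, (tm.initialState, none),
        combine (outStk tm ((w.map e.symm).reverse ++ l)) (st [] [] [] [])⟩ := by
  induction w with
  | nil =>
    intro b o
    refine StepsTo.one ?_
    simp only [afterCode, TM2.stepAux]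
    rw [update_combine_inr]
    simp [combine, outStk]
  | cons a w ih =>
    intro l o
    have h1 := ih (e.symm a :: l) (some (some a))
    rw [List.length_cons, add_comm (w.length + 1)]
    simp only [List.map_cons, List.reverse_cons, List.append_assoc, List.singleton_append]
    refine StepsTo.trans (StepsTo.one ?_) h1
    simp only [afterCode, TM2.stepAux]
    rw [update_combine_inr]
    simp only [combine, st_left, List.head?_cons, Option.isSome_some, cond_true,
      Option.getD_some, List.tail_cons, update_left]
    erw [update_combine_inl]
    simp [outStk]

end after

/-! ### Growth of stacks -/

section growth

variable {K : Type} {Γ : K → Type} {Λ σ : Type}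

/-- The number of push instructions in a statement. -/
def pushes : TM2.Stmt Γ Λ σ → ℕ
  | .push _ _ q => pushes q + 1
  | .peek _ _ q => pushes q
  | .pop _ _ q => pushes q
  | .load _ q => pushes q
  | .branch _ q q' => pushes q + pushes q'
  | .goto _ => 0
  | .halt => 0

variable [DecidableEq K]

theorem length_stepAux_le (k : K) (q : TM2.Stmt Γ Λ σ) : ∀ (v : σ) (S : ∀ k, List (Γ k)),
    ((TM2.stepAux q v S).stk k).length ≤ (S k).length + pushes q := by
  induction q with
  | push k' f q ih =>
    intro v S
    refine (ih _ _).trans ?_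
    by_cases h : k = k'
    · subst h; simp [pushes]; omega
    · simp [pushes, h]
  | peek k' f q ih => intro v S; exact ih _ _
  | pop k' f q ih =>
    intro v S
    refine (ih _ _).trans ?_
    by_cases h : k = k'
    · subst h; simp [pushes]
    · simp [pushes, h]
  | load f q ih => intro v S; exact ih _ _
  | branch c q q' ih ih' =>
    intro v S
    simp only [TM2.stepAux, pushes]
    cases c v
    · exact (ih' v S).trans (by omega)
    · exact (ih v S).trans (by omega)
  | goto l => intro v S; exact le_rfl
  | halt => intro v S; exact le_rfl

/-- A step adds at most `b` symbols to a stack. Hence the output of a polynomial-time machine, which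
is the input of the program run after it, has polynomial length. -/
theorem StepsTo.length_le {M : Λ → TM2.Stmt Γ Λ σ} {b : ℕ} (hb : ∀ l, pushes (M l) ≤ b) (k : K)
    (n : ℕ) : ∀ {c c' : TM2.Cfg Γ Λ σ}, StepsTo M n c c' →
      (c'.stk k).length ≤ (c.stk k).length + n * b := by
  induction n with
  | zero =>
    intro c c' h
    cases Option.some.inj h
    simp
  | succ n ih =>
    intro c c' h
    unfold StepsTo at h
    rw [Function.iterate_succ_apply'] at h
    obtain ⟨c₁, h₁, h₂⟩ := Option.bind_eq_some_iff.mp h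
    have h₃ : (c'.stk k).length ≤ (c₁.stk k).length + b := ?_
    · have := ih h₁
      rw [Nat.succ_mul]
      omega
    · obtain ⟨l, v, S⟩ := c₁
      cases l with
      | none => cases h₂
      | some l =>
        cases Option.some.inj h₂
        exact (length_stepAux_le k _ v S).trans (Nat.add_le_add_left (hb l) _)

end growth

/-- Each step pushes at most one symbol, so time bounds are also bounds on the size of results. -/
theorem Exec.length_le {p : Prog} {s s' : Store} {t : ℕ} (h : Exec p s s' t) :
    ∑ r, (s' r).length ≤ ∑ r, (s r).length + t := by
  have key : ∀ (s : Store) (r : Reg) (l : List Sym), l.length ≤ (s r).length + 1 →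
      ∑ r', (Function.update s r l r').length ≤ ∑ r', (s r').length + 1 := by
    intro s r l hl
    rw [← Finset.add_sum_erase _ _ (Finset.mem_univ r),
      ← Finset.add_sum_erase _ (fun r' => (s r').length) (Finset.mem_univ r)]
    have : ∑ x ∈ Finset.univ.erase r, (Function.update s r l x).length =
        ∑ x ∈ Finset.univ.erase r, (s x).length :=
      Finset.sum_congr rfl fun x hx => by simp [Finset.ne_of_mem_erase hx]
    rw [this, Function.update_self]
    omega
  induction h with
  | push r a s => exact key _ _ _ (by simp)
  | pop r s => exact key _ _ _ (by simp; omega)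
  | seq _ _ ih ih' => omega
  | ite_true _ _ ih => omega
  | ite_false _ _ ih => omega
  | while_false _ => omega
  | while_true _ _ _ ih ih' => omega

theorem Computes.length_le {p : Prog} {g : List Bool → List Bool} {T : ℕ → ℕ}
    (h : Computes p g T) (w : List Bool) : (g w).length ≤ w.length + T w.length := by
  obtain ⟨t, ht, h⟩ := h w
  have := h.length_le
  have e : ∀ a b c d : List Sym, ∑ r, (st a b c d r).length =
      a.length + (b.length + (c.length + d.length)) := by
    intro a b c d
    simp [Finset.univ, Fintype.elems]
  simp only [e, List.length_nil, List.length_map, List.length_reverse] at this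
  omega

theorem eval_mono (P : Polynomial ℕ) : Monotone P.eval := by
  intro a b h
  induction P using Polynomial.induction_on' with
  | add p q hp hq => simp only [Polynomial.eval_add]; exact Nat.add_le_add hp hq
  | monomial n c =>
    simp only [Polynomial.eval_monomial]
    exact Nat.mul_le_mul_left _ (Nat.pow_le_pow_left h n)

/-- A function computed by a stack program in polynomial time can be applied after a polynomial-time
computable function. -/
theorem PolyTime.after {f g : List Bool → List Bool} {p : Prog} {T : Polynomial ℕ}
    (hf : PolyTime f) (hg : Computes p g T.eval) : PolyTime (fun w => g (f w)) := by
  obtain ⟨⟨⟨tm, e₀, e₁⟩, T₀, hout⟩⟩ := hf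
  obtain ⟨b, hb⟩ : ∃ b, ∀ l, pushes (tm.m l) ≤ b := by
    let := tm.ΛFin
    exact ⟨∑ l, pushes (tm.m l), fun l =>
      Finset.single_le_sum (f := fun l => pushes (tm.m l)) (fun _ _ => Nat.zero_le _)
        (Finset.mem_univ l)⟩
  -- `L` bounds the length of `f w`. The summands of `T'` pay for the machine, the transfer in, the
  -- program on an input of length at most `L`, and the transfer out of an output of length at most
  -- `L + T(L)`.
  let L : Polynomial ℕ := Polynomial.X + T₀ * Polynomial.C b
  let T' : Polynomial ℕ := T₀ + (L + 1) + T.comp L + (L + T.comp L + 1)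
  have main : ∀ w, ∃ n ≤ T'.eval w.length, StepsTo (afterCode tm e₁ p) n
      (liftCfg none (st [] [] [] []) none (initList tm (w.map e₀.symm)))
      ⟨none, (tm.initialState, none),
        combine (outStk tm ((g (f w)).map e₁.symm)) (st [] [] [] [])⟩ := by
    intro w
    obtain ⟨⟨n₀, h₀⟩, hn₀⟩ := hout w
    have h₀' : StepsTo tm.m n₀ (initList tm (w.map e₀.symm)) (haltList tm ((f w).map e₁.symm)) := h₀
    have hlen : (f w).length ≤ L.eval w.length := by
      have h1 := h₀'.length_le hb tm.k₁ n₀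
      have h2 : ((initList tm (w.map e₀.symm)).stk tm.k₁).length ≤ w.length := by
        have := length_initList_le tm (w.map e₀.symm) tm.k₁
        rwa [List.length_map] at this
      rw [haltList_stk] at h1
      simp only [outStk, Function.update_self, List.length_map] at h1
      simp only [L, Polynomial.eval_add, Polynomial.eval_X, Polynomial.eval_mul,
        Polynomial.eval_C]
      exact h1.trans (Nat.add_le_add h2 (Nat.mul_le_mul_right _ hn₀))
    have s1 := stepsTo_lift (start := none) (M' := afterCode tm e₁ p) (fun l => rfl)
      (st [] [] [] []) none n₀ h₀'
    have s2 := stepsTo_transfer_in tm e₁ p tm.initialState ((f w).map e₁.symm) [] none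
    obtain ⟨t, ht, hex⟩ := hg (f w)
    obtain ⟨o, s3⟩ := hex.stepsTo (M := afterCode tm e₁ p) (outStk tm []) tm.initialState
      (fun l => Sum.inr (some (some l))) (Sum.inr (some none)) (fun l => rfl) none
    have s4 := stepsTo_transfer_out tm e₁ p tm.initialState (g (f w)).reverse [] o
    have hglen := hg.length_le (f w)
    have hT := eval_mono T hlen
    refine ⟨n₀ + (((f w).map e₁.symm).length + 1) + t + ((g (f w)).reverse.length + 1), ?_, ?_⟩
    · simp only [T', Polynomial.eval_add, Polynomial.eval_comp, Polynomial.eval_one,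
        List.length_map, List.length_reverse]
      have h₁ : n₀ ≤ T₀.eval w.length := hn₀
      have h₂ : t ≤ T.eval (f w).length := ht
      have h₃ : T.eval (f w).length ≤ T.eval (L.eval w.length) := hT
      omega
    · refine StepsTo.trans (StepsTo.trans (StepsTo.trans s1 ?_) s3) ?_
      · have e2 : (((f w).map e₁.symm).map fun a => some (e₁ a)).reverse ++ [] =
            (f w).reverse.map some := by
          simp [List.map_map, Function.comp_def]
        rw [e2] at s2
        simp only [liftCfg, haltList_stk]
        exact s2
      · convert s4 using 2
        simp
  refine ⟨⟨⟨KMedianL1.after tm e₁ p, e₀, e₁⟩, T', fun w => ?_⟩⟩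
  have h := main w
  exact ⟨⟨h.choose, (congrArg
    (fun c => (flip bind (TM2.step (afterCode tm e₁ p)))^[h.choose] (some c))
    (initList_after tm e₁ p (w.map e₀.symm))).trans (Eq.trans h.choose_spec.2
    (congrArg some (haltList_after tm e₁ p ((g (f w)).map e₁.symm)).symm))⟩, h.choose_spec.1⟩

/-! ### Running times -/

/-- The program leads from one store to another in at most `T` steps. -/
def Runs (p : Prog) (s s' : Store) (T : ℕ) : Prop := ∃ t ≤ T, Exec p s s' t

section Runs

variable {p q : Prog} {s s' s'' : Store} {T T' : ℕ} {r : Reg} {k : Option Sym → Bool}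

theorem Runs.mono (h : Runs p s s' T) (hT : T ≤ T') : Runs p s s' T' :=
  let ⟨t, ht, h⟩ := h
  ⟨t, ht.trans hT, h⟩

theorem Runs.seq (h : Runs p s s' T) (h' : Runs q s' s'' T') :
    Runs (p.seq q) s s'' (T + T') :=
  let ⟨_, ht, h⟩ := h
  let ⟨_, ht', h'⟩ := h'
  ⟨_, Nat.add_le_add ht ht', .seq h h'⟩

theorem Runs.ite_true (hk : k (s r).head? = true) (h : Runs p s s' T) :
    Runs (.ite r k p q) s s' (1 + T) :=
  let ⟨_, ht, h⟩ := h
  ⟨_, Nat.add_le_add_left ht 1, .ite_true hk h⟩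

theorem Runs.ite_false (hk : k (s r).head? = false) (h : Runs q s s' T) :
    Runs (.ite r k p q) s s' (1 + T) :=
  let ⟨_, ht, h⟩ := h
  ⟨_, Nat.add_le_add_left ht 1, .ite_false hk h⟩

theorem Runs.while_false (hk : k (s r).head? = false) : Runs (.while r k p) s s 1 :=
  ⟨1, le_rfl, .while_false hk⟩

theorem Runs.while_true (hk : k (s r).head? = true) (h : Runs p s s' T)
    (h' : Runs (.while r k p) s' s'' T') : Runs (.while r k p) s s'' (1 + T + T') :=
  let ⟨_, ht, h⟩ := h
  let ⟨_, ht', h'⟩ := h'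
  ⟨_, by omega, .while_true hk h h'⟩

variable (x : Sym) (a b c d : List Sym)

theorem push_main : Runs (.push .main x) (st a b c d) (st (x :: a) b c d) 1 :=
  ⟨1, le_rfl, by simpa using Exec.push .main x (st a b c d)⟩

theorem push_left : Runs (.push .left x) (st a b c d) (st a (x :: b) c d) 1 :=
  ⟨1, le_rfl, by simpa using Exec.push .left x (st a b c d)⟩

theorem push_right : Runs (.push .right x) (st a b c d) (st a b (x :: c) d) 1 :=
  ⟨1, le_rfl, by simpa using Exec.push .right x (st a b c d)⟩

theorem push_depth : Runs (.push .depth x) (st a b c d) (st a b c (x :: d)) 1 :=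
  ⟨1, le_rfl, by simpa using Exec.push .depth x (st a b c d)⟩

theorem pop_main : Runs (.pop .main) (st (x :: a) b c d) (st a b c d) 1 :=
  ⟨1, le_rfl, by simpa using Exec.pop .main (st (x :: a) b c d)⟩

theorem pop_left : Runs (.pop .left) (st a (x :: b) c d) (st a b c d) 1 :=
  ⟨1, le_rfl, by simpa using Exec.pop .left (st a (x :: b) c d)⟩

theorem pop_right : Runs (.pop .right) (st a b (x :: c) d) (st a b c d) 1 :=
  ⟨1, le_rfl, by simpa using Exec.pop .right (st a b (x :: c) d)⟩

theorem pop_depth : Runs (.pop .depth) (st a b c (x :: d)) (st a b c d) 1 :=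
  ⟨1, le_rfl, by simpa using Exec.pop .depth (st a b c (x :: d))⟩

end Runs

/-! ### Values on the stacks -/

/-- The values manipulated by programs. -/
inductive Val
  | nil
  | cons (u v : Val)

namespace Val

/-- The prefix notation of a value. -/
def bits : Val → List Bool
  | nil => [false]
  | cons u v => true :: (u.bits ++ v.bits)

/-- The symbols that represent a value on a stack. -/
def toks (v : Val) : List Sym := v.bits.map some

/-- The number of symbols of a value. -/
def size : Val → ℕ
  | nil => 1
  | cons u v => 1 + u.size + v.size

theorem length_toks (v : Val) : v.toks.length = v.size := by
  unfold toks
  rw [List.length_map]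
  induction v with
  | nil => rfl
  | cons u v ihu ihv => simp [bits, size, ihu, ihv]; omega

theorem one_le_size (v : Val) : 1 ≤ v.size := by
  cases v <;> simp [size]; omega

@[simp] theorem toks_nil : nil.toks = [some false] := rfl

@[simp] theorem toks_cons (u v : Val) : (cons u v).toks = some true :: (u.toks ++ v.toks) := by
  simp [toks, bits]

end Val

/-- The test whether the top of a stack is `some true`. -/
def isTrue (o : Option Sym) : Bool := o == some (some true)

/-- The test whether the top of a stack is a data symbol. -/
def isData (o : Option Sym) : Bool := (o.getD none).isSome

/-- Read a value from `Reg.main`, running `e b` for each symbol `b`. -/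
def walkLoop (e : Bool → Prog) : Prog :=
  .while .depth isData (.ite .main isTrue
    ((e true).seq ((Prog.pop .main).seq (.push .depth (some true))))
    ((e false).seq ((Prog.pop .main).seq (.pop .depth))))

/-- Read a value from `Reg.main`, running `e b` for each symbol `b`. -/
def walk (e : Bool → Prog) : Prog := (Prog.push .depth (some true)).seq (walkLoop e)

/-- Put a list on top of a stack in reverse if the flag is set. -/
def revOnto (β : Bool) (l b : List Sym) : List Sym := if β then l.reverse ++ b else b

section moves

variable {e : Bool → Prog} {β γ : Bool}

/-- The height of `Reg.depth` is the number of values still to be read: the tag of `cons` replaces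
one pending value by two, and `nil` completes one. Stating the claim with an arbitrary continuation
of the loop lets the induction hypotheses for both subtrees be chained. Each symbol costs six steps:
two tests, two for `e`, one pop, and one update of the depth. -/
theorem walkLoop_runs
    (he : ∀ x a b c d, Runs (e x) (st a b c d)
      (st a (revOnto β [some x] b) (revOnto γ [some x] c) d) 2) (v : Val) :
    ∀ a b c d s T, Runs (walkLoop e) (st a (revOnto β v.toks b) (revOnto γ v.toks c) d) s T →
      Runs (walkLoop e) (st (v.toks ++ a) b c (some true :: d)) s (6 * v.size + T) := by
  induction v with
  | nil =>
    intro a b c d s T h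
    have h1 := (he false (some false :: a) b c (some true :: d)).seq
      ((pop_main (some false) a _ _ _).seq (pop_depth (some true) a _ _ d))
    exact (Runs.while_true rfl (Runs.ite_false rfl h1) h).mono (by simp [Val.size])
  | cons u v ihu ihv =>
    intro a b c d s T h
    have h1 := (he true (some true :: (u.toks ++ (v.toks ++ a))) b c (some true :: d)).seq
      ((pop_main (some true) _ _ _ _).seq (push_depth (some true) _ _ _ _))
    have h2 : ∀ (δ : Bool) (b : List Sym), revOnto δ (Val.cons u v).toks b =
        revOnto δ v.toks (revOnto δ u.toks (revOnto δ [some true] b)) := by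
      intro δ b
      cases δ <;> simp [revOnto]
    rw [h2, h2] at h
    have h3 := Runs.while_true rfl (Runs.ite_true rfl h1) (ihu _ _ _ _ _ _ (ihv _ _ _ _ _ _ h))
    have h4 : (Val.cons u v).toks ++ a = some true :: (u.toks ++ (v.toks ++ a)) := by simp
    rw [h4]
    exact h3.mono (by simp [Val.size]; omega)

theorem walk_runs
    (he : ∀ x a b c d, Runs (e x) (st a b c d)
      (st a (revOnto β [some x] b) (revOnto γ [some x] c) d) 2) (v : Val) (a b c : List Sym) :
    Runs (walk e) (st (v.toks ++ a) b c [])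
      (st a (revOnto β v.toks b) (revOnto γ v.toks c) []) (6 * v.size + 2) :=
  ((push_depth _ _ _ _ _).seq (walkLoop_runs he v a b c [] _ _ (Runs.while_false rfl))).mono
    (by omega)

/-- Discard the top value. -/
def drop : Prog := walk fun _ => (Prog.push .left none).seq (.pop .left)

theorem drop_runs (v : Val) (a b c : List Sym) :
    Runs drop (st (v.toks ++ a) b c []) (st a b c []) (6 * v.size + 2) :=
  walk_runs (β := false) (γ := false) (fun _ a b c d =>
    (push_left none a b c d).seq (pop_left none a b c d)) v a b c

/-- Move the top value to `Reg.left`. -/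
def moveLeft : Prog := (Prog.push .left none).seq (walk fun x => .push .left (some x))

theorem moveLeft_runs (v : Val) (a b c : List Sym) :
    Runs moveLeft (st (v.toks ++ a) b c []) (st a (v.toks.reverse ++ none :: b) c [])
      (6 * v.size + 3) :=
  ((push_left none _ b c []).seq (walk_runs (β := true) (γ := false) (fun x a b c d =>
    (push_left (some x) a b c d).mono one_le_two) v a (none :: b) c)).mono (by omega)

/-- Move the top value to `Reg.right`. -/
def moveRight : Prog := (Prog.push .right none).seq (walk fun x => .push .right (some x))

theorem moveRight_runs (v : Val) (a b c : List Sym) :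
    Runs moveRight (st (v.toks ++ a) b c []) (st a b (v.toks.reverse ++ none :: c) [])
      (6 * v.size + 3) :=
  ((push_right none _ b c []).seq (walk_runs (β := false) (γ := true) (fun x a b c d =>
    (push_right (some x) a b c d).mono one_le_two) v a b (none :: c))).mono (by omega)

/-- Move the top value to both `Reg.left` and `Reg.right`. -/
def moveBoth : Prog :=
  (Prog.push .left none).seq ((Prog.push .right none).seq
    (walk fun x => (Prog.push .left (some x)).seq (.push .right (some x))))

theorem moveBoth_runs (v : Val) (a b c : List Sym) :
    Runs moveBoth (st (v.toks ++ a) b c [])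
      (st a (v.toks.reverse ++ none :: b) (v.toks.reverse ++ none :: c) []) (6 * v.size + 4) :=
  ((push_left none _ b c []).seq ((push_right none _ _ c []).seq
    (walk_runs (β := true) (γ := true) (fun x a b c d =>
      (push_left (some x) a b c d).seq (push_right (some x) a _ c d)) v a (none :: b)
        (none :: c)))).mono (by omega)

/-- Move symbols from another stack to `Reg.main` up to a separator. -/
def backLoop (r : Reg) : Prog :=
  .while r isData (.ite r isTrue
    ((Prog.push .main (some true)).seq (.pop r)) ((Prog.push .main (some false)).seq (.pop r)))

/-- Move a value from another stack to `Reg.main`. -/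
def back (r : Reg) : Prog := (backLoop r).seq (.pop r)

theorem backLoop_left_runs (l : List Bool) : ∀ (a b c d : List Sym),
    Runs (backLoop .left) (st a (l.map some ++ none :: b) c d)
      (st (l.reverse.map some ++ a) (none :: b) c d) (4 * l.length + 1) := by
  induction l with
  | nil => exact fun a b c d => Runs.while_false rfl
  | cons x l ih =>
    intro a b c d
    have h := ih (some x :: a) b c d
    have e : (x :: l).reverse.map some ++ a = l.reverse.map some ++ some x :: a := by simp
    rw [e]
    cases x with
    | false =>
      exact (Runs.while_true rfl (Runs.ite_false rfl
        ((push_main _ _ _ _ _).seq (pop_left _ _ _ _ _))) h).mono (by simp; omega)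
    | true =>
      exact (Runs.while_true rfl (Runs.ite_true rfl
        ((push_main _ _ _ _ _).seq (pop_left _ _ _ _ _))) h).mono (by simp; omega)

theorem backLoop_right_runs (l : List Bool) : ∀ (a b c d : List Sym),
    Runs (backLoop .right) (st a b (l.map some ++ none :: c) d)
      (st (l.reverse.map some ++ a) b (none :: c) d) (4 * l.length + 1) := by
  induction l with
  | nil => exact fun a b c d => Runs.while_false rfl
  | cons x l ih =>
    intro a b c d
    have h := ih (some x :: a) b c d
    have e : (x :: l).reverse.map some ++ a = l.reverse.map some ++ some x :: a := by simp
    rw [e]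
    cases x with
    | false =>
      exact (Runs.while_true rfl (Runs.ite_false rfl
        ((push_main _ _ _ _ _).seq (pop_right _ _ _ _ _))) h).mono (by simp; omega)
    | true =>
      exact (Runs.while_true rfl (Runs.ite_true rfl
        ((push_main _ _ _ _ _).seq (pop_right _ _ _ _ _))) h).mono (by simp; omega)

theorem back_left_runs (v : Val) (a b c d : List Sym) :
    Runs (back .left) (st a (v.toks.reverse ++ none :: b) c d) (st (v.toks ++ a) b c d)
      (4 * v.size + 2) := by
  have h := (backLoop_left_runs v.bits.reverse a b c d).seq (pop_left none _ b c d)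
  have hl := v.length_toks
  unfold Val.toks at hl ⊢
  rw [List.reverse_reverse, List.map_reverse] at h
  exact h.mono (by simp at hl ⊢; omega)

theorem back_right_runs (v : Val) (a b c d : List Sym) :
    Runs (back .right) (st a b (v.toks.reverse ++ none :: c) d) (st (v.toks ++ a) b c d)
      (4 * v.size + 2) := by
  have h := (backLoop_right_runs v.bits.reverse a b c d).seq (pop_right none _ b c d)
  have hl := v.length_toks
  unfold Val.toks at hl ⊢
  rw [List.reverse_reverse, List.map_reverse] at h
  exact h.mono (by simp at hl ⊢; omega)

/-- Duplicate the top value. -/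
def dup : Prog := moveBoth.seq ((back .left).seq (back .right))

theorem dup_runs (v : Val) (a b c : List Sym) :
    Runs dup (st (v.toks ++ a) b c []) (st (v.toks ++ (v.toks ++ a)) b c [])
      (14 * v.size + 8) :=
  ((moveBoth_runs v a b c).seq ((back_left_runs v a b _ []).seq
    (back_right_runs v _ b c []))).mono (by omega)

/-- Exchange the two topmost values. -/
def swap : Prog := moveLeft.seq (moveRight.seq ((back .left).seq (back .right)))

theorem swap_runs (u v : Val) (a b c : List Sym) :
    Runs swap (st (u.toks ++ (v.toks ++ a)) b c []) (st (v.toks ++ (u.toks ++ a)) b c [])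
      (10 * (u.size + v.size) + 10) :=
  ((moveLeft_runs u _ b c).seq ((moveRight_runs v a _ c).seq ((back_left_runs u a b _ []).seq
    (back_right_runs v _ b c [])))).mono (by omega)

/-- Put a fixed value on `Reg.main`. -/
def pushVal : Val → Prog
  | .nil => .push .main (some false)
  | .cons u v => (pushVal v).seq ((pushVal u).seq (.push .main (some true)))

theorem pushVal_runs (v : Val) : ∀ (a b c d : List Sym),
    Runs (pushVal v) (st a b c d) (st (v.toks ++ a) b c d) v.size := by
  induction v with
  | nil => exact fun a b c d => push_main _ _ _ _ _
  | cons u v ihu ihv =>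
    intro a b c d
    have h := (ihv a b c d).seq ((ihu _ b c d).seq (push_main (some true) _ b c d))
    rw [Val.toks_cons, List.cons_append, List.append_assoc]
    exact h.mono (by simp [Val.size]; omega)

end moves

/-! ### Polynomial-time functions on data types -/

/-- Data types whose elements can be stored as values. -/
class Enc (α : Type) where
  /-- The value that represents an element. -/
  enc : α → Val

open KMedianL1.Enc (enc)

instance : Enc Bool := ⟨fun b => if b then .cons .nil .nil else .nil⟩

instance {α β : Type} [Enc α] [Enc β] : Enc (α × β) := ⟨fun x => .cons (enc x.1) (enc x.2)⟩

/-- The value that represents a list. -/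
def encList {α : Type} [Enc α] : List α → Val
  | [] => .nil
  | x :: l => .cons (enc x) (encList l)

instance {α : Type} [Enc α] : Enc (List α) := ⟨encList⟩

/-- The size of the representation of an element. -/
def sz {α : Type} [Enc α] (x : α) : ℕ := (enc x).size

section sz

variable {α β : Type} [Enc α] [Enc β]

theorem one_le_sz (x : α) : 1 ≤ sz x := Val.one_le_size _

theorem sz_bool_le (b : Bool) : sz b ≤ 3 := by
  cases b <;> simp [sz, enc, Val.size]

@[simp] theorem sz_pair (x : α × β) : sz x = 1 + sz x.1 + sz x.2 := rfl

@[simp] theorem sz_nil : sz ([] : List α) = 1 := rfl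

@[simp] theorem sz_cons (x : α) (l : List α) : sz (x :: l) = 1 + sz x + sz l := rfl

theorem sz_append (l l' : List α) : sz (l ++ l') + 1 = sz l + sz l' := by
  induction l with
  | nil => simp; omega
  | cons x l ih => simp; omega

theorem length_lt_sz (l : List α) : l.length < sz l := by
  induction l with
  | nil => simp
  | cons x l ih => simp; omega

theorem sz_le_of_mem {x : α} {l : List α} (h : x ∈ l) : sz x ≤ sz l := by
  induction l with
  | nil => simp at h
  | cons y l ih =>
    rcases List.mem_cons.mp h with rfl | h
    · simp; omega
    · have := ih h
      simp; omega

theorem sz_le_length_mul {l : List α} {b : ℕ} (h : ∀ x ∈ l, sz x ≤ b) :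
    sz l ≤ l.length * (b + 1) + 1 := by
  induction l with
  | nil => simp
  | cons x l ih =>
    have h1 := ih fun y hy => h y (List.mem_cons_of_mem _ hy)
    have h2 := h x List.mem_cons_self
    simp only [sz_cons, List.length_cons, Nat.succ_mul]
    omega

end sz

/-- A quantity that is polynomially bounded in the size of the argument. -/
def PolyBdd {α : Type} [Enc α] (t : α → ℕ) : Prop :=
  ∃ P : Polynomial ℕ, ∀ x, t x ≤ P.eval (sz x)

section PolyBdd

variable {α : Type} [Enc α] {t t' : α → ℕ}

theorem PolyBdd.mono (h : PolyBdd t') (hle : ∀ x, t x ≤ t' x) : PolyBdd t :=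
  let ⟨P, hP⟩ := h
  ⟨P, fun x => (hle x).trans (hP x)⟩

theorem PolyBdd.const (n : ℕ) : PolyBdd fun _ : α => n := ⟨Polynomial.C n, fun _ => by simp⟩

theorem PolyBdd.sz : PolyBdd fun x : α => sz x := ⟨Polynomial.X, fun _ => by simp⟩

theorem PolyBdd.add (h : PolyBdd t) (h' : PolyBdd t') : PolyBdd fun x => t x + t' x :=
  let ⟨P, hP⟩ := h
  let ⟨Q, hQ⟩ := h'
  ⟨P + Q, fun x => by simpa using Nat.add_le_add (hP x) (hQ x)⟩

theorem PolyBdd.mul (h : PolyBdd t) (h' : PolyBdd t') : PolyBdd fun x => t x * t' x :=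
  let ⟨P, hP⟩ := h
  let ⟨Q, hQ⟩ := h'
  ⟨P * Q, fun x => by simpa using Nat.mul_le_mul (hP x) (hQ x)⟩

theorem PolyBdd.pow (h : PolyBdd t) (n : ℕ) : PolyBdd fun x => t x ^ n :=
  let ⟨P, hP⟩ := h
  ⟨P ^ n, fun x => by simpa using Nat.pow_le_pow_left (hP x) n⟩

theorem PolyBdd.eval (h : PolyBdd t) (Q : Polynomial ℕ) : PolyBdd fun x => Q.eval (t x) :=
  let ⟨P, hP⟩ := h
  ⟨Q.comp P, fun x => by simpa using eval_mono Q (hP x)⟩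

end PolyBdd

/-- The program computes the function in the given time. -/
def ProgFor {α β : Type} [Enc α] [Enc β] (p : Prog) (f : α → β) (T : α → ℕ) : Prop :=
  ∀ x a b c, Runs p (st ((enc x).toks ++ a) b c []) (st ((enc (f x)).toks ++ a) b c []) (T x)

/-- Functions computed by stack programs in polynomial time. -/
def PolyT {α β : Type} [Enc α] [Enc β] (f : α → β) : Prop :=
  ∃ p T, PolyBdd T ∧ ProgFor p f T

namespace PolyT

variable {α β γ δ : Type} [Enc α] [Enc β] [Enc γ] [Enc δ]

/-- The result stands on a stack at the end of the run, and the stacks grow by at most one symbol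
per step. -/
theorem polyBdd {f : α → β} (h : PolyT f) : PolyBdd fun x => KMedianL1.sz (f x) := by
  obtain ⟨p, T, hT, hp⟩ := h
  refine (PolyBdd.sz.add hT).mono fun x => ?_
  obtain ⟨t, ht, h⟩ := hp x [] [] []
  have := h.length_le
  have e : ∀ a b c d : List Sym, ∑ r, (st a b c d r).length =
      a.length + (b.length + (c.length + d.length)) := by
    intro a b c d
    simp [Finset.univ, Fintype.elems]
  simp only [e, List.append_nil, Val.length_toks, List.length_nil] at this
  simp only [KMedianL1.sz]
  omega

theorem bdd_comp {f : α → β} (h : PolyT f) {t : β → ℕ} (ht : PolyBdd t) :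
    PolyBdd fun x => t (f x) := by
  obtain ⟨P, hP⟩ := ht
  exact (h.polyBdd.eval P).mono fun x => hP (f x)

theorem congr {f g : α → β} (h : PolyT f) (hfg : ∀ x, g x = f x) : PolyT g := by
  rwa [show g = f from funext hfg]

theorem comp {g : β → γ} {f : α → β} (hg : PolyT g) (hf : PolyT f) : PolyT fun x => g (f x) := by
  have hb := fun t (ht : PolyBdd t) => hf.bdd_comp (t := t) ht
  obtain ⟨p, T, hT, hp⟩ := hf
  obtain ⟨q, T', hT', hq⟩ := hg
  exact ⟨p.seq q, _, hT.add (hb T' hT'), fun x a b c => (hp x a b c).seq (hq (f x) a b c)⟩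

/-- A push followed by a pop serves as the empty program. -/
theorem id : PolyT fun x : α => x :=
  ⟨(Prog.push .left none).seq (.pop .left), _, PolyBdd.const 2, fun _ _ b c =>
    (push_left none _ b c []).seq (pop_left none _ b c [])⟩

theorem const (y : β) : PolyT fun _ : α => y :=
  ⟨drop.seq (pushVal (enc y)), _,
    (((PolyBdd.const 6).mul PolyBdd.sz).add (PolyBdd.const 2)).add (PolyBdd.const (enc y).size),
    fun x a b c => (drop_runs (enc x) a b c).seq (pushVal_runs (enc y) a b c [])⟩

theorem pair {f : α → β} {g : α → γ} (hf : PolyT f) (hg : PolyT g) :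
    PolyT fun x => (f x, g x) := by
  have bf := hf.polyBdd
  have bg := hg.polyBdd
  obtain ⟨p, T, hT, hp⟩ := hf
  obtain ⟨q, T', hT', hq⟩ := hg
  refine ⟨dup.seq (p.seq (swap.seq (q.seq (swap.seq (.push .main (some true)))))),
    fun x => (14 * KMedianL1.sz x + 8) + (T x + ((10 * (KMedianL1.sz (f x) + KMedianL1.sz x) + 10) +
      (T' x + ((10 * (KMedianL1.sz (g x) + KMedianL1.sz (f x)) + 10) + 1)))), ?_,
    fun x a b c => ?_⟩
  · exact (((PolyBdd.const 14).mul PolyBdd.sz).add (PolyBdd.const 8)).add (hT.add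
      ((((PolyBdd.const 10).mul (bf.add PolyBdd.sz)).add (PolyBdd.const 10)).add (hT'.add
        ((((PolyBdd.const 10).mul (bg.add bf)).add (PolyBdd.const 10)).add (PolyBdd.const 1)))))
  · have h := (dup_runs (enc x) a b c).seq ((hp x _ b c).seq ((swap_runs _ _ a b c).seq
      ((hq x _ b c).seq ((swap_runs _ _ a b c).seq (push_main (some true) _ b c [])))))
    have e : (enc (f x, g x)).toks ++ a =
        some true :: ((enc (f x)).toks ++ ((enc (g x)).toks ++ a)) := by
      simp [enc]
    rw [e]
    exact h

theorem fst' : PolyT fun x : α × β => x.1 := by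
  refine ⟨(Prog.pop .main).seq (swap.seq drop), fun x => 1 + ((10 * (KMedianL1.sz x.1 +
    KMedianL1.sz x.2) + 10) + (6 * KMedianL1.sz x.2 + 2)), ?_, fun x a b c => ?_⟩
  · refine (((PolyBdd.const 16).mul PolyBdd.sz).add (PolyBdd.const 13)).mono fun x => ?_
    rw [sz_pair]
    omega
  · have e : (enc x).toks ++ a = some true :: ((enc x.1).toks ++ ((enc x.2).toks ++ a)) := by
      simp [enc]
    rw [e]
    exact (pop_main _ _ _ _ _).seq ((swap_runs _ _ _ _ _).seq (drop_runs _ _ _ _))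

theorem snd' : PolyT fun x : α × β => x.2 := by
  refine ⟨(Prog.pop .main).seq drop, fun x => 1 + (6 * KMedianL1.sz x.1 + 2), ?_,
    fun x a b c => ?_⟩
  · refine (((PolyBdd.const 16).mul PolyBdd.sz).add (PolyBdd.const 13)).mono fun x => ?_
    rw [sz_pair]
    omega
  · have e : (enc x).toks ++ a = some true :: ((enc x.1).toks ++ ((enc x.2).toks ++ a)) := by
      simp [enc]
    rw [e]
    exact (pop_main _ _ _ _ _).seq (drop_runs _ _ _ _)

theorem fst {f : α → β × γ} (hf : PolyT f) : PolyT fun x => (f x).1 := fst'.comp hf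

theorem snd {f : α → β × γ} (hf : PolyT f) : PolyT fun x => (f x).2 := snd'.comp hf

/-- A nonempty list has the same encoding as the pair of its head and its tail, so the program for
pairs does the job unchanged. -/
theorem cons {f : α → β} {g : α → List β} (hf : PolyT f) (hg : PolyT g) :
    PolyT fun x => f x :: g x := by
  obtain ⟨p, T, hT, hp⟩ := hf.pair hg
  exact ⟨p, T, hT, hp⟩

theorem ite {k : α → Bool} {f g : α → β} (hk : PolyT k) (hf : PolyT f) (hg : PolyT g) :
    PolyT fun x => if k x then f x else g x := by
  obtain ⟨r, T₀, hT₀, hr⟩ := hk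
  obtain ⟨p, T, hT, hp⟩ := hf
  obtain ⟨q, T', hT', hq⟩ := hg
  refine ⟨dup.seq (r.seq (.ite .main isTrue
    -- The value of `true` occupies three symbols, that of `false` only one.
    (((Prog.pop .main).seq ((Prog.pop .main).seq (.pop .main))).seq p)
    ((Prog.pop .main).seq q))),
    fun x => (14 * KMedianL1.sz x + 8) + (T₀ x + (4 + T x + T' x)), ?_, fun x a b c => ?_⟩
  · exact (((PolyBdd.const 14).mul PolyBdd.sz).add (PolyBdd.const 8)).add
      (hT₀.add (((PolyBdd.const 4).add hT).add hT'))
  · refine (dup_runs (enc x) a b c).seq ((hr x _ b c).seq ?_)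
    dsimp only
    cases hx : k x with
    | true =>
      have h := Runs.ite_true (k := isTrue) (r := .main) (q := (Prog.pop .main).seq q) rfl
        (((pop_main (some true) _ b c []).seq ((pop_main (some false) _ b c []).seq
          (pop_main (some false) _ b c []))).seq (hp x a b c))
      rw [if_pos rfl]
      exact h.mono (by omega)
    | false =>
      have h := Runs.ite_false (k := isTrue) (r := .main)
        (p := ((Prog.pop .main).seq ((Prog.pop .main).seq (.pop .main))).seq p) rfl
        ((pop_main (some false) _ b c []).seq (hq x a b c))
      rw [if_neg Bool.false_ne_true]
      exact h.mono (by omega)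

theorem isEmpty {l : α → List β} (hl : PolyT l) : PolyT fun x => (l x).isEmpty := by
  refine comp (g := List.isEmpty) ?_ hl
  refine ⟨.ite .main isTrue (drop.seq (pushVal .nil)) (drop.seq (pushVal (enc true))),
    fun l => 1 + ((6 * KMedianL1.sz l + 2) + 3), ?_, fun l a b c => ?_⟩
  · exact (PolyBdd.const 1).add ((((PolyBdd.const 6).mul PolyBdd.sz).add (PolyBdd.const 2)).add
      (PolyBdd.const 3))
  · cases l with
    | nil => exact Runs.ite_false rfl ((drop_runs _ _ _ _).seq (pushVal_runs _ _ _ _ _))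
    | cons y l =>
      exact (Runs.ite_true rfl ((drop_runs (enc (y :: l)) _ _ _).seq
        (pushVal_runs .nil _ _ _ _))).mono (by simp [KMedianL1.sz, Val.size])

theorem tail {l : α → List β} (hl : PolyT l) : PolyT fun x => (l x).tail := by
  refine comp (g := List.tail) ?_ hl
  refine ⟨.ite .main isTrue ((Prog.pop .main).seq drop)
    ((Prog.push .left none).seq (.pop .left)),
    fun l => 6 * KMedianL1.sz l + 4, ?_, fun l a b c => ?_⟩
  · exact ((PolyBdd.const 6).mul PolyBdd.sz).add (PolyBdd.const 4)
  · cases l with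
    | nil =>
      refine (Runs.ite_false rfl ((push_left none _ b c []).seq (pop_left none _ b c []))).mono ?_
      dsimp only
      omega
    | cons y l =>
      have e : (enc (y :: l)).toks ++ a = some true :: ((enc y).toks ++ ((enc l).toks ++ a)) := by
        simp [enc, encList]
      rw [e]
      refine (Runs.ite_true rfl ((pop_main _ _ _ _ _).seq (drop_runs _ _ _ _))).mono ?_
      have : (enc y).size = KMedianL1.sz y := rfl
      dsimp only
      rw [sz_cons]
      omega

theorem headD {l : α → List β} (hl : PolyT l) (d : β) : PolyT fun x => (l x).headD d := by
  refine comp (g := fun l : List β => l.headD d) ?_ hl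
  refine ⟨.ite .main isTrue ((Prog.pop .main).seq (swap.seq drop))
    ((Prog.pop .main).seq (pushVal (enc d))),
    fun l => 16 * KMedianL1.sz l + 14 + (enc d).size, ?_, fun l a b c => ?_⟩
  · exact (((PolyBdd.const 16).mul PolyBdd.sz).add (PolyBdd.const 14)).add (PolyBdd.const _)
  · cases l with
    | nil =>
      refine (Runs.ite_false rfl ((pop_main _ _ _ _ _).seq (pushVal_runs _ _ _ _ _))).mono ?_
      dsimp only
      omega
    | cons y l =>
      have e : (enc (y :: l)).toks ++ a = some true :: ((enc y).toks ++ ((enc l).toks ++ a)) := by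
        simp [enc, encList]
      rw [e]
      refine (Runs.ite_true rfl ((pop_main _ _ _ _ _).seq ((swap_runs _ _ _ _ _).seq
        (drop_runs _ _ _ _)))).mono ?_
      have h1 : (enc y).size = KMedianL1.sz y := rfl
      have h2 : (enc l).size = KMedianL1.sz l := rfl
      dsimp only
      rw [sz_cons]
      omega

/-- The loop of a program for `List.foldl`. -/
def foldLoop (p : Prog) : Prog :=
  .while .main isTrue ((Prog.pop .main).seq (swap.seq (moveLeft.seq
    ((Prog.push .main (some true)).seq (p.seq (back .left))))))

/-- In each round the rest of the list is parked on `Reg.left` while `p` acts on the head and the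
state. The state itself is never moved, so apart from `p` a round costs only linear time in the size
`M` of the list. The time of `p` needs to be bounded only at states that arise from prefixes of the
list. -/
theorem foldLoop_runs {p : Prog} {step : β × γ → γ} {T : β × γ → ℕ} (hp : ProgFor p step T)
    {N M : ℕ} (l : List β) : ∀ (s : γ) (a b c : List Sym), sz l ≤ M →
      (∀ l' e, l' ++ [e] <+: l → T (e, l'.foldl (fun s e => step (e, s)) s) ≤ N) →
      Runs (foldLoop p) (st ((enc l).toks ++ ((enc s).toks ++ a)) b c [])
        (st (some false :: ((enc (l.foldl (fun s e => step (e, s)) s)).toks ++ a)) b c [])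
        ((N + 20 * M + 20) * l.length + 1) := by
  induction l with
  | nil => exact fun s a b c _ _ => Runs.while_false rfl
  | cons y l ih =>
    intro s a b c hM hN
    rw [sz_cons] at hM
    have h1 : T (y, s) ≤ N := hN [] y (by simp)
    have h2 := ih (step (y, s)) a b c (by omega) fun l' e h =>
      hN (y :: l') e (by simpa using h)
    have e : (enc (y :: l)).toks ++ ((enc s).toks ++ a) =
        some true :: ((enc y).toks ++ ((enc l).toks ++ ((enc s).toks ++ a))) := by
      simp [enc, encList]
    have e' : (enc (y, s)).toks ++ a =
        some true :: ((enc y).toks ++ ((enc s).toks ++ a)) := by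
      simp [enc]
    have h3 := hp (y, s) a ((enc l).toks.reverse ++ none :: b) c
    rw [e'] at h3
    rw [e]
    refine (Runs.while_true rfl ((pop_main _ _ _ _ _).seq ((swap_runs _ _ _ _ _).seq
      ((moveLeft_runs _ _ _ _).seq ((push_main _ _ _ _ _).seq
        (h3.seq (back_left_runs _ _ _ _ _)))))) h2).mono ?_
    have h1 : (enc y).size = KMedianL1.sz y := rfl
    have h2 : (enc l).size = KMedianL1.sz l := rfl
    rw [List.length_cons, Nat.mul_succ]
    omega

theorem foldl_aux {l : α → List β} {s : α → γ} {step : β × γ → γ} {B : α → ℕ} (hl : PolyT l)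
    (hs : PolyT s) (hstep : PolyT step) (hB : PolyBdd B)
    (h : ∀ x l', l' <+: l x → KMedianL1.sz (l'.foldl (fun s e => step (e, s)) (s x)) ≤ B x) :
    PolyT fun x => (l x).foldl (fun s e => step (e, s)) (s x) := by
  have bl := hl.polyBdd
  obtain ⟨q, T', hT', hq⟩ := hl.pair hs
  obtain ⟨p, T, ⟨P, hT⟩, hp⟩ := hstep
  refine ⟨q.seq ((Prog.pop .main).seq ((foldLoop p).seq (.pop .main))),
    fun x => T' x + (1 + (((P.eval (1 + KMedianL1.sz (l x) + B x) + 20 * KMedianL1.sz (l x) + 20) *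
      KMedianL1.sz (l x) + 1) + 1)), ?_, fun x a b c => ?_⟩
  · exact hT'.add ((PolyBdd.const 1).add ((((((((PolyBdd.const 1).add bl).add hB).eval P).add
      ((PolyBdd.const 20).mul bl)).add (PolyBdd.const 20)).mul bl).add (PolyBdd.const 1) |>.add
        (PolyBdd.const 1)))
  · have h1 := hq x a b c
    have e : (enc (l x, s x)).toks ++ a =
        some true :: ((enc (l x)).toks ++ ((enc (s x)).toks ++ a)) := by
      simp [enc]
    rw [e] at h1
    refine h1.seq ((pop_main _ _ _ _ _).seq (Runs.seq (Runs.mono (foldLoop_runs hp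
      (N := P.eval (1 + KMedianL1.sz (l x) + B x)) (l x) (s x) a b c
      le_rfl fun l' e h' => (hT _).trans (eval_mono P ?_)) ?_) (pop_main _ _ _ _ _)))
    · have h1 := sz_le_of_mem (h'.subset (List.mem_append_right l' (List.mem_singleton_self e)))
      have h2 := h x l' ((List.prefix_append _ _).trans h')
      rw [sz_pair]
      exact Nat.add_le_add (Nat.add_le_add_left h1 1) h2
    · exact Nat.add_le_add_right (Nat.mul_le_mul_left _ (length_lt_sz _).le) 1

/-- Folds over lists are computed in polynomial time if the results stay small. -/
theorem foldl {l : α → List β} {s : α → γ} {step : α → γ → β → γ} {B : α → ℕ} (hl : PolyT l)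
    (hs : PolyT s) (hstep : PolyT fun p : β × (α × γ) => step p.2.1 p.2.2 p.1) (hB : PolyBdd B)
    (h : ∀ x l', l' <+: l x → KMedianL1.sz (l'.foldl (step x) (s x)) ≤ B x) :
    PolyT fun x => (l x).foldl (step x) (s x) := by
  -- The step of `foldl_aux` has no access to the argument `x`; therefore `x` travels as the first
  -- component of the accumulator.
  have key : ∀ (x : α) (l : List β) (s : γ),
      l.foldl (fun (p : α × γ) e => (p.1, step p.1 p.2 e)) (x, s) = (x, l.foldl (step x) s) := by
    intro x l
    induction l with
    | nil => intro s; rfl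
    | cons y l ih => intro s; exact ih _
  have := foldl_aux (step := fun p : β × (α × γ) => (p.2.1, step p.2.1 p.2.2 p.1)) hl
    (PolyT.id.pair hs) (PolyT.id.snd.fst.pair hstep)
    (((PolyBdd.const 1).add PolyBdd.sz).add hB) (fun x l' hl' => by
      simp only
      rw [key, sz_pair]
      exact Nat.add_le_add_left (h x l' hl') _)
  refine this.snd.congr fun x => ?_
  simp only
  rw [key]

end PolyT

/-! ### Strings as input and output -/

/-- Read a string from `Reg.left` into a value. -/
def loadBits : Prog :=
  (pushVal .nil).seq (.while .left isData (.seq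
    (.ite .left isTrue (pushVal (enc true)) (pushVal (enc false)))
    ((Prog.push .main (some true)).seq (.pop .left))))

/-- Write a value to `Reg.left` as a string. -/
def unloadBits : Prog :=
  Prog.seq (.while .main isTrue ((Prog.pop .main).seq
    (.ite .main isTrue
      (((Prog.pop .main).seq ((Prog.pop .main).seq (.pop .main))).seq (.push .left (some true)))
      ((Prog.pop .main).seq (.push .left (some false)))))) (.pop .main)

/-- Since the string is stored in reverse, its last symbol is on top, and consing the symbols as
they are popped restores the order. -/
theorem loadBits_runs (w : List Bool) :
    Runs loadBits (st [] (w.reverse.map some) [] []) (st (enc w).toks [] [] [])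
      (7 * w.length + 2) := by
  have key : ∀ r l : List Bool, Runs (.while .left isData (.seq
      (.ite .left isTrue (pushVal (enc true)) (pushVal (enc false)))
      ((Prog.push .main (some true)).seq (.pop .left))))
      (st (enc l).toks (r.map some) [] []) (st (enc (r.reverse ++ l)).toks [] [] [])
      (7 * r.length + 1) := by
    intro r
    induction r with
    | nil => exact fun l => Runs.while_false rfl
    | cons x r ih =>
      intro l
      have h := ih (x :: l)
      have e : (enc (x :: l)).toks = some true :: ((enc x).toks ++ (enc l).toks) := by
        simp [enc, encList]
      rw [e] at h
      have e' : (x :: r).reverse ++ l = r.reverse ++ x :: l := by simp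
      rw [e']
      cases x with
      | false =>
        exact (Runs.while_true rfl ((Runs.ite_false rfl (pushVal_runs _ _ _ _ _)).seq
          ((push_main _ _ _ _ _).seq (pop_left _ _ _ _ _))) h).mono
            (by simp [enc, Val.size]; omega)
      | true =>
        exact (Runs.while_true rfl ((Runs.ite_true rfl (pushVal_runs _ _ _ _ _)).seq
          ((push_main _ _ _ _ _).seq (pop_left _ _ _ _ _))) h).mono
            (by simp [enc, Val.size]; omega)
  have h := (pushVal_runs .nil [] (w.reverse.map some) [] []).seq (key w.reverse [])
  rw [List.reverse_reverse, List.append_nil] at h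
  exact h.mono (by simp [Val.size]; omega)

theorem unloadBits_runs (w : List Bool) :
    Runs unloadBits (st (enc w).toks [] [] []) (st [] (w.reverse.map some) [] [])
      (7 * w.length + 2) := by
  have key : ∀ (l : List Bool) (b : List Sym), Runs (.while .main isTrue ((Prog.pop .main).seq
      (.ite .main isTrue
        (((Prog.pop .main).seq ((Prog.pop .main).seq (.pop .main))).seq (.push .left (some true)))
        ((Prog.pop .main).seq (.push .left (some false))))))
      (st (enc l).toks b [] []) (st [some false] (l.reverse.map some ++ b) [] [])
      (7 * l.length + 1) := by
    intro l
    induction l with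
    | nil => exact fun b => Runs.while_false rfl
    | cons x l ih =>
      intro b
      have h := ih (some x :: b)
      have e : (x :: l).reverse.map some ++ b = l.reverse.map some ++ some x :: b := by simp
      rw [e]
      cases x with
      | false =>
        exact (Runs.while_true rfl ((pop_main _ _ _ _ _).seq (Runs.ite_false rfl
          ((pop_main _ _ _ _ _).seq (push_left _ _ _ _ _)))) h).mono (by simp; omega)
      | true =>
        exact (Runs.while_true rfl ((pop_main _ _ _ _ _).seq (Runs.ite_true rfl
          (((pop_main _ _ _ _ _).seq ((pop_main _ _ _ _ _).seq (pop_main _ _ _ _ _))).seq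
            (push_left _ _ _ _ _)))) h).mono (by simp; omega)
  have h := (key w []).seq (pop_main _ _ _ _ _)
  rw [List.append_nil] at h
  exact h.mono (by omega)

/-- A function computed by a stack program can be applied after a polynomial-time computable
function. -/
theorem PolyTime.comp_polyT {f g : List Bool → List Bool} (hf : PolyTime f) (hg : PolyT g) :
    PolyTime fun w => g (f w) := by
  obtain ⟨Q, hQ⟩ := hg.polyBdd
  obtain ⟨p, T, ⟨P, hP⟩, hp⟩ := hg
  have hsz : ∀ w : List Bool, sz w ≤ 4 * w.length + 1 := fun w => by
    have := sz_le_length_mul (l := w) (b := 3) fun x _ => sz_bool_le x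
    omega
  let S : Polynomial ℕ := Polynomial.C 4 * Polynomial.X + 1
  let R : Polynomial ℕ := (Polynomial.C 7 * Polynomial.X + 2) + (P.comp S +
    (Polynomial.C 7 * Q.comp S + 2))
  have hS : ∀ w : List Bool, sz w ≤ S.eval w.length := fun w => by simpa [S] using hsz w
  refine PolyTime.after (p := loadBits.seq (p.seq unloadBits)) (T := R) hf fun w => ?_
  have h₀ := hp w [] [] []
  simp only [List.append_nil] at h₀
  refine ((loadBits_runs w).seq ((h₀.mono ((hP w).trans (eval_mono P (hS w)))).seq
    (unloadBits_runs (g w)))).mono ?_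
  have h1 : (g w).length ≤ Q.eval (S.eval w.length) :=
    (length_lt_sz _).le.trans ((hQ w).trans (eval_mono Q (hS w)))
  simp only [R, Polynomial.eval_add, Polynomial.eval_mul, Polynomial.eval_C, Polynomial.eval_X,
    Polynomial.eval_comp, Polynomial.eval_ofNat]
  omega

/-! ### List functions in polynomial time -/

namespace PolyT

variable {α β γ δ : Type} [Enc α] [Enc β] [Enc γ] [Enc δ]

theorem cond {k : α → Bool} {f g : α → β} (hk : PolyT k) (hf : PolyT f) (hg : PolyT g) :
    PolyT fun x => bif k x then f x else g x :=
  (ite hk hf hg).congr fun x => by cases k x <;> rfl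

theorem and {k k' : α → Bool} (hk : PolyT k) (hk' : PolyT k') : PolyT fun x => k x && k' x :=
  (cond hk hk' (const false)).congr fun x => by cases k x <;> rfl

theorem or {k k' : α → Bool} (hk : PolyT k) (hk' : PolyT k') : PolyT fun x => k x || k' x :=
  (cond hk (const true) hk').congr fun x => by cases k x <;> rfl

theorem not {k : α → Bool} (hk : PolyT k) : PolyT fun x => !k x :=
  (cond hk (const false) (const true)).congr fun x => by cases k x <;> rfl

/-- Growth by an additive `B x` per element keeps the accumulator within `|l x| * B x` of its
initial size. Some such bound is indispensable, since a polynomial-time step that doubles its state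
could reach exponential size. -/
theorem foldl_add {l : α → List β} {s : α → γ} {step : α → γ → β → γ} {B : α → ℕ} (hl : PolyT l)
    (hs : PolyT s) (hstep : PolyT fun p : β × (α × γ) => step p.2.1 p.2.2 p.1) (hB : PolyBdd B)
    (h : ∀ x s, ∀ e ∈ l x, KMedianL1.sz (step x s e) ≤ KMedianL1.sz s + B x) :
    PolyT fun x => (l x).foldl (step x) (s x) := by
  refine foldl hl hs hstep (hs.polyBdd.add (hl.polyBdd.mul hB)) fun x l' hl' => ?_
  have key : ∀ (l' : List β) (s : γ), (∀ e ∈ l', e ∈ l x) →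
      KMedianL1.sz (l'.foldl (step x) s) ≤ KMedianL1.sz s + l'.length * B x := by
    intro l'
    induction l' with
    | nil => simp
    | cons y l' ih =>
      intro s hy
      have h1 := ih (step x s y) fun e he => hy e (List.mem_cons_of_mem _ he)
      have h2 := h x s y (hy y List.mem_cons_self)
      simp only [List.foldl_cons, List.length_cons, Nat.succ_mul]
      omega
  refine (key l' (s x) fun e he => hl'.subset he).trans (Nat.add_le_add_left ?_ _)
  exact Nat.mul_le_mul_right _ (hl'.length_le.trans (length_lt_sz _).le)

theorem reverse {l : α → List β} (hl : PolyT l) : PolyT fun x => (l x).reverse := by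
  refine (foldl_add (step := fun _ acc e => e :: acc) hl (const []) (id.fst.cons id.snd.snd)
    ((PolyBdd.const 1).add hl.polyBdd) fun x s e he => ?_).congr fun x => ?_
  · have := sz_le_of_mem he
    rw [sz_cons]
    omega
  · have key : ∀ l acc : List β, l.reverse ++ acc = l.foldl (fun acc e => e :: acc) acc := by
      intro l
      induction l with
      | nil => simp
      | cons y l ih => intro acc; rw [List.foldl_cons, ← ih]; simp
    rw [← key, List.append_nil]

theorem foldr_add {l : α → List β} {s : α → γ} {step : α → β → γ → γ} {B : α → ℕ} (hl : PolyT l)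
    (hs : PolyT s) (hstep : PolyT fun p : β × (α × γ) => step p.2.1 p.1 p.2.2) (hB : PolyBdd B)
    (h : ∀ x s, ∀ e ∈ l x, KMedianL1.sz (step x e s) ≤ KMedianL1.sz s + B x) :
    PolyT fun x => (l x).foldr (step x) (s x) :=
  (foldl_add (step := fun x s e => step x e s) hl.reverse hs hstep hB fun x s e he =>
    h x s e (List.mem_reverse.mp he)).congr fun x => by rw [List.foldl_reverse]

theorem append {l l' : α → List β} (hl : PolyT l) (hl' : PolyT l') :
    PolyT fun x => l x ++ l' x := by
  refine (foldr_add (step := fun _ e acc => e :: acc) hl hl' (id.fst.cons id.snd.snd)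
    ((PolyBdd.const 1).add hl.polyBdd) fun x s e he => ?_).congr fun x => ?_
  · have := sz_le_of_mem he
    rw [sz_cons]
    omega
  · simp

/-- A bound for a function with context at the elements of a list. -/
theorem exists_bdd_of_mem {l : α → List β} {f : α → β → γ} (hl : PolyT l)
    (hf : PolyT fun p : α × β => f p.1 p.2) :
    ∃ B : α → ℕ, PolyBdd B ∧ ∀ x, ∀ e ∈ l x, KMedianL1.sz (f x e) ≤ B x := by
  obtain ⟨P, hP⟩ := hf.polyBdd
  refine ⟨_, (((PolyBdd.const 1).add PolyBdd.sz).add hl.polyBdd).eval P, fun x e he => ?_⟩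
  exact (hP (x, e)).trans (eval_mono P (Nat.add_le_add_left (sz_le_of_mem he) _))

theorem map {l : α → List β} {f : α → β → γ} (hl : PolyT l)
    (hf : PolyT fun p : α × β => f p.1 p.2) : PolyT fun x => (l x).map (f x) := by
  obtain ⟨B, hB, h⟩ := exists_bdd_of_mem hl hf
  refine (foldr_add (step := fun x e acc => f x e :: acc) hl (const [])
    ((hf.comp (id.snd.fst.pair id.fst)).cons id.snd.snd)
    ((PolyBdd.const 1).add hB) fun x s e he => ?_).congr fun x => ?_
  · have := h x e he
    rw [sz_cons]
    omega
  · induction l x with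
    | nil => rfl
    | cons y l ih => simp

theorem flatMap {l : α → List β} {f : α → β → List γ} (hl : PolyT l)
    (hf : PolyT fun p : α × β => f p.1 p.2) : PolyT fun x => (l x).flatMap (f x) := by
  obtain ⟨B, hB, h⟩ := exists_bdd_of_mem hl hf
  refine (foldr_add (step := fun x e acc => f x e ++ acc) hl (const [])
    ((hf.comp (id.snd.fst.pair id.fst)).append id.snd.snd) hB fun x s e he => ?_).congr fun x => ?_
  · have := h x e he
    have := sz_append (f x e) s
    omega
  · induction l x with
    | nil => rfl
    | cons y l ih => rw [List.flatMap_cons, List.foldr_cons, ih]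

theorem filter {l : α → List β} {k : α → β → Bool} (hl : PolyT l)
    (hk : PolyT fun p : α × β => k p.1 p.2) : PolyT fun x => (l x).filter (k x) := by
  refine (foldr_add (step := fun x e acc => bif k x e then e :: acc else acc) hl (const [])
    (cond (hk.comp (id.snd.fst.pair id.fst)) (id.fst.cons id.snd.snd) id.snd.snd)
    ((PolyBdd.const 1).add hl.polyBdd) fun x s e he => ?_).congr fun x => ?_
  · have := sz_le_of_mem he
    cases k x e
    · simp only [cond_false]; omega
    · simp only [cond_true, sz_cons]; omega
  · induction l x with
    | nil => rfl
    | cons y l ih => rw [List.filter_cons, List.foldr_cons, ih]; cases k x y <;> rfl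

theorem all {l : α → List β} {k : α → β → Bool} (hl : PolyT l)
    (hk : PolyT fun p : α × β => k p.1 p.2) : PolyT fun x => (l x).all (k x) := by
  refine (foldr_add (step := fun x e acc => k x e && acc) hl (const true)
    ((hk.comp (id.snd.fst.pair id.fst)).and id.snd.snd)
    (PolyBdd.const 3) fun x s e he => ?_).congr fun x => ?_
  · have := sz_bool_le (k x e && s)
    omega
  · induction l x with
    | nil => rfl
    | cons y l ih => rw [List.all_cons, List.foldr_cons, ih]

/-- Numbers are handled in unary, as lengths of lists: dropping plays the role of truncated
subtraction, and emptiness of the result is a comparison. -/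
theorem drop_length {l : α → List β} {l' : α → List γ} (hl : PolyT l) (hl' : PolyT l') :
    PolyT fun x => (l x).drop (l' x).length := by
  refine (foldl_add (step := fun _ acc _ => acc.tail) hl' hl id.snd.snd.tail
    (PolyBdd.const 0) fun x s e _ => ?_).congr fun x => ?_
  · cases s with
    | nil => simp
    | cons y s => simp
  · have key : ∀ (l' : List γ) (l : List β),
        l.drop l'.length = l'.foldl (fun acc _ => acc.tail) l := by
      intro l'
      induction l' with
      | nil => simp
      | cons y l' ih => intro l; rw [List.foldl_cons, ← ih, List.length_cons, List.drop_tail]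
    exact key _ _

theorem length_le {l : α → List β} {l' : α → List γ} (hl : PolyT l) (hl' : PolyT l') :
    PolyT fun x => decide ((l x).length ≤ (l' x).length) :=
  (drop_length hl hl').isEmpty.congr fun x => by
    rw [Bool.eq_iff_iff, decide_eq_true_iff, List.isEmpty_iff, List.drop_eq_nil_iff]

theorem zip [Inhabited γ] {l : α → List β} {l' : α → List γ} (hl : PolyT l) (hl' : PolyT l') :
    PolyT fun x => (l x).zip (l' x) := by
  let step : List γ × List (β × γ) → β → List γ × List (β × γ) := fun s e =>
    bif s.1.isEmpty then s else (s.1.tail, (e, s.1.headD default) :: s.2)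
  refine (reverse (snd (foldl_add (step := fun _ s e => step s e) hl (hl'.pair (const []))
    (cond id.snd.snd.fst.isEmpty id.snd.snd (id.snd.snd.fst.tail.pair
      ((id.fst.pair (id.snd.snd.fst.headD default)).cons id.snd.snd.snd)))
    ((PolyBdd.const 4).add hl.polyBdd) fun x s e he => ?_))).congr fun x => ?_
  · have := sz_le_of_mem he
    obtain ⟨s, acc⟩ := s
    cases s with
    | nil => exact Nat.le_add_right _ _
    | cons y s =>
      simp only [step, List.isEmpty_cons, cond_false, List.tail_cons, List.headD_cons, sz_pair,
        sz_cons]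
      omega
  · have key : ∀ (l : List β) (l' : List γ) (acc : List (β × γ)),
        (l.foldl step (l', acc)).2.reverse = acc.reverse ++ l.zip l' := by
      intro l
      induction l with
      | nil => simp
      | cons y l ih =>
        intro l' acc
        rw [List.foldl_cons]
        cases l' with
        | nil => exact (ih [] acc).trans (by simp)
        | cons z l' => exact (ih l' _).trans (by simp)
    rw [key]
    rfl

theorem zipWith [Inhabited γ] {l : α → List β} {l' : α → List γ} {f : β → γ → δ} (hl : PolyT l)
    (hl' : PolyT l') (hf : PolyT fun p : β × γ => f p.1 p.2) :
    PolyT fun x => List.zipWith f (l x) (l' x) :=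
  (map (f := fun _ p => f p.1 p.2) (zip hl hl') (hf.comp id.snd)).congr fun _ =>
    (List.map_uncurry_zip_eq_zipWith).symm

theorem beq_const (w : List Bool) : PolyT fun l : List Bool => l == w := by
  induction w with
  | nil => exact id.isEmpty.congr fun l => by cases l <;> rfl
  | cons b w ih =>
    have hb : PolyT fun c : Bool => c == b := by
      cases b
      · exact id.not.congr fun c => by cases c <;> rfl
      · exact id.congr fun c => by cases c <;> rfl
    refine (cond id.isEmpty (const false) ((hb.comp (id.headD false)).and (ih.comp id.tail))).congr
      fun l => ?_
    cases l <;> rfl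

/-- For a fixed finite set, membership is a fixed disjunction of comparisons with constants, however
the set was obtained. -/
theorem mem_const (s : Set (List Bool)) (hs : s.Finite) [DecidablePred (· ∈ s)] :
    PolyT fun l : List Bool => decide (l ∈ s) := by
  have key : ∀ L : List (List Bool), PolyT fun l : List Bool => decide (l ∈ L) := by
    intro L
    induction L with
    | nil => exact (const false).congr fun l => by simp
    | cons w L ih =>
      exact ((beq_const w).or ih).congr fun l => by
        rw [Bool.eq_iff_iff]; simp
  exact (key hs.toFinset.toList).congr fun l => by simp

end PolyT

/-! ### Distances between unions of almost disjoint sets and arbitrary centers -/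

section overlap

variable {U Ω : Type*} [DecidableEq U] [DecidableEq Ω]

/-- A Bonferroni-type inequality: adding a set `f a` to the union loses at most its intersections
with the previous sets, at most `|S| * t`, and `|S| ^ 2 + |S| ≤ (|S| + 1) ^ 2`. -/
theorem sum_card_le_card_biUnion (f : U → Finset Ω) {t : ℝ}
    (ht : 0 ≤ t) (S : Finset U)
    (hf : ∀ u ∈ S, ∀ v ∈ S, u ≠ v → ((f u ∩ f v).card : ℝ) ≤ t) :
    ∑ u ∈ S, ((f u).card : ℝ) ≤ (S.biUnion f).card + (S.card : ℝ) ^ 2 * t := by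
  induction S using Finset.induction_on with
  | empty => simp
  | insert a S ha ih =>
    have h1 := ih fun u hu v hv => hf u (Finset.mem_insert_of_mem hu) v (Finset.mem_insert_of_mem hv)
    have h2 : ((f a ∩ S.biUnion f).card : ℝ) ≤ S.card * t := by
      rw [Finset.inter_biUnion]
      refine (Nat.cast_le.mpr Finset.card_biUnion_le).trans ?_
      rw [Nat.cast_sum, ← nsmul_eq_mul]
      refine Finset.sum_le_card_nsmul _ _ _ fun u hu => ?_
      refine hf a (Finset.mem_insert_self a S) u (Finset.mem_insert_of_mem hu) ?_
      rintro rfl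
      exact ha hu
    have h3 : (((f a ∪ S.biUnion f).card : ℝ)) + (f a ∩ S.biUnion f).card =
        (f a).card + (S.biUnion f).card := by
      exact_mod_cast Finset.card_union_add_card_inter (f a) (S.biUnion f)
    rw [Finset.sum_insert ha, Finset.biUnion_insert, Finset.card_insert_of_notMem ha]
    push_cast
    nlinarith [mul_nonneg (Nat.cast_nonneg (α := ℝ) S.card) ht]

/-- The number of elements in which two sets differ. -/
def diffCard (a c : Finset Ω) : ℝ := (a \ c).card + (c \ a).card

theorem diffCard_eq (a c : Finset Ω) :
    diffCard a c = a.card + c.card - 2 * (a ∩ c).card := by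
  have h1 : ((a \ c).card : ℝ) + (a ∩ c).card = a.card := by
    exact_mod_cast Finset.card_sdiff_add_card_inter a c
  have h2 : ((c \ a).card : ℝ) + (c ∩ a).card = c.card := by
    exact_mod_cast Finset.card_sdiff_add_card_inter c a
  rw [Finset.inter_comm c a] at h2
  unfold diffCard
  linarith

/-- A family of almost disjoint codewords for the elements of the sets in `E`. -/
structure Codewords (C : U → Finset Ω) (E : Finset (Finset U)) (z : ℕ) (m δ : ℝ) : Prop where
  pos : 0 < m
  nonneg : 0 ≤ δ
  card_le : ∀ u, ((C u).card : ℝ) ≤ m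
  card_inter_le : ∀ u v, u ≠ v → ((C u ∩ C v).card : ℝ) ≤ δ * m
  card_eq : ∀ T ∈ E, ∀ u ∈ T, ((C u).card : ℝ) = m
  card_mem : ∀ T ∈ E, T.card = z

namespace Codewords

variable {C : U → Finset Ω} {E : Finset (Finset U)} {z : ℕ} {m δ : ℝ}

theorem nonneg' (h : Codewords C E z m δ) : 0 ≤ δ * m := mul_nonneg h.nonneg h.pos.le

theorem card_biUnion_le (h : Codewords C E z m δ) {T : Finset U} (hT : T ∈ E) :
    ((T.biUnion C).card : ℝ) ≤ z * m := by
  refine (Nat.cast_le.mpr Finset.card_biUnion_le).trans ?_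
  rw [Nat.cast_sum, ← h.card_mem T hT, ← nsmul_eq_mul]
  exact Finset.sum_le_card_nsmul _ _ _ fun u _ => h.card_le u

theorem le_card_biUnion (h : Codewords C E z m δ) {T : Finset U} (hT : T ∈ E) :
    z * m - (z : ℝ) ^ 2 * (δ * m) ≤ ((T.biUnion C).card : ℝ) := by
  have h1 := sum_card_le_card_biUnion C h.nonneg' T fun u _ v _ huv => h.card_inter_le u v huv
  rw [Finset.sum_congr rfl (h.card_eq T hT), Finset.sum_const, nsmul_eq_mul, h.card_mem T hT] at h1
  linarith

/-- Different members of `E` have different unions of codewords. -/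
theorem injOn (h : Codewords C E z m δ) (hz : z * δ < 1) :
    Set.InjOn (fun T : Finset U => T.biUnion C) E := by
  intro T hT T' hT' heq
  by_contra hne
  have hcard : T'.card = T.card := by rw [h.card_mem T hT, h.card_mem T' hT']
  obtain ⟨u, hu, hu'⟩ : ∃ u ∈ T, u ∉ T' := by
    by_contra hcon
    push Not at hcon
    exact hne (Finset.eq_of_subset_of_card_le hcon hcard.le)
  -- If the unions agreed, the codeword of a vertex `u ∈ T \ T'` would be covered by its `z` small
  -- intersections with the codewords of `T'`, giving `m ≤ z * δ * m`.
  have hsub : C u ⊆ T'.biUnion fun v => C u ∩ C v := by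
    intro ω hω
    have h1 : ω ∈ T'.biUnion C := by
      have h2 : ω ∈ T.biUnion C := Finset.mem_biUnion.mpr ⟨u, hu, hω⟩
      simp only at heq
      rwa [heq] at h2
    obtain ⟨v, hv, hωv⟩ := Finset.mem_biUnion.mp h1
    exact Finset.mem_biUnion.mpr ⟨v, hv, Finset.mem_inter.mpr ⟨hω, hωv⟩⟩
  have h1 : (C u).card ≤ ∑ v ∈ T', (C u ∩ C v).card :=
    (Finset.card_le_card hsub).trans Finset.card_biUnion_le
  have h2 : ((C u).card : ℝ) ≤ z * (δ * m) := by
    refine (Nat.cast_le.mpr h1).trans ?_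
    rw [Nat.cast_sum, ← h.card_mem T' hT', ← nsmul_eq_mul]
    refine Finset.sum_le_card_nsmul _ _ _ fun v hv => h.card_inter_le u v ?_
    rintro rfl
    exact hu' hv
  rw [h.card_eq T hT u hu] at h2
  have := h.pos
  nlinarith

/-- The distance of a union of codewords to the union of codewords for a subset. -/
theorem diffCard_subset_le (h : Codewords C E z m δ) {S T : Finset U} (hT : T ∈ E) (hS : S ⊆ T) :
    diffCard (T.biUnion C) (S.biUnion C) ≤ (z - S.card) * m := by
  have h1 : S.biUnion C \ T.biUnion C = ∅ :=
    Finset.sdiff_eq_empty_iff_subset.mpr (Finset.biUnion_subset_biUnion_of_subset_left C hS)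
  have h2 : T.biUnion C \ S.biUnion C ⊆ (T \ S).biUnion C := by
    intro ω hω
    obtain ⟨hω1, hω2⟩ := Finset.mem_sdiff.mp hω
    obtain ⟨u, hu, hωu⟩ := Finset.mem_biUnion.mp hω1
    exact Finset.mem_biUnion.mpr ⟨u, Finset.mem_sdiff.mpr ⟨hu, fun hu' =>
      hω2 (Finset.mem_biUnion.mpr ⟨u, hu', hωu⟩)⟩, hωu⟩
  have h3 : ((T \ S).card : ℝ) = z - S.card := by
    have := Finset.card_sdiff_add_card_eq_card hS
    rw [h.card_mem T hT] at this
    rw [eq_sub_iff_add_eq]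
    exact_mod_cast this
  unfold diffCard
  rw [h1, Finset.card_empty, Nat.cast_zero, add_zero, ← h3, ← nsmul_eq_mul]
  refine (Nat.cast_le.mpr ((Finset.card_le_card h2).trans Finset.card_biUnion_le)).trans ?_
  rw [Nat.cast_sum]
  exact Finset.sum_le_card_nsmul _ _ _ fun u _ => h.card_le u

/-- The number of common elements of a center and a codeword, summed up. -/
theorem sum_inter_le (h : Codewords C E z m δ) (c : Finset Ω) (S : Finset U) :
    ∑ u ∈ S, ((C u ∩ c).card : ℝ) ≤ c.card + (S.card : ℝ) ^ 2 * (δ * m) := by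
  refine (sum_card_le_card_biUnion (fun u => C u ∩ c) h.nonneg' S fun u _ v _ huv => ?_).trans ?_
  · refine le_trans (Nat.cast_le.mpr (Finset.card_le_card ?_)) (h.card_inter_le u v huv)
    exact Finset.inter_subset_inter Finset.inter_subset_left Finset.inter_subset_left
  · refine add_le_add_left (Nat.cast_le.mpr (Finset.card_le_card ?_)) _
    exact Finset.biUnion_subset.mpr fun u _ => Finset.inter_subset_right

/-- In `|a| + |c| - 2 |a ∩ c|` the codewords are nearly disjoint, so `|a|` is almost `z * m`, while
`|a ∩ c|` is at most the sum over the single codewords. -/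
theorem le_diffCard (h : Codewords C E z m δ) (c : Finset Ω) {T : Finset U} (hT : T ∈ E) :
    z * m - (z : ℝ) ^ 2 * (δ * m) + c.card - 2 * ∑ u ∈ T, ((C u ∩ c).card : ℝ) ≤
      diffCard (T.biUnion C) c := by
  have h1 := h.le_card_biUnion hT
  have h2 : ((T.biUnion C ∩ c).card : ℝ) ≤ ∑ u ∈ T, ((C u ∩ c).card : ℝ) := by
    rw [Finset.biUnion_inter]
    exact_mod_cast Finset.card_biUnion_le
  rw [diffCard_eq]
  linarith

variable [Fintype U]

/-- The elements whose codewords have a substantial part in common with a center. -/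
noncomputable def near (C : U → Finset Ω) (c : Finset Ω) (τm : ℝ) : Finset U :=
  {u | τm ≤ ((C u ∩ c).card : ℝ)}

/-- A set of `s` near vertices would have intersections with `c` of total size at least `s * τ * m ≥
4 * z * m`, whereas near-disjointness allows at most `|c| + s ^ 2 * δ * m < 4 * z * m`. -/
theorem card_near_lt (h : Codewords C E z m δ) {c : Finset Ω} {τ : ℝ} {s : ℕ}
    (hc : (c.card : ℝ) ≤ 2 * z * m) (hs : 4 * z ≤ s * τ) (hδ : (s : ℝ) ^ 2 * δ < 2 * z) :
    (near C c (τ * m)).card < s := by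
  by_contra hcon
  push Not at hcon
  obtain ⟨N, hN, hNs⟩ := Finset.exists_subset_card_eq hcon
  have h1 := h.sum_inter_le c N
  have h2 : (s : ℝ) * (τ * m) ≤ ∑ u ∈ N, ((C u ∩ c).card : ℝ) := by
    rw [← hNs, ← nsmul_eq_mul]
    exact Finset.card_nsmul_le_sum _ _ _ fun u hu => (Finset.mem_filter.mp (hN hu)).2
  rw [hNs] at h1
  have hm := h.pos
  have h3 : 4 * z * m ≤ s * τ * m := mul_le_mul_of_nonneg_right hs hm.le
  have h4 : (s : ℝ) ^ 2 * δ * m < 2 * z * m := mul_lt_mul_of_pos_right hδ hm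
  nlinarith

/-- The number of sets of size `z` with more than `y` elements in a small set. -/
theorem card_bad_le {y : ℕ} (hE : ∀ T ∈ E, T.card = z) (N : Finset U) :
    (E.filter fun T => y + 1 ≤ (T ∩ N).card).card ≤
      2 ^ N.card * Fintype.card U ^ (z - y - 1) := by
  -- Such a `T` is the union of a subset `R` of `N` with `y + 1` elements and a set of `z - y - 1`
  -- further vertices; there are few choices for `R` since `N` is small.
  have hsub : (E.filter fun T => y + 1 ≤ (T ∩ N).card) ⊆
      Finset.image₂ (fun R Q => R ∪ Q) N.powerset
        (Finset.powersetCard (z - y - 1) Finset.univ) := by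
    intro T hT
    obtain ⟨hTE, hTN⟩ := Finset.mem_filter.mp hT
    obtain ⟨R, hR, hRc⟩ := Finset.exists_subset_card_eq hTN
    have hRT : R ⊆ T := hR.trans Finset.inter_subset_left
    refine Finset.mem_image₂.mpr ⟨R, ?_, T \ R, ?_, Finset.union_sdiff_of_subset hRT⟩
    · exact Finset.mem_powerset.mpr (hR.trans Finset.inter_subset_right)
    · refine Finset.mem_powersetCard.mpr ⟨Finset.subset_univ _, ?_⟩
      rw [Finset.card_sdiff_of_subset hRT, hE T hTE, hRc]
      omega
  refine (Finset.card_le_card hsub).trans (Finset.card_image₂_le _ _ _ |>.trans ?_)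
  rw [Finset.card_powerset, Finset.card_powersetCard, Finset.card_univ]
  exact Nat.mul_le_mul_left _ (Nat.choose_le_pow _ _)

/-- Every center is close to sets of `E` essentially only through one set of size `y`. -/
theorem exists_best (h : Codewords C E z m δ) {y : ℕ} (hy : 1 ≤ y) (hyz : y < z)
    (hyU : y ≤ Fintype.card U) {τ : ℝ} {s : ℕ} (hτ : 0 ≤ τ) (hs : 4 * z ≤ s * τ)
    (hδ : (s : ℝ) ^ 2 * δ < 2 * z) (c : Finset Ω) :
    ∃ S : Finset U, S.card = y ∧ ∃ bad ⊆ E,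
      bad.card ≤ 2 ^ s * Fintype.card U ^ (z - y - 1) ∧
      ∀ T ∈ E, T ∉ bad →
        (z - y) * m - (5 * z ^ 2 * δ + 2 * z * τ) * m ≤ diffCard (T.biUnion C) c ∧
        (¬ S ⊆ T → (z - y + 1) * m - (5 * z ^ 2 * δ + 2 * z * τ) * m ≤
          diffCard (T.biUnion C) c) := by
  have hm := h.pos
  have hδm := h.nonneg'
  have hyR : (1 : ℝ) ≤ y := by exact_mod_cast hy
  have hyzR : (y : ℝ) + 1 ≤ z := by exact_mod_cast hyz
  have hzm : 0 ≤ (z : ℝ) ^ 2 * (δ * m) := by positivity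
  have hτm : 0 ≤ z * (τ * m) := by positivity
  obtain ⟨S₀, -, hS₀⟩ := Finset.exists_subset_card_eq (s := (Finset.univ : Finset U)) (n := y)
    (by rwa [Finset.card_univ])
  by_cases hc : (c.card : ℝ) ≤ 2 * z * m
  swap
  · push Not at hc
    -- A center with more than `2 * z * m` ones is farther than `z * m` from every point, as the
    -- points have at most `z * m` ones; `y ≥ 1` then suffices.
    have key : ∀ T ∈ E, (z - y + 1) * m - (5 * z ^ 2 * δ + 2 * z * τ) * m ≤
        diffCard (T.biUnion C) c := by
      intro T hT
      have h1 := h.card_biUnion_le hT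
      have h2 : ((T.biUnion C ∩ c).card : ℝ) ≤ (T.biUnion C).card := by
        exact_mod_cast Finset.card_le_card Finset.inter_subset_left
      rw [diffCard_eq]
      nlinarith
    exact ⟨S₀, hS₀, ∅, Finset.empty_subset _, by simp, fun T hT _ =>
      ⟨by nlinarith [key T hT], fun _ => key T hT⟩⟩
  set N := near C c (τ * m) with hN
  have hNs : N.card < s := h.card_near_lt hc hs hδ
  set p : U → ℝ := fun u => ((C u ∩ c).card : ℝ) with hp
  have hp0 : ∀ u, 0 ≤ p u := fun u => Nat.cast_nonneg _
  have hpm : ∀ u, p u ≤ m := fun u =>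
    (Nat.cast_le.mpr (Finset.card_le_card Finset.inter_subset_left)).trans (h.card_le u)
  have hfar : ∀ u, u ∉ N → p u ≤ τ * m := by
    intro u hu
    by_contra hcon
    push Not at hcon
    exact hu (Finset.mem_filter.mpr ⟨Finset.mem_univ u, hcon.le⟩)
  have hsumT : ∀ T ∈ E, ∑ u ∈ T, p u ≤ ∑ u ∈ T ∩ N, p u + z * (τ * m) := by
    intro T hT
    rw [← Finset.sum_inter_add_sum_sdiff T N]
    refine add_le_add_right ?_ _
    refine (Finset.sum_le_card_nsmul _ _ (τ * m) fun u hu =>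
      hfar u (Finset.mem_sdiff.mp hu).2).trans ?_
    rw [nsmul_eq_mul]
    refine mul_le_mul_of_nonneg_right ?_ (by positivity)
    rw [← h.card_mem T hT]
    exact_mod_cast Finset.card_le_card Finset.sdiff_subset
  have hd : ∀ T ∈ E, z * m - (z : ℝ) ^ 2 * (δ * m) + c.card - 2 * ∑ u ∈ T ∩ N, p u
      - 2 * (z * (τ * m)) ≤ diffCard (T.biUnion C) c := by
    intro T hT
    have h1 := h.le_diffCard c hT
    have h2 := hsumT T hT
    simp only [hp] at h2 ⊢
    linarith
  -- Two bounds for the part of the center used by the codewords of `S`: the ones of the center are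
  -- counted nearly once (`hpc`), and each codeword has at most `m` ones (`hpS`). In `|c| - 2 * ∑
  -- p`, one copy of the sum is estimated by the first bound, which cancels `|c|`, and the other by
  -- the second.
  have hpc : ∀ S : Finset U, ∀ r : ℕ, S.card ≤ r →
      ∑ u ∈ S, p u ≤ c.card + (r : ℝ) ^ 2 * (δ * m) := by
    intro S r hr
    refine (h.sum_inter_le c S).trans (add_le_add_right ?_ _)
    have : (S.card : ℝ) ≤ r := by exact_mod_cast hr
    gcongr
  have hpS : ∀ S : Finset U, ∀ r : ℕ, S.card ≤ r → ∑ u ∈ S, p u ≤ r * m := by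
    intro S r hr
    refine (Finset.sum_le_card_nsmul _ _ m fun u _ => hpm u).trans ?_
    rw [nsmul_eq_mul]
    have : (S.card : ℝ) ≤ r := by exact_mod_cast hr
    gcongr
  have hTz : ∀ T ∈ E, (T ∩ N).card ≤ z := fun T hT =>
    (Finset.card_le_card Finset.inter_subset_left).trans (h.card_mem T hT).le
  set bad := E.filter fun T => y + 1 ≤ (T ∩ N).card with hbad
  have hbadc : bad.card ≤ 2 ^ s * Fintype.card U ^ (z - y - 1) :=
    (card_bad_le h.card_mem N).trans
      (Nat.mul_le_mul_right _ (Nat.pow_le_pow_right two_pos hNs.le))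
  have hgood : ∀ T ∈ E, T ∉ bad → (T ∩ N).card ≤ y := by
    intro T hT hTb
    by_contra hcon
    push Not at hcon
    exact hTb (Finset.mem_filter.mpr ⟨hT, hcon⟩)
  have hfirst : ∀ T ∈ E, T ∉ bad →
      (z - y) * m - (5 * z ^ 2 * δ + 2 * z * τ) * m ≤ diffCard (T.biUnion C) c := by
    intro T hT hTb
    have h1 := hd T hT
    have h2 := hpc (T ∩ N) z (hTz T hT)
    have h3 := hpS (T ∩ N) y (hgood T hT hTb)
    nlinarith
  -- With at most `y - 1` near vertices, the same computation as for `hfirst` gains a further `m`.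
  have hfew : ∀ T ∈ E, (T ∩ N).card < y →
      (z - y + 1) * m - (5 * z ^ 2 * δ + 2 * z * τ) * m ≤ diffCard (T.biUnion C) c := by
    intro T hT hTy
    have h1 := hd T hT
    have h2 := hpc (T ∩ N) z (hTz T hT)
    have h3 := hpS (T ∩ N) (y - 1) (by omega)
    rw [Nat.cast_sub hy, Nat.cast_one] at h3
    nlinarith
  by_cases hex : ∃ T₀ ∈ E, T₀ ∉ bad ∧ diffCard (T₀.biUnion C) c <
      (z - y + 1) * m - (5 * z ^ 2 * δ + 2 * z * τ) * m
  swap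
  · push Not at hex
    exact ⟨S₀, hS₀, bad, Finset.filter_subset _ _, hbadc, fun T hT hTb =>
      ⟨hfirst T hT hTb, fun _ => hex T hT hTb⟩⟩
  obtain ⟨T₀, hT₀, hT₀b, hlt₀⟩ := hex
  have hcard₀ : (T₀ ∩ N).card = y := by
    refine le_antisymm (hgood T₀ hT₀ hT₀b) ?_
    by_contra hcon
    push Not at hcon
    exact (hfew T₀ hT₀ hcon).not_gt hlt₀
  -- The trace on `N` of one close edge is the only `y`-set through which other good edges can be
  -- close.
  refine ⟨T₀ ∩ N, hcard₀, bad, Finset.filter_subset _ _, hbadc, fun T hT hTb =>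
    ⟨hfirst T hT hTb, fun hsub => ?_⟩⟩
  by_contra hcon
  push Not at hcon
  have hcard : (T ∩ N).card = y := by
    refine le_antisymm (hgood T hT hTb) ?_
    by_contra hcon'
    push Not at hcon'
    exact (hfew T hT hcon').not_gt hcon
  have hne : ((T ∩ N) ∩ (T₀ ∩ N)).card ≤ y - 1 := by
    have h1 : ((T ∩ N) ∩ (T₀ ∩ N)).card < (T₀ ∩ N).card := by
      refine Finset.card_lt_card (Finset.ssubset_iff_subset_ne.mpr
        ⟨Finset.inter_subset_right, fun heq => hsub ?_⟩)
      rw [← heq]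
      exact Finset.inter_subset_left.trans Finset.inter_subset_left
    omega
  have hun : ((T ∩ N) ∪ (T₀ ∩ N)).card ≤ 2 * z := by
    refine (Finset.card_union_le _ _).trans ?_
    omega
  have h1 := hd T hT
  have h2 := hd T₀ hT₀
  have h3 := hpc _ _ hun
  have h4 := hpS _ _ hne
  -- Adding the bounds for `T` and `T₀`, the union of the traces uses at most about `|c|` and the
  -- intersection at most `(y - 1) * m`, so the two distances sum to nearly `2 * (z - y + 1) * m`.
  -- The loss `10 * z ^ 2 * δ` consists of `2 * z ^ 2 * δ` from the two points and `2 * (2 * z) ^ 2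
  -- * δ` from the union; half of it explains the constant `5`.
  have h5 : ∑ u ∈ (T ∩ N) ∪ (T₀ ∩ N), p u + ∑ u ∈ (T ∩ N) ∩ (T₀ ∩ N), p u =
      ∑ u ∈ T ∩ N, p u + ∑ u ∈ T₀ ∩ N, p u := Finset.sum_union_inter
  rw [Nat.cast_sub hy, Nat.cast_one] at h4
  push_cast at h3
  nlinarith

/-- The cost of any choice of centers if no `k` sets of size `y` cover more than an `α` fraction. -/
theorem le_sum_diffCard (h : Codewords C E z m δ) {y : ℕ} (hy : 1 ≤ y) (hyz : y < z)
    (hyU : y ≤ Fintype.card U) {τ α : ℝ} {s k : ℕ} (hτ : 0 ≤ τ) (hs : 4 * z ≤ s * τ)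
    (hδ : (s : ℝ) ^ 2 * δ < 2 * z)
    (hα : ∀ S : Fin k → Finset U, (∀ i, (S i).card = y) →
      ((Finset.univ.biUnion fun i => E.filter fun T => S i ⊆ T).card : ℝ) ≤ α * E.card)
    (c : Fin k → Finset Ω) (σ : Finset U → Fin k) :
    E.card * ((z - y + (1 - α) - (5 * z ^ 2 * δ + 2 * z * τ)) * m) -
      k * (2 ^ s * (Fintype.card U : ℝ) ^ (z - y - 1)) * ((z - y + 1) * m) ≤
      ∑ T ∈ E, diffCard (T.biUnion C) (c (σ T)) := by
  have hm := h.pos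
  have hyzR : (y : ℝ) + 1 ≤ z := by exact_mod_cast hyz
  choose S hS bad hbadE hbad hbest using h.exists_best hy hyz hyU hτ hs hδ
  set e : ℝ := 5 * z ^ 2 * δ + 2 * z * τ with he
  have he0 : 0 ≤ e := by have := h.nonneg; positivity
  set cov := Finset.univ.biUnion fun i => E.filter fun T => S (c i) ⊆ T with hcov
  set B := Finset.univ.biUnion fun i => bad (c i) with hB
  have hcovc := hα (fun i => S (c i)) fun i => hS (c i)
  have hcovE : cov ⊆ E := Finset.biUnion_subset.mpr fun i _ => Finset.filter_subset _ _
  have hBc : (B.card : ℝ) ≤ k * (2 ^ s * (Fintype.card U : ℝ) ^ (z - y - 1)) := by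
    have : B.card ≤ k * (2 ^ s * Fintype.card U ^ (z - y - 1)) := by
      refine Finset.card_biUnion_le.trans ?_
      refine (Finset.sum_le_card_nsmul _ _ _ fun i _ => hbad (c i)).trans ?_
      simp
    exact_mod_cast this
  have hBE : B ⊆ E := Finset.biUnion_subset.mpr fun i _ => hbadE (c i)
  -- For bad edges the left side is at most zero, so the trivial bound suffices. For the others,
  -- being covered saves at most `m`.
  have hterm : ∀ T ∈ E, (z - y + 1 - e) * m - (if T ∈ cov then m else 0) -
      (if T ∈ B then (z - y + 1) * m else 0) ≤ diffCard (T.biUnion C) (c (σ T)) := by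
    intro T hT
    by_cases hTB : T ∈ B
    · rw [if_pos hTB]
      have h0 : 0 ≤ diffCard (T.biUnion C) (c (σ T)) := by unfold diffCard; positivity
      have h1 : 0 ≤ (if T ∈ cov then m else 0) := by split_ifs <;> linarith
      nlinarith
    · rw [if_neg hTB]
      have hTb : T ∉ bad (c (σ T)) := fun hmem =>
        hTB (Finset.mem_biUnion.mpr ⟨σ T, Finset.mem_univ _, hmem⟩)
      obtain ⟨h1, h2⟩ := hbest (c (σ T)) T hT hTb
      by_cases hTc : T ∈ cov
      · rw [if_pos hTc]
        linarith
      · rw [if_neg hTc]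
        have := h2 fun hsub => hTc (Finset.mem_biUnion.mpr
          ⟨σ T, Finset.mem_univ _, Finset.mem_filter.mpr ⟨hT, hsub⟩⟩)
        linarith
  refine le_trans ?_ (Finset.sum_le_sum hterm)
  rw [Finset.sum_sub_distrib, Finset.sum_sub_distrib, Finset.sum_const, nsmul_eq_mul,
    ← Finset.sum_filter, ← Finset.sum_filter, Finset.sum_const, Finset.sum_const,
    Finset.filter_mem_eq_inter, Finset.filter_mem_eq_inter, Finset.inter_eq_right.mpr hcovE,
    Finset.inter_eq_right.mpr hBE, nsmul_eq_mul, nsmul_eq_mul]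
  have h1 : (cov.card : ℝ) * m ≤ α * E.card * m := mul_le_mul_of_nonneg_right hcovc hm.le
  have h2 : (B.card : ℝ) * ((z - y + 1) * m) ≤
      k * (2 ^ s * (Fintype.card U : ℝ) ^ (z - y - 1)) * ((z - y + 1) * m) :=
    mul_le_mul_of_nonneg_right hBc (by nlinarith)
  linarith

end Codewords

end overlap

/-! ### Greedy codes of one-hot words -/

/-- The number of common ones of two words. -/
def inter (v w : List Bool) : ℕ := (List.zipWith and v w).count true

theorem inter_append {v v' w w' : List Bool} (h : v.length = w.length) :
    inter (v ++ v') (w ++ w') = inter v w + inter v' w' := by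
  unfold inter
  rw [List.zipWith_append h, List.count_append]

theorem inter_comm (v w : List Bool) : inter v w = inter w v := by
  unfold inter
  rw [List.zipWith_comm_of_comm]
  exact Bool.and_comm

/-- The words of length `q` with a single one. -/
def blocks (q : ℕ) : List (List Bool) :=
  (List.range q).map fun i => (List.range q).map fun j => decide (i = j)

theorem length_of_mem_blocks {q : ℕ} {b : List Bool} (hb : b ∈ blocks q) : b.length = q := by
  obtain ⟨i, -, rfl⟩ := List.mem_map.mp hb
  simp

theorem inter_block {q i j : ℕ} (hi : i < q) :
    inter ((List.range q).map fun t => decide (i = t)) ((List.range q).map fun t => decide (j = t)) =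
      if i = j then 1 else 0 := by
  unfold inter
  rw [List.zipWith_map, List.zipWith_self, List.count_eq_countP, List.countP_map]
  split_ifs with h
  · subst h
    have h1 : List.countP ((fun x => x == true) ∘ fun a => (decide (i = a) && decide (i = a)))
        (List.range q) = List.count i (List.range q) := by
      rw [List.count_eq_countP]
      refine List.countP_congr fun t _ => ?_
      simp only [Function.comp_apply, Bool.and_self, beq_iff_eq, decide_eq_true_eq]
      exact eq_comm
    rw [h1, List.count_eq_one_of_mem List.nodup_range (List.mem_range.mpr hi)]
  · rw [List.countP_eq_zero]
    intro t _
    simp only [Function.comp_apply, Bool.and_eq_true, decide_eq_true_eq, beq_iff_eq]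
    rintro ⟨rfl, rfl⟩
    exact h rfl

theorem inter_self_of_mem_blocks {q : ℕ} {b : List Bool} (hb : b ∈ blocks q) : inter b b = 1 := by
  obtain ⟨i, hi, rfl⟩ := List.mem_map.mp hb
  rw [inter_block (List.mem_range.mp hi), if_pos rfl]

/-- The block `b` itself contributes `q`, each of the other `q - 1` blocks contributes `1`. -/
theorem sum_pow_inter_blocks_le {q : ℕ} {b : List Bool} (hb : b ∈ blocks q) :
    ((blocks q).map fun b' => q ^ inter b' b).sum ≤ 2 * q := by
  obtain ⟨j, hj, rfl⟩ := List.mem_map.mp hb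
  unfold blocks
  rw [List.map_map]
  have h1 : ((List.range q).map ((fun b' => q ^ inter b' ((List.range q).map fun t => decide (j = t))) ∘
      fun i => (List.range q).map fun t => decide (i = t))).sum ≤
      ((List.range q).map fun i => 1 + if j = i then q else 0).sum := by
    refine List.sum_le_sum fun i hi => ?_
    simp only [Function.comp_apply]
    rw [inter_block (List.mem_range.mp hi)]
    by_cases h : i = j
    · subst h; simp
    · simp [h]
  refine h1.trans ?_
  rw [List.sum_map_add, ← List.sum_toFinset _ List.nodup_range,
    ← List.sum_toFinset (fun i => if j = i then q else 0) List.nodup_range, List.toFinset_range,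
    Finset.sum_ite_eq, if_pos (Finset.mem_range.mpr (List.mem_range.mp hj))]
  simp
  omega

/-- Concatenations of `m` blocks. -/
def words (B : List (List Bool)) : ℕ → List (List Bool)
  | 0 => [[]]
  | m + 1 => B.flatMap fun b => (words B m).map (b ++ ·)

theorem length_words (B : List (List Bool)) (m : ℕ) : (words B m).length = B.length ^ m := by
  induction m with
  | zero => rfl
  | succ m ih => simp [words, List.length_flatMap, ih, pow_succ, mul_comm]

theorem length_of_mem_words {q m : ℕ} {w : List Bool} (hw : w ∈ words (blocks q) m) :
    w.length = q * m := by
  induction m generalizing w with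
  | zero => simp [words] at hw; simp [hw]
  | succ m ih =>
    obtain ⟨b, hb, hw⟩ := List.mem_flatMap.mp hw
    obtain ⟨w', hw', rfl⟩ := List.mem_map.mp hw
    rw [List.length_append, length_of_mem_blocks hb, ih hw', mul_add, mul_one, add_comm]

theorem inter_self_of_mem_words {q m : ℕ} {w : List Bool} (hw : w ∈ words (blocks q) m) :
    inter w w = m := by
  induction m generalizing w with
  | zero => simp [words] at hw; simp [hw, inter]
  | succ m ih =>
    obtain ⟨b, hb, hw⟩ := List.mem_flatMap.mp hw
    obtain ⟨w', hw', rfl⟩ := List.mem_map.mp hw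
    rw [inter_append rfl, ih hw', inter_self_of_mem_blocks hb, add_comm]

/-- An exponential moment of the number of agreements with a fixed word: it factors over the blocks,
each of which contributes at most `2 * q`. -/
theorem sum_pow_inter_words_le {q m : ℕ} {w : List Bool} (hw : w ∈ words (blocks q) m) :
    ((words (blocks q) m).map fun v => q ^ inter v w).sum ≤ (2 * q) ^ m := by
  induction m generalizing w with
  | zero => simp [words] at hw; simp [words, hw, inter]
  | succ m ih =>
    obtain ⟨b, hb, hw⟩ := List.mem_flatMap.mp hw
    obtain ⟨w', hw', rfl⟩ := List.mem_map.mp hw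
    have h1 := ih hw'
    have h2 := sum_pow_inter_blocks_le hb
    have h3 : ∀ L : List (List Bool), (∀ b' ∈ L, b'.length = q) →
        ((L.flatMap fun b' => (words (blocks q) m).map (b' ++ ·)).map
          fun v => q ^ inter v (b ++ w')).sum =
        (L.map fun b' => q ^ inter b' b).sum *
          ((words (blocks q) m).map fun v => q ^ inter v w').sum := by
      intro L hL
      induction L with
      | nil => simp
      | cons b' L ihL =>
        have h4 : b'.length = b.length := by
          rw [hL b' List.mem_cons_self, length_of_mem_blocks hb]
        rw [List.flatMap_cons, List.map_append, List.sum_append,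
          ihL fun b'' h => hL b'' (List.mem_cons_of_mem _ h), List.map_cons, List.sum_cons, add_mul,
          List.map_map]
        congr 1
        rw [← List.sum_map_mul_left]
        congr 1
        refine List.map_congr_left fun v _ => ?_
        simp only [Function.comp_apply]
        rw [inter_append h4, pow_add]
    rw [words, h3 _ fun b' h => length_of_mem_blocks h, pow_succ, mul_comm]
    exact Nat.mul_le_mul h1 h2

/-- Choose words one after the other that are compatible with the words chosen before. -/
def greedy {α : Type} (ok : α → α → Bool) (ws : List α) : List α :=
  ws.foldl (fun acc w => bif acc.all fun v => ok v w then w :: acc else acc) []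

section greedy

variable {α : Type} {ok : α → α → Bool}

/-- The last property is the maximality of the greedy choice: a rejected word is incompatible with a
word already chosen, and chosen words are never removed. New words are put in front, whence the
order of the arguments in the pairwise relation. -/
theorem greedy_spec (ws : List α) : ∀ acc : List α, acc.Pairwise (fun v w => ok w v = true) →
    let res := ws.foldl (fun acc w => bif acc.all fun v => ok v w then w :: acc else acc) acc
    res.Pairwise (fun v w => ok w v = true) ∧ (∀ v ∈ res, v ∈ acc ∨ v ∈ ws) ∧
      (∀ v ∈ acc, v ∈ res) ∧ ∀ w ∈ ws, ∃ v ∈ res, ok v w = false ∨ v = w := by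
  induction ws with
  | nil => intro acc h; simpa using h
  | cons w ws ih =>
    intro acc hacc
    simp only [List.foldl_cons]
    cases hall : acc.all fun v => ok v w with
    | true =>
      obtain ⟨h1, h2, h3, h4⟩ := ih (w :: acc) (List.pairwise_cons.mpr
        ⟨fun v hv => List.all_eq_true.mp hall v hv, hacc⟩)
      refine ⟨h1, fun v hv => ?_, fun v hv => h3 v (List.mem_cons_of_mem _ hv), fun v hv => ?_⟩
      · rcases h2 v hv with h | h
        · rcases List.mem_cons.mp h with rfl | h
          · exact Or.inr List.mem_cons_self
          · exact Or.inl h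
        · exact Or.inr (List.mem_cons_of_mem _ h)
      · rcases List.mem_cons.mp hv with rfl | hv
        · exact ⟨v, h3 v List.mem_cons_self, Or.inr rfl⟩
        · exact h4 v hv
    | false =>
      obtain ⟨h1, h2, h3, h4⟩ := ih acc hacc
      refine ⟨h1, fun v hv => (h2 v hv).imp_right (List.mem_cons_of_mem _), h3, fun v hv => ?_⟩
      rcases List.mem_cons.mp hv with rfl | hv
      · obtain ⟨u, hu, hok⟩ := List.all_eq_false.mp hall
        exact ⟨u, h3 u hu, Or.inl (by simpa using hok)⟩
      · exact h4 v hv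

/-- Every word is counted by at least one member of `acc`. -/
theorem length_le_sum_countP (ws acc : List α) (p : α → α → Bool)
    (h : ∀ w ∈ ws, ∃ v ∈ acc, p v w = true) :
    ws.length ≤ (acc.map fun v => ws.countP (p v)).sum := by
  induction ws with
  | nil => simp
  | cons w ws ih =>
    have h1 := ih fun w' hw' => h w' (List.mem_cons_of_mem _ hw')
    obtain ⟨v, hv, hp⟩ := h w List.mem_cons_self
    have h2 : (acc.map fun v => (w :: ws).countP (p v)).sum =
        (acc.map fun v => ws.countP (p v)).sum + (acc.map fun v => if p v w then 1 else 0).sum := by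
      rw [← List.sum_map_add]
      congr 1
      exact List.map_congr_left fun v _ => List.countP_cons
    have h3 : 1 ≤ (acc.map fun v => if p v w then 1 else 0).sum := by
      refine le_trans ?_ (List.single_le_sum (fun _ _ => Nat.zero_le _) _
        (List.mem_map_of_mem (f := fun v => if p v w then 1 else 0) hv))
      rw [if_pos hp]
    rw [List.length_cons]
    omega

/-- This is Markov's inequality in counting form. -/
theorem countP_mul_le_sum (ws : List α) (p : α → Bool) (f : α → ℕ) (b : ℕ)
    (h : ∀ w, p w = true → b ≤ f w) : ws.countP p * b ≤ (ws.map f).sum := by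
  induction ws with
  | nil => simp
  | cons w ws ih =>
    rw [List.countP_cons, List.map_cons, List.sum_cons, add_mul]
    split_ifs with hp
    · have := h w hp; omega
    · omega

end greedy

/-- Greedily chosen one-hot words any two of which agree in at most `m / D` blocks. -/
def code (D q m : ℕ) : List (List Bool) :=
  greedy (fun v w => decide (D * inter v w ≤ m)) (words (blocks q) m)

section code

variable {D q m : ℕ}

theorem mem_words_of_mem_code {w : List Bool} (hw : w ∈ code D q m) : w ∈ words (blocks q) m := by
  have h := (greedy_spec (ok := fun v w => decide (D * inter v w ≤ m)) (words (blocks q) m) []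
    List.Pairwise.nil).2.1 w hw
  simpa using h

theorem pairwise_code : (code D q m).Pairwise fun v w => D * inter v w ≤ m :=
  (greedy_spec (ok := fun v w => decide (D * inter v w ≤ m)) (words (blocks q) m) []
    List.Pairwise.nil).1.imp fun {v w} h => by
      rw [inter_comm]
      exact of_decide_eq_true h

/-- A Gilbert–Varshamov argument. By maximality every word agrees with some codeword in at least `m
/ D` blocks, where `q ^ inter` is at least `2 ^ (a * m)` by the choice of `q`. By Markov's
inequality a codeword accounts for at most `(2 * q) ^ m / 2 ^ (a * m)` of the `q ^ m` words, so
there are at least `2 ^ (a * m) / 2 ^ m ≥ (2 * z) ^ m` codewords. -/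
theorem pow_le_length_code {a z : ℕ} (hD : 2 ≤ D) (hm : 1 ≤ m) (ha : 4 * z ≤ 2 ^ a) :
    z * 2 ^ m ≤ (code D (2 ^ (D * a)) m).length := by
  set q := 2 ^ (D * a) with hq
  set W := words (blocks q) m with hW
  have hcov : ∀ w ∈ W, ∃ v ∈ code D q m, decide (m ≤ D * inter w v) = true := by
    intro w hw
    obtain ⟨v, hv, h⟩ := (greedy_spec (ok := fun v w => decide (D * inter v w ≤ m)) W []
      List.Pairwise.nil).2.2.2 w hw
    refine ⟨v, hv, decide_eq_true ?_⟩
    rcases h with h | rfl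
    · have := of_decide_eq_false h
      rw [inter_comm]
      omega
    · rw [inter_self_of_mem_words hw]
      nlinarith
  have h1 := length_le_sum_countP W (code D q m) (fun v w => decide (m ≤ D * inter w v)) hcov
  have h2 : ∀ v ∈ code D q m,
      W.countP (fun w => decide (m ≤ D * inter w v)) * 2 ^ (a * m) ≤ (2 * q) ^ m := by
    intro v hv
    refine (countP_mul_le_sum W _ (fun w => q ^ inter w v) _ fun w hw => ?_).trans
      (sum_pow_inter_words_le (mem_words_of_mem_code hv))
    rw [hq, ← pow_mul]
    refine Nat.pow_le_pow_right two_pos ?_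
    have := of_decide_eq_true hw
    nlinarith
  have h3 : W.length * 2 ^ (a * m) ≤ (code D q m).length * (2 * q) ^ m := by
    refine (Nat.mul_le_mul_right _ h1).trans ?_
    rw [mul_comm, ← List.sum_map_mul_left]
    refine (List.sum_le_card_nsmul _ ((2 * q) ^ m) ?_).trans ?_
    · intro x hx
      obtain ⟨v, hv, rfl⟩ := List.mem_map.mp hx
      rw [mul_comm]
      exact h2 v hv
    · simp
  have hq0 : 0 < q ^ m := by positivity
  have h4 : W.length = q ^ m := by
    rw [hW, length_words]
    simp [blocks]
  rw [h4, mul_pow, ← mul_assoc, mul_comm] at h3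
  have h5 : 2 ^ (a * m) ≤ (code D q m).length * 2 ^ m := Nat.le_of_mul_le_mul_right h3 hq0
  have h6 : (4 * z) ^ m ≤ 2 ^ (a * m) := by
    rw [pow_mul]
    exact Nat.pow_le_pow_left ha m
  have h7 : (2 * z) ^ m * 2 ^ m ≤ (code D q m).length * 2 ^ m := by
    refine le_trans (le_of_eq ?_) (h6.trans h5)
    rw [← mul_pow]
    congr 1
    ring
  refine le_trans ?_ (Nat.le_of_mul_le_mul_right h7 (by positivity))
  rw [mul_pow, mul_comm]
  exact Nat.mul_le_mul_left _ (Nat.le_self_pow (by omega) z)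

end code

/-! ### Assigning codewords to columns -/

/-- Assign the words to the positions of the ones, and the empty word to other positions. -/
def assign : List Bool → List (List Bool) → List (List Bool)
  | [], _ => []
  | true :: us, ws => ws.headD [] :: assign us ws.tail
  | false :: us, ws => [] :: assign us ws

theorem length_assign (us : List Bool) : ∀ ws, (assign us ws).length = us.length := by
  induction us with
  | nil => intro ws; rfl
  | cons u us ih => intro ws; cases u <;> simp [assign, ih]

theorem mem_assign (us : List Bool) : ∀ ws, ∀ w ∈ assign us ws, w ∈ ws ∨ w = [] := by
  induction us with
  | nil => intro ws w hw; simp [assign] at hw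
  | cons u us ih =>
    intro ws w hw
    cases u with
    | true =>
      rw [assign] at hw
      rcases List.mem_cons.mp hw with rfl | hw
      · cases ws <;> simp
      · exact (ih _ w hw).imp_left List.mem_of_mem_tail
    | false =>
      rw [assign] at hw
      rcases List.mem_cons.mp hw with rfl | hw
      · exact Or.inr rfl
      · exact ih _ w hw

theorem pairwise_assign {D m : ℕ} (us : List Bool) : ∀ ws : List (List Bool),
    ws.Pairwise (fun v w => D * inter v w ≤ m) →
    (assign us ws).Pairwise (fun v w => D * inter v w ≤ m) := by
  induction us with
  | nil => intro ws _; exact List.Pairwise.nil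
  | cons u us ih =>
    intro ws h
    cases u with
    | false => exact List.pairwise_cons.mpr ⟨fun w _ => by simp [inter], ih ws h⟩
    | true =>
      cases ws with
      | nil => exact List.pairwise_cons.mpr ⟨fun w _ => by simp [inter], ih [] h⟩
      | cons v ws =>
        obtain ⟨h1, h2⟩ := List.pairwise_cons.mp h
        refine List.pairwise_cons.mpr ⟨fun w hw => ?_, ih ws h2⟩
        rcases mem_assign us ws w hw with hw | rfl
        · exact h1 w hw
        · simp [inter]

theorem getD_assign_mem (us : List Bool) : ∀ (ws : List (List Bool)) (i : ℕ),
    us.count true ≤ ws.length → us.getD i false = true → (assign us ws).getD i [] ∈ ws := by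
  induction us with
  | nil => intro ws i _ h; simp at h
  | cons u us ih =>
    intro ws i hlen h
    cases u with
    | false =>
      cases i with
      | zero => simp at h
      | succ i => exact ih ws i (by simpa using hlen) (by simpa using h)
    | true =>
      cases ws with
      | nil => simp at hlen
      | cons w ws =>
        cases i with
        | zero => simp [assign]
        | succ i =>
          exact List.mem_cons_of_mem _ (ih ws i (by simpa using hlen) (by simpa using h))

/-- The disjunction of words. -/
def orL (v w : List Bool) : List Bool := List.zipWith or v w

theorem length_orL {v w : List Bool} (h : v.length = w.length) : (orL v w).length = v.length := by
  simp [orL, h]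

theorem getD_orL {v w : List Bool} (h : v.length = w.length) (i : ℕ) :
    (orL v w).getD i false = (v.getD i false || w.getD i false) := by
  induction v generalizing w i with
  | nil =>
    cases w with
    | nil => rfl
    | cons => simp at h
  | cons a v ih =>
    cases w with
    | nil => simp at h
    | cons b w =>
      cases i with
      | zero => rfl
      | succ i => exact ih (by simpa using h) i

/-- The disjunction of a list of words of equal length. -/
theorem getD_foldl_orL (rows : List (List Bool)) : ∀ acc : List Bool,
    (∀ r ∈ rows, r.length = acc.length) →
    (rows.foldl orL acc).length = acc.length ∧ ∀ i, (rows.foldl orL acc).getD i false = true ↔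
      acc.getD i false = true ∨ ∃ r ∈ rows, r.getD i false = true := by
  induction rows with
  | nil => intro acc _; simp
  | cons r rows ih =>
    intro acc h
    have h1 := length_orL (h r List.mem_cons_self).symm
    obtain ⟨h2, h3⟩ := ih (orL acc r) fun r' hr' => by
      rw [h1]; exact h r' (List.mem_cons_of_mem _ hr')
    refine ⟨by rw [List.foldl_cons, h2, h1], fun i => ?_⟩
    rw [List.foldl_cons, h3, getD_orL (h r List.mem_cons_self).symm, Bool.or_eq_true]
    simp [or_assoc]

/-- The disjunction of the words at the positions of the ones of a row. -/
def point (zeros : List Bool) (A : List (List Bool)) (r : List Bool) : List Bool :=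
  (r.zip A).foldl (fun acc p => bif p.1 then orL acc p.2 else acc) zeros

/-- Because `orL` truncates to the shorter word, lengths have to match, but only at the ones of `r`;
the empty words assigned to unused columns do no harm. -/
theorem getD_point (r : List Bool) : ∀ (A : List (List Bool)) (acc : List Bool),
    (∀ i, r.getD i false = true → i < A.length → (A.getD i []).length = acc.length) →
    (point acc A r).length = acc.length ∧ ∀ j, (point acc A r).getD j false = true ↔
      acc.getD j false = true ∨
        ∃ i, r.getD i false = true ∧ (A.getD i []).getD j false = true := by
  induction r with
  | nil => intro A acc _; simp [point]
  | cons b r ih =>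
    intro A acc h
    cases A with
    | nil => simp [point]
    | cons w A =>
      have hsucc : ∀ i, r.getD i false = true → i < A.length →
          (A.getD i []).length = acc.length := fun i h1 h2 =>
        h (i + 1) (by simpa using h1) (by simpa using h2)
      have hex : ∀ j, (∃ i, (b :: r).getD i false = true ∧
          ((w :: A).getD i []).getD j false = true) ↔ (b = true ∧ w.getD j false = true) ∨
          ∃ i, r.getD i false = true ∧ (A.getD i []).getD j false = true := by
        intro j
        constructor
        · rintro ⟨i, h1, h2⟩
          cases i with
          | zero => exact Or.inl ⟨by simpa using h1, by simpa using h2⟩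
          | succ i => exact Or.inr ⟨i, by simpa using h1, by simpa using h2⟩
        · rintro (⟨h1, h2⟩ | ⟨i, h1, h2⟩)
          · exact ⟨0, by simpa using h1, by simpa using h2⟩
          · exact ⟨i + 1, by simpa using h1, by simpa using h2⟩
      cases b with
      | false =>
        obtain ⟨h1, h2⟩ := ih A acc hsucc
        refine ⟨h1, fun j => (h2 j).trans ?_⟩
        rw [hex]
        simp
      | true =>
        have hw : acc.length = w.length := by simpa using (h 0 (by simp) (by simp)).symm
        have hlen := length_orL hw
        obtain ⟨h1, h2⟩ := ih A (orL acc w) fun i h1 h2 => by rw [hlen]; exact hsucc i h1 h2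
        refine ⟨h1.trans hlen, fun j => (h2 j).trans ?_⟩
        rw [hex, getD_orL hw, Bool.or_eq_true]
        simp [or_assoc]

/-! ### Words as sets of positions -/

/-- The positions of the ones of a word. -/
def onesSet (d : ℕ) (w : List Bool) : Finset (Fin d) := {j | w.getD j false = true}

/-- Lengths below `d` are admitted so that the empty word of an unused vertex gives the empty set.
-/
theorem card_onesSet {d : ℕ} (w : List Bool) (hw : w.length ≤ d) :
    (onesSet d w).card = w.count true := by
  unfold onesSet
  induction d generalizing w with
  | zero => simp at hw; simp [hw]
  | succ d ih =>
    cases w with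
    | nil => simp
    | cons b w =>
      rw [Fin.card_filter_univ_succ]
      have h := ih w (by simpa using hw)
      cases b <;> simp at h ⊢ <;> omega

theorem card_onesSet_inter {d : ℕ} {v w : List Bool} (hv : v.length ≤ d) :
    (onesSet d v ∩ onesSet d w).card = inter v w := by
  have h : onesSet d v ∩ onesSet d w = onesSet d (List.zipWith and v w) := by
    ext j
    simp only [onesSet, Finset.mem_inter, Finset.mem_filter, Finset.mem_univ, true_and]
    have key : ∀ (v w : List Bool) (i : ℕ), (v.getD i false = true ∧ w.getD i false = true) ↔
        (List.zipWith and v w).getD i false = true := by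
      intro v
      induction v with
      | nil => simp
      | cons a v ih =>
        intro w i
        cases w with
        | nil => simp
        | cons b w =>
          cases i with
          | zero => simp
          | succ i => simpa using ih w i
    exact key v w j
  rw [h, card_onesSet _ (by simp; omega)]
  rfl

/-! ### Medians of Boolean points -/

theorem norm_boolPoint_sub {d : ℕ} (a : Fin d → Bool) (x : L1 d) :
    ‖boolPoint a - x‖ = ∑ i, |(if a i then (1 : ℝ) else 0) - x i| := by
  rw [PiLp.norm_eq_of_L1]
  rfl

/-- The majority bit minimizes the sum of the distances to bits. -/
theorem exists_majority {ι : Type*} (P : Finset ι) (f : ι → Bool) :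
    ∃ b : Bool, IsMedian P (fun a => if f a then (1 : ℝ) else 0) (if b then 1 else 0) ∧
      ∀ x : ℝ, ∑ a ∈ P, |(if f a then (1 : ℝ) else 0) - (if b then 1 else 0)| ≤
        ∑ a ∈ P, |(if f a then (1 : ℝ) else 0) - x| := by
  have hcard : (P.filter fun a => f a = true).card + (P.filter fun a => ¬ f a = true).card =
      P.card := Finset.card_filter_add_card_filter_not _
  set p := (P.filter fun a => f a = true).card with hp
  set r := (P.filter fun a => ¬ f a = true).card with hr
  have hsum : ∀ x : ℝ, ∑ a ∈ P, |(if f a then (1 : ℝ) else 0) - x| = p * |1 - x| + r * |x| := by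
    intro x
    rw [← Finset.sum_filter_add_sum_filter_not P (fun a => f a = true)]
    congr 1
    · rw [Finset.sum_congr rfl (g := fun _ => |1 - x|) fun a ha => by
        rw [if_pos (Finset.mem_filter.mp ha).2], Finset.sum_const, nsmul_eq_mul]
    · rw [Finset.sum_congr rfl (g := fun _ => |x|) fun a ha => by
        rw [if_neg (Finset.mem_filter.mp ha).2, zero_sub, abs_neg], Finset.sum_const, nsmul_eq_mul]
  -- Hence `p * |1 - x| + r * |x| ≥ min p r`, which is the cost of the majority bit.
  have hone : ∀ x : ℝ, 1 ≤ |1 - x| + |x| := fun x => by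
    have := abs_add_le (1 - x) x
    simpa using this
  have hlt1 : (P.filter fun a => (if f a then (1 : ℝ) else 0) < 1).card = r := by
    rw [hr]
    congr 1
    refine Finset.filter_congr fun a _ => ?_
    cases f a <;> simp
  have hlt0 : (P.filter fun a => (if f a then (1 : ℝ) else 0) < 0).card = 0 := by
    rw [Finset.card_eq_zero, Finset.filter_eq_empty_iff]
    intro a _
    cases f a <;> simp
  have hgt1 : (P.filter fun a => 1 < (if f a then (1 : ℝ) else 0)).card = 0 := by
    rw [Finset.card_eq_zero, Finset.filter_eq_empty_iff]
    intro a _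
    cases f a <;> simp
  have hgt0 : (P.filter fun a => 0 < (if f a then (1 : ℝ) else 0)).card = p := by
    rw [hp]
    congr 1
    refine Finset.filter_congr fun a _ => ?_
    cases f a <;> simp
  by_cases hle : r ≤ p
  · refine ⟨true, ⟨?_, ?_⟩, fun x => ?_⟩
    · simp only [if_true]
      rw [hlt1]
      omega
    · simp only [if_true]
      rw [hgt1]
      omega
    · have hle' : (r : ℝ) ≤ p := by exact_mod_cast hle
      simp only [if_true]
      rw [hsum, hsum]
      have h1 := hone x
      simp only [sub_self, abs_zero, mul_zero, zero_add, abs_one, mul_one]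
      nlinarith [abs_nonneg (1 - x), abs_nonneg x, Nat.cast_nonneg (α := ℝ) r]
  · refine ⟨false, ⟨?_, ?_⟩, fun x => ?_⟩
    · simp only [Bool.false_eq_true, if_false]
      rw [hlt0]
      omega
    · simp only [Bool.false_eq_true, if_false]
      rw [hgt0]
      omega
    · have hle' : (p : ℝ) ≤ r := by exact_mod_cast (not_le.mp hle).le
      simp only [Bool.false_eq_true, if_false]
      rw [hsum, hsum]
      have h1 := hone x
      simp only [sub_zero, abs_zero, mul_zero, add_zero, abs_one, mul_one]
      nlinarith [abs_nonneg (1 - x), abs_nonneg x, Nat.cast_nonneg (α := ℝ) p]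

/-- The coordinatewise majority is a median that minimizes the cost of one cluster. -/
theorem exists_bool_median (d : ℕ) (P : Finset (Fin d → Bool)) : ∃ c : Fin d → Bool,
    (∀ i, IsMedian P (fun a => boolPoint a i) (boolPoint c i)) ∧
    ∀ x : L1 d, ∑ a ∈ P, ‖boolPoint a - boolPoint c‖ ≤ ∑ a ∈ P, ‖boolPoint a - x‖ := by
  choose c hc hmin using fun i : Fin d => exists_majority P fun a : Fin d → Bool => a i
  refine ⟨c, hc, fun x => ?_⟩
  simp only [norm_boolPoint_sub]
  rw [Finset.sum_comm, Finset.sum_comm (s := P)]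
  exact Finset.sum_le_sum fun i _ => hmin i (x i)

/-- Centers can be replaced by Boolean centers without increasing the cost. -/
theorem exists_bool_centers {d k : ℕ} (P : Finset (Fin d → Bool)) (c : Fin k → L1 d)
    (σ : (Fin d → Bool) → Fin k) : ∃ b : Fin k → Fin d → Bool,
      cost P (fun i => boolPoint (b i)) σ ≤ cost P c σ := by
  choose b _ hb using fun i : Fin k => exists_bool_median d (P.filter fun a => σ a = i)
  refine ⟨b, ?_⟩
  unfold cost
  rw [← Finset.sum_fiberwise P σ, ← Finset.sum_fiberwise P σ]
  refine Finset.sum_le_sum fun i _ => ?_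
  have h : ∀ c' : Fin k → L1 d, ∑ a ∈ P with σ a = i, ‖boolPoint a - c' (σ a)‖ =
      ∑ a ∈ P with σ a = i, ‖boolPoint a - c' i‖ := fun c' =>
    Finset.sum_congr rfl fun a ha => by rw [(Finset.mem_filter.mp ha).2]
  rw [h fun i => boolPoint (b i), h c]
  exact hb i (c i)

/-- The set of the coordinates of a Boolean point that are one. -/
def support {d : ℕ} (a : Fin d → Bool) : Finset (Fin d) := {i | a i = true}

theorem norm_boolPoint_sub_boolPoint {d : ℕ} (a b : Fin d → Bool) :
    ‖boolPoint a - boolPoint b‖ = diffCard (support a) (support b) := by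
  rw [norm_boolPoint_sub]
  have h : ∀ i, |(if a i then (1 : ℝ) else 0) - boolPoint b i| =
      (if i ∈ support a \ support b then 1 else 0) +
        (if i ∈ support b \ support a then 1 else 0) := by
    intro i
    simp only [support, boolPoint, Finset.mem_sdiff, Finset.mem_filter, Finset.mem_univ, true_and]
    cases a i <;> cases b i <;> simp
  simp_rw [h]
  rw [Finset.sum_add_distrib]
  simp only [Finset.sum_boole, Finset.filter_univ_mem]
  rfl

theorem sz_bits_le (l : List Bool) : sz l ≤ 4 * l.length + 1 := by
  have := sz_le_length_mul (l := l) (b := 3) fun x _ => sz_bool_le x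
  omega

/-! ### Parsing -/

/-- The state of the parser: whether the unary number is being read, whether the next symbol is a
bit of a row, the unary number, the current row, and the rows before. -/
abbrev ParseState : Type := Bool × Bool × List Bool × List Bool × List (List Bool)

/-- One step of the parser. -/
def parseStep (s : ParseState) (b : Bool) : ParseState :=
  bif s.1 then
    bif b then (true, false, true :: s.2.2.1, [], []) else (false, false, s.2.2.1, [], [])
  else bif s.2.1 then (false, false, s.2.2.1, s.2.2.2.1 ++ [b], s.2.2.2.2)
  else bif b then (false, true, s.2.2.1, s.2.2.2.1, s.2.2.2.2)
  else (false, false, s.2.2.1, [], s.2.2.2.2 ++ [s.2.2.2.1])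

/-- Recover the unary number and the rows. -/
def parse (w : List Bool) : List Bool × List (List Bool) :=
  let s := w.foldl parseStep (true, false, [], [], [])
  (s.2.2.1, s.2.2.2.2)

/-- Only descriptions of instances reach the reduction, so the behaviour of `parse` on other strings
is irrelevant. -/
theorem parse_encode (k : ℕ) (rows : List (List Bool)) :
    parse (encode k rows) = (List.replicate k true, rows) := by
  have h1 : ∀ (k : ℕ) (l : List Bool), (List.replicate k true).foldl parseStep
      (true, false, l, [], []) = (true, false, List.replicate k true ++ l, [], []) := by
    intro k
    induction k with
    | zero => intro l; rfl
    | succ k ih =>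
      intro l
      rw [List.replicate_succ, List.foldl_cons]
      refine (ih (true :: l)).trans ?_
      rw [← List.replicate_succ, List.replicate_succ']
      simp
  have h2 : ∀ (r l cur : List Bool) (R : List (List Bool)), (encodeRow r).foldl parseStep
      (false, false, l, cur, R) = (false, false, l, [], R ++ [cur ++ r]) := by
    intro r
    induction r with
    | nil => intro l cur R; simp [encodeRow, parseStep]
    | cons b r ih =>
      intro l cur R
      refine (ih l (cur ++ [b]) R).trans ?_
      simp
  have h3 : ∀ (rows : List (List Bool)) (l : List Bool) (R : List (List Bool)),
      (rows.flatMap encodeRow).foldl parseStep (false, false, l, [], R) =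
        (false, false, l, [], R ++ rows) := by
    intro rows
    induction rows with
    | nil => intro l R; simp
    | cons r rows ih =>
      intro l R
      rw [List.flatMap_cons, List.foldl_append, h2, ih]
      simp
  unfold parse encode
  rw [List.foldl_append, List.foldl_append, h1]
  have h4 : [false].foldl parseStep (true, false, List.replicate k true ++ [], [], []) =
      (false, false, List.replicate k true, [], []) := by
    simp [parseStep]
  rw [h4, h3]
  simp

namespace PolyT

variable {α β γ : Type} [Enc α] [Enc β] [Enc γ]

theorem parseStep {f : α → ParseState} {g : α → Bool} (hf : PolyT f) (hg : PolyT g) :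
    PolyT fun x => parseStep (f x) (g x) := by
  have hk := hf.snd.snd.fst
  have hcur := hf.snd.snd.snd.fst
  have hR := hf.snd.snd.snd.snd
  exact cond hf.fst
    (cond hg ((const true).pair ((const false).pair (((const true).cons hk).pair
        ((const []).pair (const [])))))
      ((const false).pair ((const false).pair (hk.pair ((const []).pair (const []))))))
    (cond hf.snd.fst ((const false).pair ((const false).pair (hk.pair
        ((hcur.append (hg.cons (const []))).pair hR))))
      (cond hg ((const false).pair ((const true).pair (hk.pair (hcur.pair hR))))
        ((const false).pair ((const false).pair (hk.pair ((const []).pair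
          (hR.append (hcur.cons (const [])))))))))

theorem parse : PolyT KMedianL1.parse := by
  have h : PolyT fun w : List Bool =>
      w.foldl KMedianL1.parseStep (true, false, [], [], []) := by
    refine foldl_add (step := fun _ s b => KMedianL1.parseStep s b) id (const _)
      (parseStep id.snd.snd id.fst) (PolyBdd.const 20) fun w s b _ => ?_
    obtain ⟨s1, s2, k, cur, R⟩ := s
    have h1 := sz_append cur [b]
    have h2 := sz_append R [cur]
    have h3 := sz_bool_le b
    have h4 := one_le_sz s1
    have h5 := one_le_sz s2
    have h6 := one_le_sz cur
    have h7 := one_le_sz R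
    have h8 := sz_bool_le true
    have h9 := sz_bool_le false
    simp only [sz_cons, sz_nil] at h1 h2
    unfold KMedianL1.parseStep
    cases s1 <;> cases s2 <;> cases b <;> simp only [cond_true, cond_false, sz_pair, sz_cons,
      sz_nil] at h1 h2 h3 ⊢ <;> omega
  exact h.snd.snd.fst.pair h.snd.snd.snd.snd

theorem encodeRow {f : α → List Bool} (hf : PolyT f) : PolyT fun x => encodeRow (f x) :=
  (flatMap (f := fun _ b => [true, b]) hf ((const true).cons (id.snd.cons (const [])))).append
    (const [false])

end PolyT

/-! ### The reduction as a function on strings -/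

/-- A list with as many elements as the binary representation of the length has digits. -/
def sizeList {β : Type} (l : List β) : List Bool :=
  (l.foldl (fun (s : List Bool × List Bool) _ =>
    bif decide (s.2.length ≤ l.length) then (true :: s.1, s.2 ++ s.2) else s) ([], [true])).1

section sizeList

variable {β : Type} (l : List β)

/-- The second component doubles as long as its length is at most `|l|` and the first one counts the
doublings; the process stops at the first power of two above `|l|`. -/
theorem sizeList_spec (l' : List β) (h : l'.length ≤ l.length) :
    let s := l'.foldl (fun (s : List Bool × List Bool) _ =>
      bif decide (s.2.length ≤ l.length) then (true :: s.1, s.2 ++ s.2) else s) ([], [true])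
    s.1.length = min l'.length (Nat.size l.length) ∧ s.2.length = 2 ^ s.1.length := by
  induction l' using List.reverseRecOn with
  | nil => simp
  | append_singleton l' x ih =>
    rw [List.length_append, List.length_singleton] at h
    obtain ⟨h1, h2⟩ := ih (by omega)
    simp only [List.foldl_append, List.foldl_cons, List.foldl_nil]
    generalize l'.foldl (fun (s : List Bool × List Bool) _ =>
      bif decide (s.2.length ≤ l.length) then (true :: s.1, s.2 ++ s.2) else s) ([], [true]) = s
      at h1 h2
    by_cases hle : s.2.length ≤ l.length
    · rw [decide_eq_true hle, cond_true]
      have h3 : s.1.length < Nat.size l.length := Nat.lt_size.mpr (h2 ▸ hle)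
      refine ⟨?_, ?_⟩
      · simp only [List.length_cons, List.length_append, List.length_nil]
        omega
      · simp only [List.length_cons, List.length_append, pow_succ]
        omega
    · rw [decide_eq_false hle, cond_false]
      have h3 : ¬ s.1.length < Nat.size l.length := fun h => hle (h2 ▸ Nat.lt_size.mp h)
      refine ⟨?_, h2⟩
      simp only [List.length_cons, List.length_append, List.length_nil]
      omega

theorem length_sizeList : (sizeList l).length = Nat.size l.length := by
  have h := (sizeList_spec l l le_rfl).1
  -- One pass over `l` offers enough rounds for all doublings.
  have h2 : Nat.size l.length ≤ l.length := Nat.size_le.mpr Nat.lt_two_pow_self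
  unfold sizeList
  rw [h, min_eq_right h2]

end sizeList

/-- The columns in which some row has a one. -/
def usedColumns (rows : List (List Bool)) : List Bool := rows.foldl orL (rows.headD [])

/-- The points for the rows. -/
def points (D q : ℕ) (rows : List (List Bool)) : List (List Bool) :=
  rows.map (point ((sizeList rows).flatMap fun _ => List.replicate q false)
    (assign (usedColumns rows) (code D q (sizeList rows).length)))

/-- The reduction on strings: instances with few columns or invalid instances are decided with a
table. -/
noncomputable def reduction (D q N₀ K₀ : ℕ) (table : Set (List Bool)) (yesWord noWord : List Bool)
    (w : List Bool) : List Bool :=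
  open Classical in
  bif decide (((parse w).2.headD []).length ≤ N₀) then
    bif decide (K₀ ≤ (parse w).1.length) || decide (w ∈ table) then yesWord else noWord
  else (parse w).1 ++ [false] ++ (points D q (parse w).2).flatMap encodeRow

namespace PolyT

variable {α β γ : Type} [Enc α] [Enc β] [Enc γ]

theorem sizeList : PolyT fun l : List β => sizeList l := by
  refine fst (foldl (B := fun l => 1 + (4 * KMedianL1.sz l + 1) + (4 * (2 * KMedianL1.sz l) + 1))
    (step := fun (l : List β) (s : List Bool × List Bool) (_ : β) =>
      bif decide (s.2.length ≤ l.length) then (true :: s.1, s.2 ++ s.2) else s) id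
    ((const []).pair (const [true]))
    (cond (length_le id.snd.snd.snd id.snd.fst)
      (((const true).cons id.snd.snd.fst).pair (id.snd.snd.snd.append id.snd.snd.snd)) id.snd.snd)
    (((PolyBdd.const 1).add (((PolyBdd.const 4).mul PolyBdd.sz).add (PolyBdd.const 1))).add
      (((PolyBdd.const 4).mul ((PolyBdd.const 2).mul PolyBdd.sz)).add (PolyBdd.const 1)))
    fun l l' hl' => ?_)
  obtain ⟨h1, h2⟩ := sizeList_spec l l' hl'.length_le
  generalize l'.foldl (fun (s : List Bool × List Bool) _ =>
      bif decide (s.2.length ≤ l.length) then (true :: s.1, s.2 ++ s.2) else s) ([], [true]) = s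
      at h1 h2
  have h3 := sz_bits_le s.1
  have h4 := sz_bits_le s.2
  have h5 := length_lt_sz l
  have h6 := hl'.length_le
  have h7 : s.2.length ≤ 2 * l.length + 1 := by
    rw [h2]
    rcases Nat.eq_zero_or_pos s.1.length with h0 | h0
    · rw [h0]; omega
    · have h8 : 2 ^ (s.1.length - 1) ≤ l.length := Nat.lt_size.mp (by omega)
      have h9 : 2 ^ s.1.length = 2 * 2 ^ (s.1.length - 1) := by
        rw [← pow_succ']
        congr 1
        omega
      omega
  rw [sz_pair]
  omega

/-- The number of words is `(2 ^ e) ^ m = (2 ^ m) ^ e` with `2 ^ m` at most linear in the size of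
the list, and `e` is a constant of the reduction. -/
theorem words (e : ℕ) : PolyT fun l : List β =>
    words (blocks (2 ^ e)) (KMedianL1.sizeList l).length := by
  have key : ∀ (B : List (List Bool)) (l : List Bool) (j : ℕ),
      l.foldl (fun W _ => B.flatMap fun b => W.map (b ++ ·)) (KMedianL1.words B j) =
        KMedianL1.words B (j + l.length) := by
    intro B l
    induction l with
    | nil => intro j; rfl
    | cons x l ih =>
      intro j
      rw [List.foldl_cons]
      refine (ih (j + 1)).trans ?_
      rw [List.length_cons]
      congr 1
      omega
  refine (foldl (B := fun l : List β => (2 * KMedianL1.sz l) ^ e *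
    (4 * (2 ^ e * KMedianL1.sz l) + 2) + 1)
    (s := fun _ => [[]])
    (step := fun _ W _ => (blocks (2 ^ e)).flatMap fun b => W.map (b ++ ·)) sizeList (const [[]])
    (flatMap (f := fun (p : Bool × (List β × List (List Bool))) b => p.2.2.map (b ++ ·))
      (const (blocks (2 ^ e)))
      (map (f := fun (p : (Bool × (List β × List (List Bool))) × List Bool) v => p.2 ++ v)
        id.fst.snd.snd (id.fst.snd.append id.snd)))
    (((((PolyBdd.const 2).mul PolyBdd.sz).pow e).mul (((PolyBdd.const 4).mul
      ((PolyBdd.const (2 ^ e)).mul PolyBdd.sz)).add (PolyBdd.const 2))).add (PolyBdd.const 1))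
    fun l l' hl' => ?_).congr fun l => ?_
  · have h0 := key (blocks (2 ^ e)) l' 0
    rw [zero_add] at h0
    have h1 : l'.length ≤ Nat.size l.length := by
      rw [← length_sizeList]
      exact hl'.length_le
    have h2 : l'.length ≤ l.length := h1.trans (Nat.size_le.mpr Nat.lt_two_pow_self)
    have h3 : 2 ^ l'.length ≤ 2 * KMedianL1.sz l := by
      have h5 := length_lt_sz l
      rcases Nat.eq_zero_or_pos l'.length with h0 | h0
      · rw [h0]; omega
      · have h8 : 2 ^ (l'.length - 1) ≤ l.length := Nat.lt_size.mp (by omega)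
        have h9 : 2 ^ l'.length = 2 * 2 ^ (l'.length - 1) := by
          rw [← pow_succ']
          congr 1
          omega
        omega
    have h4 : ∀ w ∈ KMedianL1.words (blocks (2 ^ e)) l'.length,
        KMedianL1.sz w ≤ 4 * (2 ^ e * KMedianL1.sz l) + 1 := by
      intro w hw
      have h5 := sz_bits_le w
      rw [length_of_mem_words hw] at h5
      refine h5.trans (Nat.add_le_add_right (Nat.mul_le_mul_left 4 (Nat.mul_le_mul_left _ ?_)) 1)
      exact h2.trans (length_lt_sz l).le
    have h5 := sz_le_length_mul h4
    rw [length_words, show (blocks (2 ^ e)).length = 2 ^ e by simp [blocks], ← pow_mul, mul_comm e,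
      pow_mul] at h5
    refine le_trans (le_of_eq (congrArg _ h0)) (h5.trans (Nat.add_le_add_right ?_ 1))
    exact Nat.mul_le_mul_right _ (Nat.pow_le_pow_left h3 e)
  · have h0 := key (blocks (2 ^ e)) (KMedianL1.sizeList l) 0
    rw [zero_add] at h0
    exact h0.symm

theorem code (D e : ℕ) : PolyT fun l : List β =>
    code D (2 ^ e) (KMedianL1.sizeList l).length := by
  have hand : PolyT fun p : Bool × Bool => p.1 && p.2 := and id.fst id.snd
  have hok : PolyT fun p : List Bool × (List Bool × (List β × List (List Bool))) =>
      decide (D * inter p.1 p.2.1 ≤ (KMedianL1.sizeList p.2.2.1).length) := by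
    -- The product `D * inter` is represented in unary by writing `D` symbols for each common one.
    refine (length_le (flatMap (f := fun _ _ => List.replicate D true)
      (filter (k := fun _ b => b) (zipWith id.fst id.snd.fst hand) id.snd)
      (const (List.replicate D true))) (sizeList.comp id.snd.snd.fst)).congr fun p => ?_
    have h1 : ∀ l : List Bool, ((l.filter fun b => b).flatMap fun _ =>
        List.replicate D true).length = D * l.count true := by
      intro l
      rw [List.length_flatMap, List.count_eq_countP, List.countP_eq_length_filter]
      simp [mul_comm]
    rw [h1]
    rfl
  refine foldl_add (B := fun l : List β =>
      1 + KMedianL1.sz (KMedianL1.words (blocks (2 ^ e)) (KMedianL1.sizeList l).length))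
    (step := fun (l : List β) acc w => bif acc.all fun v =>
      decide (D * inter v w ≤ (KMedianL1.sizeList l).length) then w :: acc else acc)
    (words e) (const [])
    (cond (all (k := fun (p : List Bool × (List β × List (List Bool))) v =>
        decide (D * inter v p.1 ≤ (KMedianL1.sizeList p.2.1).length)) id.snd.snd
        (hok.comp (id.snd.pair id.fst)))
      (id.fst.cons id.snd.snd) id.snd.snd)
    ((PolyBdd.const 1).add (words e).polyBdd) fun l s w hw => ?_
  have h1 := sz_le_of_mem hw
  cases s.all fun v => decide (D * inter v w ≤ (KMedianL1.sizeList l).length)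
  · simp only [cond_false]; omega
  · simp only [cond_true, sz_cons]; omega

theorem orL {f g : α → List Bool} (hf : PolyT f) (hg : PolyT g) :
    PolyT fun x => orL (f x) (g x) := zipWith hf hg (or id.fst id.snd)

theorem usedColumns : PolyT usedColumns := by
  refine foldl (B := fun rows => 4 * KMedianL1.sz (rows.headD []) + 1)
    (step := fun _ => KMedianL1.orL) id (headD id []) (orL id.snd.snd id.fst)
    (((PolyBdd.const 4).mul (headD id []).polyBdd).add (PolyBdd.const 1)) fun rows l _ => ?_
  have key : ∀ (l : List (List Bool)) (acc : List Bool),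
      (l.foldl KMedianL1.orL acc).length ≤ acc.length := by
    intro l
    induction l with
    | nil => intro acc; exact le_rfl
    | cons r l ih => intro acc; exact (ih _).trans (by simp [KMedianL1.orL])
  have h1 := sz_bits_le (l.foldl KMedianL1.orL (rows.headD []))
  have h2 := key l (rows.headD [])
  have h3 := length_lt_sz (rows.headD [])
  omega

theorem assign {f : α → List Bool} {g : α → List (List Bool)} (hf : PolyT f) (hg : PolyT g) :
    PolyT fun x => assign (f x) (g x) := by
  let step : List (List Bool) × List (List Bool) → Bool → List (List Bool) × List (List Bool) :=
    fun s u => bif u then (s.1.tail, s.1.headD [] :: s.2) else (s.1, [] :: s.2)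
  have hstep : PolyT fun p : Bool × (α × (List (List Bool) × List (List Bool))) =>
      step p.2.2 p.1 :=
    cond id.fst (id.snd.snd.fst.tail.pair ((id.snd.snd.fst.headD []).cons id.snd.snd.snd))
      (id.snd.snd.fst.pair ((const []).cons id.snd.snd.snd))
  refine (reverse (snd (foldl_add (step := fun _ => step) hf (hg.pair (const [])) hstep
    (PolyBdd.const 4) fun x s u _ => ?_))).congr fun x => ?_
  · obtain ⟨ws, acc⟩ := s
    cases u with
    | false => simp only [step, cond_false, sz_pair, sz_cons, sz_nil]; omega
    | true =>
      cases ws with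
      | nil =>
        simp only [step, cond_true, List.tail_nil, List.headD_nil, sz_pair, sz_cons, sz_nil]
        omega
      | cons w ws =>
        simp only [step, cond_true, List.tail_cons, List.headD_cons, sz_pair, sz_cons]
        omega
  · have key : ∀ (us : List Bool) (ws acc : List (List Bool)),
        (us.foldl step (ws, acc)).2.reverse = acc.reverse ++ KMedianL1.assign us ws := by
      intro us
      induction us with
      | nil => intro ws acc; simp [KMedianL1.assign]
      | cons u us ih =>
        intro ws acc
        rw [List.foldl_cons]
        cases u with
        | false => exact (ih ws ([] :: acc)).trans (by simp [KMedianL1.assign])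
        | true =>
          exact (ih ws.tail (ws.headD [] :: acc)).trans (by simp [KMedianL1.assign])
    rw [key]
    rfl

theorem point {f : α → List Bool} {g : α → List (List Bool)} {h : α → List Bool} (hf : PolyT f)
    (hg : PolyT g) (hh : PolyT h) : PolyT fun x => point (f x) (g x) (h x) := by
  refine foldl (B := fun x => 4 * KMedianL1.sz (f x) + 1)
    (step := fun _ (acc : List Bool) (p : Bool × List Bool) =>
      bif p.1 then KMedianL1.orL acc p.2 else acc) (hh.zip hg) hf
    (cond id.fst.fst (orL id.snd.snd id.fst.snd) id.snd.snd)
    (((PolyBdd.const 4).mul hf.polyBdd).add (PolyBdd.const 1)) fun x l _ => ?_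
  have key : ∀ (l : List (Bool × List Bool)) (acc : List Bool),
      (l.foldl (fun acc p => bif p.1 then KMedianL1.orL acc p.2 else acc) acc).length ≤
        acc.length := by
    intro l
    induction l with
    | nil => intro acc; exact le_rfl
    | cons p l ih =>
      intro acc
      refine (ih _).trans ?_
      obtain ⟨b, w⟩ := p
      cases b <;> simp [KMedianL1.orL]
  have h1 := sz_bits_le
    (l.foldl (fun acc p => bif p.1 then KMedianL1.orL acc p.2 else acc) (f x))
  have h2 := key l (f x)
  have h3 := length_lt_sz (f x)
  omega

theorem points (D e : ℕ) : PolyT (points D (2 ^ e)) := by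
  have hz : PolyT fun rows : List (List Bool) => (KMedianL1.sizeList rows).flatMap fun _ =>
      List.replicate (2 ^ e) false :=
    flatMap (f := fun _ _ => List.replicate (2 ^ e) false) sizeList (const _)
  have hA : PolyT fun rows : List (List Bool) => KMedianL1.assign (KMedianL1.usedColumns rows)
      (KMedianL1.code D (2 ^ e) (KMedianL1.sizeList rows).length) :=
    assign usedColumns (code D e)
  exact map (f := fun rows r => KMedianL1.point ((KMedianL1.sizeList rows).flatMap fun _ =>
      List.replicate (2 ^ e) false) (KMedianL1.assign (KMedianL1.usedColumns rows)
      (KMedianL1.code D (2 ^ e) (KMedianL1.sizeList rows).length)) r) id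
    (point (hz.comp id.fst) (hA.comp id.fst) id.snd)

theorem reduction (D e N₀ K₀ : ℕ) (table : Set (List Bool)) (ht : table.Finite)
    (yesWord noWord : List Bool) :
    PolyT (reduction D (2 ^ e) N₀ K₀ table yesWord noWord) := by
  classical
  have hk : PolyT fun w => (KMedianL1.parse w).1 := parse.fst
  have hr : PolyT fun w => (KMedianL1.parse w).2 := parse.snd
  refine cond ?_ (cond (or ?_ ?_) (const _) (const _)) ((hk.append (const [false])).append
    (flatMap (f := fun _ r => KMedianL1.encodeRow r) ((points D e).comp hr) (encodeRow id.snd)))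
  · exact (length_le (headD hr []) (const (List.replicate N₀ true))).congr fun w => by simp
  · exact (length_le (const (List.replicate K₀ true)) hk).congr fun w => by simp
  · exact (mem_const table ht).congr fun w => by simp

end PolyT

/-! ### The reduction on instances -/

/-- The indicator function of a set of vertices. -/
def indicator {n : ℕ} (T : Finset (Fin n)) : Fin n → Bool := fun i => decide (i ∈ T)

theorem indicator_injective {n : ℕ} : Function.Injective (indicator (n := n)) := by
  intro T T' h
  ext i
  have := congrFun h i
  simpa [indicator] using this

theorem getD_ofFn_eq_true {n : ℕ} (a : Fin n → Bool) (i : ℕ) :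
    (List.ofFn a).getD i false = true ↔ ∃ h : i < n, a ⟨i, h⟩ = true := by
  by_cases h : i < n
  · simp [h]
  · simp [h]

/-- The word of length `d` as a Boolean point. -/
def wordPoint (d : ℕ) (w : List Bool) : Fin d → Bool := fun j => w.getD j false

theorem ofFn_wordPoint {d : ℕ} {w : List Bool} (hw : w.length = d) :
    List.ofFn (wordPoint d w) = w := by
  subst hw
  refine List.ext_getElem (by simp) fun i h1 h2 => ?_
  simp [wordPoint, h2]

/-- A description of an instance, parsed. -/
theorem CoverageInstance.exists_rows {I : CoverageInstance} {w : List Bool}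
    (hw : I.DescribedBy w) : ∃ pts : List (Fin I.n → Bool), pts.Nodup ∧
      pts.toFinset = I.E.image indicator ∧ pts.length = I.E.card ∧
      parse w = (List.replicate I.k true, pts.map List.ofFn) := by
  obtain ⟨pts, h1, h2, h3⟩ := hw
  refine ⟨pts, h1, h2, ?_, ?_⟩
  · rw [← List.toFinset_card_of_nodup h1, h2]
    exact Finset.card_image_of_injective _ indicator_injective
  · rw [h3, parse_encode]

/-- The number of vertices is the length of the first row, which exists because `E` is nonempty. -/
theorem CoverageInstance.length_headD {I : CoverageInstance} {w : List Bool} {z : ℕ}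
    (hV : I.Valid z) (hw : I.DescribedBy w) : ((parse w).2.headD []).length = I.n := by
  obtain ⟨pts, -, -, h1, h2⟩ := I.exists_rows hw
  rw [h2]
  cases pts with
  | nil =>
    have := hV.1.card_pos
    simp at h1
    omega
  | cons a pts => simp

/-- The points produced by the reduction are the unions of codewords. -/
theorem CoverageInstance.exists_points {I : CoverageInstance} {w : List Bool} {z D a : ℕ}
    (hV : I.Valid z) (hw : I.DescribedBy w) (hD : 2 ≤ D) (hzD : z < D)
    (ha : 4 * z ≤ 2 ^ a) : ∃ (C : Fin I.n → Finset (Fin (2 ^ (D * a) * Nat.size I.E.card)))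
      (F : Finset (Fin I.n) → Fin (2 ^ (D * a) * Nat.size I.E.card) → Bool),
      Codewords C I.E z (Nat.size I.E.card) (1 / D) ∧
      (∀ T ∈ I.E, support (F T) = T.biUnion C) ∧
      Describes ((parse w).1 ++ [false] ++ (points D (2 ^ (D * a)) (parse w).2).flatMap encodeRow)
        I.k (I.E.image F) := by
  obtain ⟨hne, hEz, hk⟩ := hV
  obtain ⟨pts, hnd, htf, hlen, hparse⟩ := I.exists_rows hw
  rw [hparse]
  set rows := pts.map List.ofFn with hrows
  set q := 2 ^ (D * a) with hq
  set m := Nat.size I.E.card with hm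
  set d := q * m with hd
  have hrlen : ∀ r ∈ rows, r.length = I.n := by
    intro r hr
    obtain ⟨b, -, rfl⟩ := List.mem_map.mp hr
    simp
  have hmem : ∀ b, b ∈ pts ↔ ∃ T ∈ I.E, indicator T = b := by
    intro b
    rw [← List.mem_toFinset, htf, Finset.mem_image]
  have hm1 : 1 ≤ m := Nat.lt_size.mpr (by rw [pow_zero]; exact hne.card_pos)
  have hsize : (sizeList rows).length = m := by
    rw [length_sizeList, hrows, List.length_map, hlen]
  set us := usedColumns rows with hus
  have hused : us.length = I.n ∧ ∀ i, us.getD i false = true ↔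
      ∃ r ∈ rows, r.getD i false = true := by
    have hne' : rows ≠ [] := by
      intro h
      rw [hrows, List.map_eq_nil_iff] at h
      have := hne.card_pos
      simp [h] at hlen
      omega
    obtain ⟨r₀, rs, hr₀⟩ := List.exists_cons_of_ne_nil hne'
    have hr₀l : r₀.length = I.n := hrlen r₀ (by rw [hr₀]; exact List.mem_cons_self)
    have h1 := getD_foldl_orL rows r₀ fun r hr => by rw [hrlen r hr, hr₀l]
    have h2 : us = rows.foldl orL r₀ := by rw [hus, usedColumns, hr₀, List.headD_cons]
    rw [h2]
    refine ⟨h1.1.trans hr₀l, fun i => (h1.2 i).trans ⟨?_, Or.inr⟩⟩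
    rintro (h | h)
    · exact ⟨r₀, by rw [hr₀]; exact List.mem_cons_self, h⟩
    · exact h
  have husedT : ∀ u : Fin I.n, us.getD u false = true ↔ ∃ T ∈ I.E, u ∈ T := by
    intro u
    rw [hused.2]
    constructor
    · rintro ⟨r, hr, h⟩
      obtain ⟨b, hb, rfl⟩ := List.mem_map.mp hr
      obtain ⟨T, hT, rfl⟩ := (hmem b).mp hb
      obtain ⟨h1, h2⟩ := (getD_ofFn_eq_true _ _).mp h
      exact ⟨T, hT, by simpa [indicator] using h2⟩
    · rintro ⟨T, hT, hu⟩
      refine ⟨List.ofFn (indicator T), List.mem_map_of_mem ((hmem _).mpr ⟨T, hT, rfl⟩), ?_⟩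
      exact (getD_ofFn_eq_true _ _).mpr ⟨u.2, by simpa [indicator] using hu⟩
  set ws := code D q m with hws
  -- Only used vertices need codewords. There are at most `z * |E| ≤ z * 2 ^ m` of them, while the
  -- number of all vertices need not be bounded in terms of `|E|`.
  have hcount : us.count true ≤ ws.length := by
    rw [← card_onesSet (d := I.n) us hused.1.le]
    have h1 : onesSet I.n us ⊆ I.E.biUnion fun T => T := by
      intro u hu
      obtain ⟨T, hT, huT⟩ := (husedT u).mp (Finset.mem_filter.mp hu).2
      exact Finset.mem_biUnion.mpr ⟨T, hT, huT⟩
    have h2 : (I.E.biUnion fun T => T).card ≤ I.E.card * z :=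
      Finset.card_biUnion_le_card_mul _ _ _ fun T hT => (hEz T hT).le
    have h3 : I.E.card * z ≤ z * 2 ^ m := by
      rw [mul_comm]
      exact Nat.mul_le_mul_left _ (Nat.lt_size_self _).le
    exact (Finset.card_le_card h1).trans (h2.trans (h3.trans (pow_le_length_code hD hm1 ha)))
  set A := assign us ws with hA
  have hAlen : A.length = I.n := by rw [hA, length_assign, hused.1]
  have hwsm : ∀ v ∈ ws, v.length = d ∧ inter v v = m := fun v hv =>
    ⟨length_of_mem_words (mem_words_of_mem_code hv),
      inter_self_of_mem_words (mem_words_of_mem_code hv)⟩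
  have hAu : ∀ u : Fin I.n, A.getD u [] ∈ ws ∨ A.getD u [] = [] := by
    intro u
    refine mem_assign us ws _ ?_
    have hu : (u : ℕ) < A.length := by rw [hAlen]; exact u.2
    rw [List.getD_eq_getElem _ _ hu]
    exact List.getElem_mem hu
  have hAd : ∀ u : Fin I.n, (A.getD u []).length ≤ d := by
    intro u
    rcases hAu u with h | h
    · exact (hwsm _ h).1.le
    · rw [h]; exact Nat.zero_le _
  have hAT : ∀ T ∈ I.E, ∀ u ∈ T, A.getD u [] ∈ ws := fun T hT u hu =>
    getD_assign_mem us ws u hcount ((husedT u).mpr ⟨T, hT, hu⟩)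
  let C : Fin I.n → Finset (Fin d) := fun u => onesSet d (A.getD u [])
  have hCself : ∀ u, (C u).card = inter (A.getD u []) (A.getD u []) := by
    intro u
    rw [← card_onesSet_inter (hAd u), Finset.inter_self]
  have hDpos : (0 : ℝ) < D := by exact_mod_cast (by omega : 0 < D)
  have hC : Codewords C I.E z m (1 / D) := by
    refine ⟨by exact_mod_cast hm1, by positivity, fun u => ?_, fun u v huv => ?_,
      fun T hT u hu => ?_, hEz⟩
    · rw [hCself]
      rcases hAu u with h | h
      · exact_mod_cast (hwsm _ h).2.le
      · rw [h]; simp [inter]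
    · have h1 : ∀ u v : Fin I.n, u < v → D * inter (A.getD u []) (A.getD v []) ≤ m := by
        intro u v huv
        have hu : (u : ℕ) < A.length := by rw [hAlen]; exact u.2
        have hv : (v : ℕ) < A.length := by rw [hAlen]; exact v.2
        have h2 := List.pairwise_iff_getElem.mp (pairwise_assign us ws pairwise_code) u v hu hv huv
        rw [List.getD_eq_getElem _ _ hu, List.getD_eq_getElem _ _ hv]
        exact h2
      have h2 : D * (C u ∩ C v).card ≤ m := by
        rw [card_onesSet_inter (hAd u)]
        rcases lt_or_gt_of_ne huv with h | h
        · exact h1 u v h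
        · rw [inter_comm]; exact h1 v u h
      rw [one_div, inv_mul_eq_div, le_div_iff₀ hDpos, mul_comm]
      exact_mod_cast h2
    · rw [hCself, (hwsm _ (hAT T hT u hu)).2]
  let zeros : List Bool := (sizeList rows).flatMap fun _ => List.replicate q false
  have hzl : zeros.length = d := by
    simp [zeros, List.length_flatMap, hsize, hd, mul_comm]
  have hz0 : ∀ j, ¬ zeros.getD j false = true := by
    intro j h
    by_cases hj : j < zeros.length
    · rw [List.getD_eq_getElem _ _ hj] at h
      have h1 := List.getElem_mem hj
      rw [h] at h1
      obtain ⟨x, -, h2⟩ := List.mem_flatMap.mp h1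
      exact Bool.noConfusion (List.eq_of_mem_replicate h2)
    · rw [List.getD_eq_default _ _ (not_lt.mp hj)] at h
      exact Bool.noConfusion h
  let G : (Fin I.n → Bool) → Fin d → Bool := fun b => wordPoint d (point zeros A (List.ofFn b))
  have hpoint : ∀ T ∈ I.E, (point zeros A (List.ofFn (indicator T))).length = d ∧
      support (G (indicator T)) = T.biUnion C := by
    intro T hT
    obtain ⟨h1, h2⟩ := getD_point (List.ofFn (indicator T)) A zeros fun i hi hiA => by
      obtain ⟨h3, h4⟩ := (getD_ofFn_eq_true _ _).mp hi
      rw [hzl]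
      exact (hwsm _ (hAT T hT ⟨i, h3⟩ (by simpa [indicator] using h4))).1
    refine ⟨h1.trans hzl, ?_⟩
    ext j
    simp only [support, G, wordPoint, Finset.mem_filter, Finset.mem_univ, true_and,
      Finset.mem_biUnion, C, onesSet]
    rw [h2]
    constructor
    · rintro (h | ⟨i, hi, h⟩)
      · exact absurd h (hz0 j)
      · obtain ⟨h3, h4⟩ := (getD_ofFn_eq_true _ _).mp hi
        exact ⟨⟨i, h3⟩, by simpa [indicator] using h4, h⟩
    · rintro ⟨u, hu, h⟩
      exact Or.inr ⟨u, (getD_ofFn_eq_true _ _).mpr ⟨u.2, by simpa [indicator] using hu⟩, h⟩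
  -- Distinct edges must give distinct points, since a description lists points without repetition
  -- and the number of points has to be `|E|`.
  have hinj : Set.InjOn (fun T : Finset (Fin I.n) => T.biUnion C) I.E := by
    refine hC.injOn ?_
    rw [mul_one_div, div_lt_one hDpos]
    exact_mod_cast hzD
  refine ⟨C, fun T => G (indicator T), hC, fun T hT => (hpoint T hT).2, pts.map G, ?_, ?_, ?_⟩
  · refine List.Nodup.map_on ?_ hnd
    intro b hb b' hb' h
    obtain ⟨T, hT, rfl⟩ := (hmem b).mp hb
    obtain ⟨T', hT', rfl⟩ := (hmem b').mp hb'
    rw [hinj hT hT' (by simp only; rw [← (hpoint T hT).2, ← (hpoint T' hT').2, h])]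
  · ext b
    rw [List.mem_toFinset, List.mem_map, Finset.mem_image]
    constructor
    · rintro ⟨b', hb', rfl⟩
      obtain ⟨T, hT, rfl⟩ := (hmem b').mp hb'
      exact ⟨T, hT, rfl⟩
    · rintro ⟨T, hT, rfl⟩
      exact ⟨indicator T, (hmem _).mpr ⟨T, hT, rfl⟩, rfl⟩
  · unfold encode points
    rw [hsize, List.map_map, hrows, List.map_map]
    congr 2
    refine List.map_congr_left fun b hb => ?_
    obtain ⟨T, hT, rfl⟩ := (hmem b).mp hb
    exact (ofFn_wordPoint (hpoint T hT).1).symm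

/-! ### Completeness and soundness -/

section analysis

variable {n d k z y : ℕ} {E : Finset (Finset (Fin n))} {C : Fin n → Finset (Fin d)}
  {F : Finset (Fin n) → Fin d → Bool} {m δ : ℝ}

theorem injOn_points (hC : Codewords C E z m δ) (hF : ∀ T ∈ E, support (F T) = T.biUnion C)
    (hz : z * δ < 1) : Set.InjOn F E := fun T hT T' hT' h =>
  hC.injOn hz hT hT' (by simp only; rw [← hF T hT, ← hF T' hT', h])

/-- The centers are the unions of the codewords of the covering sets. An assignment of points,
rather than edges, is available because the points determine the edges. -/
theorem exists_cost_le (hC : Codewords C E z m δ) (hF : ∀ T ∈ E, support (F T) = T.biUnion C)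
    (hz : z * δ < 1) (hk : 1 ≤ k) (S : Fin k → Finset (Fin n)) (hS : ∀ i, (S i).card = y)
    (hcov : ∀ T ∈ E, ∃ i, S i ⊆ T) : ∃ (c : Fin k → L1 d) (σ : (Fin d → Bool) → Fin k),
      cost (E.image F) c σ ≤ (z - y) * m * E.card := by
  have hinj := injOn_points hC hF hz
  have h1 : ∀ a : Fin d → Bool, ∃ i : Fin k, ∀ T ∈ E, F T = a → S i ⊆ T := by
    intro a
    by_cases h : ∃ T ∈ E, F T = a
    · obtain ⟨T, hT, rfl⟩ := h
      obtain ⟨i, hi⟩ := hcov T hT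
      exact ⟨i, fun T' hT' h => by rwa [hinj hT' hT h]⟩
    · exact ⟨⟨0, hk⟩, fun T hT hTa => absurd ⟨T, hT, hTa⟩ h⟩
  choose σ hσ using h1
  refine ⟨fun i => boolPoint fun j => decide (j ∈ (S i).biUnion C), σ, ?_⟩
  unfold cost
  rw [Finset.sum_image hinj, mul_comm, ← nsmul_eq_mul]
  refine Finset.sum_le_card_nsmul _ _ _ fun T hT => ?_
  rw [norm_boolPoint_sub_boolPoint, hF T hT, ← hS (σ (F T))]
  have h2 : support (fun j => decide (j ∈ (S (σ (F T))).biUnion C)) = (S (σ (F T))).biUnion C := by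
    ext j
    simp [support]
  rw [h2]
  exact hC.diffCard_subset_le hT (hσ (F T) T hT rfl)

theorem le_cost (hC : Codewords C E z m δ) (hF : ∀ T ∈ E, support (F T) = T.biUnion C)
    (hz : z * δ < 1) (hy : 1 ≤ y) (hyz : y < z) (hyn : y ≤ n) {τ α : ℝ} {s : ℕ} (hτ : 0 ≤ τ)
    (hs : 4 * z ≤ s * τ) (hδ : (s : ℝ) ^ 2 * δ < 2 * z)
    (hα : ∀ S : Fin k → Finset (Fin n), (∀ i, (S i).card = y) →
      ((Finset.univ.biUnion fun i => E.filter fun T => S i ⊆ T).card : ℝ) ≤ α * E.card)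
    (c : Fin k → L1 d) (σ : (Fin d → Bool) → Fin k) :
    E.card * ((z - y + (1 - α) - (5 * z ^ 2 * δ + 2 * z * τ)) * m) -
      k * (2 ^ s * (n : ℝ) ^ (z - y - 1)) * ((z - y + 1) * m) ≤ cost (E.image F) c σ := by
  obtain ⟨b, hb⟩ := exists_bool_centers (E.image F) c σ
  refine le_trans ?_ hb
  have h := hC.le_sum_diffCard hy hyz (by rwa [Fintype.card_fin]) hτ hs hδ hα
    (fun i => support (b i)) (fun T => σ (F T))
  rw [Fintype.card_fin] at h
  refine h.trans (le_of_eq ?_)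
  unfold cost
  rw [Finset.sum_image (injOn_points hC hF hz)]
  refine Finset.sum_congr rfl fun T hT => ?_
  rw [norm_boolPoint_sub_boolPoint, hF T hT]

end analysis

/-! ### Instances with few vertices -/

theorem length_encodeRow (r : List Bool) : (encodeRow r).length = 2 * r.length + 1 := by
  have h : ∀ r : List Bool, (r.flatMap fun b => [true, b]).length = 2 * r.length := by
    intro r
    induction r with
    | nil => rfl
    | cons b r ih =>
      rw [List.flatMap_cons, List.length_append, ih, List.length_cons]
      simp only [List.length_cons, List.length_nil]
      ring
  rw [encodeRow, List.length_append, h, List.length_singleton]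

namespace CoverageInstance

theorem le_n {I : CoverageInstance} {z : ℕ} (hV : I.Valid z) : z ≤ I.n := by
  obtain ⟨T, hT⟩ := hV.1
  rw [← hV.2.1 T hT]
  simpa using T.card_le_univ

theorem Complete.not_sound {I : CoverageInstance} {z y : ℕ} {α : ℝ}
    (hc : I.Complete y) (hV : I.Valid z) (hα : α < 1) : ¬ I.Sound α y := by
  intro hs
  obtain ⟨S, hS, hcov⟩ := hc
  have h1 := hs S hS
  rw [hcov] at h1
  have h2 : (0 : ℝ) < I.E.card := by exact_mod_cast hV.1.card_pos
  nlinarith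

/-- There are at most `2 ^ n` sets of size `y`, so `k` choices can exhaust them all, and each edge
contains one of them. -/
theorem complete_of_two_pow_le {I : CoverageInstance} {z y : ℕ} (hV : I.Valid z) (hyz : y ≤ z)
    (hk : 2 ^ I.n ≤ I.k) : I.Complete y := by
  obtain ⟨T₀, hT₀⟩ := hV.1
  obtain ⟨S₀, -, hS₀⟩ := Finset.exists_subset_card_eq (hyz.trans (hV.2.1 T₀ hT₀).ge)
  have : Nonempty {S : Finset (Fin I.n) // S.card = y} := ⟨⟨S₀, hS₀⟩⟩
  have hcard : Fintype.card {S : Finset (Fin I.n) // S.card = y} ≤ Fintype.card (Fin I.k) := by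
    refine (Fintype.card_subtype_le _).trans ?_
    simpa using hk
  obtain ⟨e⟩ := Function.Embedding.nonempty_of_card_le hcard
  have hsurj := Function.invFun_surjective e.injective
  refine ⟨fun i => (Function.invFun e i).1, fun i => (Function.invFun e i).2, ?_⟩
  ext T
  simp only [covUnion, cov, Finset.mem_biUnion, Finset.mem_univ, true_and, Finset.mem_filter]
  refine ⟨fun ⟨_, h, _⟩ => h, fun hT => ?_⟩
  obtain ⟨S, hST, hS⟩ := Finset.exists_subset_card_eq (hyz.trans (hV.2.1 T hT).ge)
  obtain ⟨i, hi⟩ := hsurj ⟨S, hS⟩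
  exact ⟨i, hT, by rw [hi]; exact hST⟩

/-- A word describes at most one valid instance. -/
theorem eq_of_describedBy {I J : CoverageInstance} {z z' : ℕ} {w : List Bool} (hI : I.Valid z)
    (hJ : J.Valid z') (hIw : I.DescribedBy w) (hJw : J.DescribedBy w) : I = J := by
  have hn : I.n = J.n := (length_headD hI hIw).symm.trans (length_headD hJ hJw)
  obtain ⟨n, E, k⟩ := I
  obtain ⟨n', E', k'⟩ := J
  simp only at hn
  subst hn
  obtain ⟨p, -, hp, -, hw⟩ := exists_rows hIw
  obtain ⟨p', -, hp', -, hw'⟩ := exists_rows hJw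
  rw [hw, Prod.mk.injEq] at hw'
  obtain ⟨hk, hr⟩ := hw'
  have hk' : k = k' := by simpa using congrArg List.length hk
  have hpp : p = p' := List.map_injective_iff.mpr List.ofFn_injective hr
  rw [hpp] at hp
  have hE : E = E' := Finset.image_injective indicator_injective (hp.symm.trans hp')
  rw [hk', hE]

/-- With bounded `n` and `k` only finitely many words remain, which makes the table of the reduction
finite. -/
theorem length_le {I : CoverageInstance} {w : List Bool} (hw : I.DescribedBy w) :
    w.length ≤ I.k + 1 + 2 ^ I.n * (2 * I.n + 1) := by
  obtain ⟨pts, hnd, -, rfl⟩ := hw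
  have h1 : ∀ l : List (Fin I.n → Bool),
      ((l.map List.ofFn).flatMap encodeRow).length = l.length * (2 * I.n + 1) := by
    intro l
    induction l with
    | nil => simp
    | cons a l ih =>
      rw [List.map_cons, List.flatMap_cons, List.length_append, ih, List.length_cons]
      rw [length_encodeRow, List.length_ofFn]
      ring
  have h2 : pts.length ≤ 2 ^ I.n := by simpa using hnd.length_le_card
  unfold encode
  rw [List.length_append, h1, List.length_append, List.length_replicate, List.length_singleton]
  exact Nat.add_le_add_left (Nat.mul_le_mul_right _ h2) _

end CoverageInstance

/-! ### The gap problem -/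

/-- The two points of constant coordinates, described together with the number `k`. -/
theorem exists_describes_pair {r : ℕ} (hr : 1 ≤ r) (k : ℕ) : ∃ w,
    Describes w k ({fun _ => false, fun _ => true} : Finset (Fin r → Bool)) := by
  refine ⟨_, [fun _ => false, fun _ => true], ?_, ?_, rfl⟩
  · have h : (fun _ : Fin r => false) ≠ fun _ => true := fun h =>
      Bool.noConfusion (congrFun h ⟨0, hr⟩)
    simp [h]
  · simp

theorem card_pair {r : ℕ} (hr : 1 ≤ r) :
    ({fun _ => false, fun _ => true} : Finset (Fin r → Bool)).card = 2 :=
  Finset.card_pair fun h => Bool.noConfusion (congrFun h ⟨0, hr⟩)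

/-- Two points with a center at each of them have cost zero. -/
theorem kMedianGap_yes_nonempty {K ρ F : ℝ} (hKr : 1 ≤ K * Real.log 2) (hρ : 0 < ρ) :
    (kMedianGap K ρ F).yes.Nonempty := by
  obtain ⟨w, hw⟩ := exists_describes_pair (r := 1) le_rfl 2
  refine ⟨w, 1, 2, _, (card_pair le_rfl).ge, by norm_num, ?_, hw, ?_⟩
  · rw [card_pair le_rfl]
    exact_mod_cast hKr
  · refine ⟨![boolPoint fun _ => false, boolPoint fun _ => true],
      fun a => if a = fun _ => false then 0 else 1, ?_⟩
    have h : (fun _ : Fin 1 => true) ≠ fun _ => false := fun h =>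
      Bool.noConfusion (congrFun h 0)
    have h0 : 0 ≤ Real.log 2 := Real.log_nonneg (by norm_num)
    rw [card_pair le_rfl, cost, Finset.sum_pair h.symm]
    simp [h]
    positivity

/-- Two antipodal points of `{0,1}^r` with a single center cost at least their distance `r`, by the
triangle inequality. -/
theorem kMedianGap_no_nonempty {K ρ F : ℝ} {r : ℕ} (hr : 1 ≤ r) (hK : r ≤ K * Real.log 2)
    (hF : F * (ρ * 2 * Real.log 2) ≤ r) : (kMedianGap K ρ F).no.Nonempty := by
  obtain ⟨w, hw⟩ := exists_describes_pair hr 1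
  refine ⟨w, r, 1, _, (card_pair hr).ge, le_rfl, ?_, hw, fun c σ => ?_⟩
  · rw [card_pair hr]
    exact_mod_cast hK
  · have h : (fun _ : Fin r => false) ≠ fun _ => true := fun h =>
      Bool.noConfusion (congrFun h ⟨0, hr⟩)
    rw [card_pair hr, cost, Finset.sum_pair h, Subsingleton.elim (σ fun _ => false) 0,
      Subsingleton.elim (σ fun _ => true) 0]
    have h1 : ‖boolPoint (fun _ : Fin r => true) - boolPoint fun _ => false‖ = r := by
      rw [norm_boolPoint_sub_boolPoint]
      simp [support, diffCard]
    have h2 := norm_sub_le_norm_sub_add_norm_sub (boolPoint fun _ : Fin r => true) (c 0)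
      (boolPoint fun _ => false)
    rw [h1, norm_sub_rev (c 0)] at h2
    push_cast
    linarith

theorem kMedianNPHardToApprox_mono {F F' : ℝ} (h : F ≤ F') (hF : KMedianNPHardToApprox F') :
    KMedianNPHardToApprox F := by
  obtain ⟨K, ρ, hK, hρ, hard⟩ := hF
  refine ⟨K, ρ, hK, hρ, fun L hL => ?_⟩
  obtain ⟨f, hf, hfL⟩ := hard L hL
  refine ⟨f, hf, fun x => ⟨(hfL x).1, fun hx => ?_⟩⟩
  obtain ⟨d, k, P, h1, h2, h3, h4, h5⟩ := (hfL x).2 hx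
  refine ⟨d, k, P, h1, h2, h3, h4, fun c σ => le_trans ?_ (h5 c σ)⟩
  refine mul_le_mul_of_nonneg_right h ?_
  have : 0 ≤ Real.log P.card := Real.log_natCast_nonneg _
  positivity

/-! ### Hardness of the gap problem -/

theorem log_le_size_mul_log_two {N : ℕ} (hN : 1 ≤ N) :
    Real.log N ≤ Nat.size N * Real.log 2 := by
  rw [← Real.log_pow]
  refine Real.log_le_log (by exact_mod_cast hN) ?_
  exact_mod_cast (Nat.lt_size_self N).le

theorem size_sub_one_mul_log_two_le {N : ℕ} (hN : 1 ≤ N) :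
    ((Nat.size N : ℝ) - 1) * Real.log 2 ≤ Real.log N := by
  have h1 : 1 ≤ Nat.size N := Nat.lt_size.mpr (by simpa using hN)
  have h2 : 2 ^ (Nat.size N - 1) ≤ N := Nat.lt_size.mp (by omega)
  have h3 : ((Nat.size N : ℝ) - 1) = ((Nat.size N - 1 : ℕ) : ℝ) := by
    push_cast [Nat.cast_sub h1]
    ring
  rw [h3, ← Real.log_pow]
  exact Real.log_le_log (by positivity) (by exact_mod_cast h2)

/-- For `m ≥ 2` one has `m ≤ 2 * (m - 1)`, so `m` is at most `2 / b` times the logarithm `l`. -/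
theorem dimension_le {q m K l b : ℝ} (hb : 0 < b) (hq : 0 ≤ q) (hm : 2 ≤ m)
    (hl : (m - 1) * b ≤ l) (hK : 2 * q / b ≤ K) : q * m ≤ K * l := by
  have h1 : m * b ≤ 2 * l := by nlinarith
  have h0 : 0 ≤ l := by nlinarith
  refine le_trans ?_ (mul_le_mul_of_nonneg_right hK h0)
  rw [div_mul_eq_mul_div, le_div_iff₀ hb]
  calc q * m * b = q * (m * b) := by ring
    _ ≤ q * (2 * l) := mul_le_mul_of_nonneg_left h1 hq
    _ = _ := by ring

/-- The costs scale with `m`, the gap problem with `l = log |E|`, and `(m - 1) * b ≤ l ≤ m * b` for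
`b = log 2`. The factor `1 + η` in the threshold absorbs the rounding, as `m ≤ (1 + η) * (m - 1)`.
-/
theorem yes_bound {H η m B l b : ℝ} (hH : 0 ≤ H) (hη : 0 ≤ η) (hB : 0 ≤ B) (hb : 0 < b)
    (hηm : 1 + η ≤ η * m) (hl : (m - 1) * b ≤ l) : H * m * B ≤ H * (1 + η) / b * B * l := by
  have h2 : m * b ≤ (1 + η) * l := by
    calc m * b ≤ (1 + η) * (m - 1) * b := mul_le_mul_of_nonneg_right (by linarith) hb.le
      _ = (1 + η) * ((m - 1) * b) := by ring
      _ ≤ _ := mul_le_mul_of_nonneg_left hl (by linarith)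
  rw [div_mul_eq_mul_div, div_mul_eq_mul_div, le_div_iff₀ hb]
  calc H * m * B * b = H * B * (m * b) := by ring
    _ ≤ H * B * ((1 + η) * l) := mul_le_mul_of_nonneg_left h2 (mul_nonneg hH hB)
    _ = _ := by ring

/-- Of the slack `ε`, one half pays for the factor `1 + η` in the threshold, a quarter for the
overlap of codewords and a quarter for the bad edges, which number at most `X`. -/
theorem no_bound {A H η m B l b α ε err X : ℝ} (hA : 0 ≤ A) (hH : 0 ≤ H) (hη : 0 ≤ η)
    (hB : 0 ≤ B) (hm : 0 ≤ m) (hb : 0 < b) (hl : l ≤ m * b)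
    (hAH : A * (H * (1 + η)) ≤ H + (1 - α) - ε / 2) (herr : err ≤ ε / 4)
    (hX : X * (H + 1) ≤ ε / 4 * B) : A * (H * (1 + η) / b * B * l) ≤
      B * ((H + (1 - α) - err) * m) - X * ((H + 1) * m) := by
  have h6 : l / b ≤ m := by rwa [div_le_iff₀ hb]
  have h5 : A * (H * (1 + η) / b * B * l) ≤ (H + (1 - α) - ε / 2) * (m * B) := by
    calc A * (H * (1 + η) / b * B * l) = A * (H * (1 + η)) * B * (l / b) := by ring
      _ ≤ A * (H * (1 + η)) * B * m := mul_le_mul_of_nonneg_left h6 (by positivity)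
      _ = A * (H * (1 + η)) * (m * B) := by ring
      _ ≤ _ := mul_le_mul_of_nonneg_right hAH (by positivity)
  have h7 : X * ((H + 1) * m) ≤ ε / 4 * B * m := by
    calc X * ((H + 1) * m) = X * (H + 1) * m := by ring
      _ ≤ _ := mul_le_mul_of_nonneg_right hX hm
  have h8 : (H + (1 - α) - ε / 4) * (m * B) ≤ (H + (1 - α) - err) * (m * B) :=
    mul_le_mul_of_nonneg_right (by linarith) (by positivity)
  linarith

/-- The reduction from the coverage problem on instances with many vertices. -/
theorem exists_reduction_of_large {α ε : ℝ} {z y : ℕ} (hα : 0 ≤ α) (hα1 : α < 1) (hy : 1 ≤ y)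
    (hyz : y < z) (hε : 0 < ε) (hε1 : ε ≤ 1) : ∃ (D e : ℕ) (K₀ ρ G : ℝ), 0 < K₀ ∧ 0 < ρ ∧
    ∀ (K : ℝ) (g : ℕ → ℝ) (I : CoverageInstance) (w : List Bool), K₀ ≤ K → G ≤ g I.n →
      I.Valid z → I.Dense g z y → I.DescribedBy w →
      (I.Complete y → (parse w).1 ++ [false] ++ (points D (2 ^ e) (parse w).2).flatMap encodeRow ∈
        (kMedianGap K ρ (1 + (1 - α) / ((z : ℝ) - y) - ε)).yes) ∧
      (I.Sound α y → (parse w).1 ++ [false] ++ (points D (2 ^ e) (parse w).2).flatMap encodeRow ∈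
        (kMedianGap K ρ (1 + (1 - α) / ((z : ℝ) - y) - ε)).no) := by
  have hz2 : (2 : ℝ) ≤ z := by exact_mod_cast (by omega : 2 ≤ z)
  have hy1 : (1 : ℝ) ≤ y := by exact_mod_cast hy
  have hH : (1 : ℝ) ≤ (z : ℝ) - y := by
    have : ((y + 1 : ℕ) : ℝ) ≤ z := by exact_mod_cast hyz
    push_cast at this
    linarith
  have hHz : (z : ℝ) - y + 1 ≤ z := by linarith
  set H : ℝ := (z : ℝ) - y with hHdef
  set A : ℝ := 1 + (1 - α) / H - ε with hA
  have hz0 : (0 : ℝ) < z := by linarith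
  have hH0 : 0 < H := by linarith
  have hAH : A * H = H + (1 - α) - ε * H := by
    rw [hA]
    field_simp
  have hA0 : 0 ≤ A := by
    have : 0 ≤ (1 - α) / H := div_nonneg (by linarith) hH0.le
    linarith
  have hlog : 0 < Real.log 2 := Real.log_pos (by norm_num)
  -- This `s` satisfies `s * τ ≥ 4 * z` for `τ = ε / (16 * z)`.
  obtain ⟨s, hs⟩ := exists_nat_ge (64 * (z : ℝ) ^ 2 / ε)
  -- The summands serve the size of the code, the injectivity `z / D < 1`, the error `5 * z ^ 2 / D
  -- ≤ ε / 8`, and the bound `s ^ 2 / D < 2 * z` on near vertices.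
  obtain ⟨D, hD⟩ := exists_nat_gt (2 + z + 40 * (z : ℝ) ^ 2 / ε + (s : ℝ) ^ 2)
  have hq0 : 0 ≤ 40 * (z : ℝ) ^ 2 / ε := by positivity
  have hD2 : 2 ≤ D := by
    have : (2 : ℝ) < D := by linarith [sq_nonneg (s : ℝ)]
    exact_mod_cast this.le
  have hzD' : (z : ℝ) < D := by linarith [sq_nonneg (s : ℝ)]
  have hzD : z < D := by exact_mod_cast hzD'
  have hD0 : (0 : ℝ) < D := by linarith
  have hsD : (s : ℝ) ^ 2 < D := by linarith
  have hεD : 40 * (z : ℝ) ^ 2 / ε < D := by linarith [sq_nonneg (s : ℝ)]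
  set τ : ℝ := ε / (16 * z) with hτ
  set η : ℝ := ε / (8 * z) with hη
  have hη0 : 0 < η := by positivity
  have hτ0 : 0 ≤ τ := by positivity
  have hsτ : 4 * (z : ℝ) ≤ s * τ := by
    rw [div_le_iff₀ hε] at hs
    rw [hτ, mul_div_assoc', le_div_iff₀ (by positivity)]
    linarith
  have herr : 5 * (z : ℝ) ^ 2 * (1 / D) + 2 * z * τ ≤ ε / 4 := by
    have h1 : 2 * (z : ℝ) * τ = ε / 8 := by
      rw [hτ]
      field_simp
      norm_num
    have h2 : 5 * (z : ℝ) ^ 2 * (1 / D) ≤ ε / 8 := by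
      rw [div_lt_iff₀ hε] at hεD
      rw [mul_one_div, div_le_iff₀ hD0]
      linarith
    linarith
  have hsδ : (s : ℝ) ^ 2 * (1 / D) < 2 * z := by
    rw [mul_one_div, div_lt_iff₀ hD0]
    nlinarith
  have hzδ : (z : ℝ) * (1 / D) < 1 := by
    rw [mul_one_div, div_lt_one hD0]
    exact hzD'
  obtain ⟨L, hL⟩ := exists_nat_ge (2 + 1 / η)
  -- The exponent is `D * a` with `a = 4 * z`, for which `4 * z ≤ 2 ^ a`. The two entries of the
  -- maximum make the bad edges cost at most `ε / 4 * |E| * m` and force `|E| ≥ 2 ^ L`, so that `m`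
  -- is large.
  refine ⟨D, D * (4 * z), 2 * 2 ^ (D * (4 * z)) / Real.log 2, H * (1 + η) / Real.log 2,
    max (2 ^ s * (z + 1) * 4 / ε) (2 ^ L), by positivity, by positivity, ?_⟩
  intro K g I w hK hG hV hDense hw
  set m := Nat.size I.E.card with hm
  obtain ⟨C, F, hC, hF, hDesc⟩ := I.exists_points (a := 4 * z) hV hw hD2 hzD
    Nat.lt_two_pow_self.le
  have hzn := CoverageInstance.le_n hV
  have hcard : (I.E.image F).card = I.E.card :=
    Finset.card_image_of_injOn (injOn_points hC hF hzδ)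
  set X : ℝ := I.k * (I.n : ℝ) ^ (z - y - 1) with hX
  have hX1 : 1 ≤ X := by
    have h1 : (1 : ℝ) ≤ I.k := by exact_mod_cast hV.2.2
    have h2 : (1 : ℝ) ≤ I.n := by exact_mod_cast (by omega : 1 ≤ I.n)
    exact one_le_mul_of_one_le_of_one_le h1 (one_le_pow₀ h2)
  have hDense' : g I.n * X ≤ I.E.card := hDense
  have hGL : (2 : ℝ) ^ L ≤ I.E.card := by
    have h1 : (2 : ℝ) ^ L ≤ g I.n := (le_max_right _ _).trans hG
    have h2 : (0 : ℝ) < 2 ^ L := by positivity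
    nlinarith
  have hXE : 2 ^ s * (z + 1) * X ≤ ε / 4 * I.E.card := by
    have h1 : 2 ^ s * ((z : ℝ) + 1) * 4 / ε * X ≤ I.E.card :=
      (mul_le_mul_of_nonneg_right ((le_max_left _ _).trans hG) (by linarith)).trans hDense'
    rw [div_mul_eq_mul_div, div_le_iff₀ hε] at h1
    linarith
  have hLE : L < Nat.size I.E.card := Nat.lt_size.mpr (by exact_mod_cast hGL)
  have hE2 : 2 ≤ I.E.card := by
    have h1 : (2 : ℝ) ≤ L := by
      have : 0 < 1 / η := by positivity
      linarith
    have h2 : 2 ≤ L := by exact_mod_cast h1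
    have h3 : 2 ^ L ≤ I.E.card := by exact_mod_cast hGL
    have h4 : 2 ^ 1 ≤ 2 ^ L := Nat.pow_le_pow_right (by norm_num) (by omega)
    omega
  have hl1 := log_le_size_mul_log_two (N := I.E.card) (by omega)
  have hl2 := size_sub_one_mul_log_two_le (N := I.E.card) (by omega)
  have hmL : 2 + 1 / η ≤ (m : ℝ) := hL.trans (by exact_mod_cast hLE.le)
  have hηm : 1 + η ≤ η * m := by
    have h1 : η * (2 + 1 / η) ≤ η * m := mul_le_mul_of_nonneg_left hmL hη0.le
    have h2 : η * (2 + 1 / η) = 2 * η + 1 := by field_simp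
    linarith
  have hm2 : (2 : ℝ) ≤ m := by
    have : 0 < 1 / η := by positivity
    linarith
  have hE0 : (0 : ℝ) < I.E.card := by exact_mod_cast (by omega : 0 < I.E.card)
  have hdim : ((2 ^ (D * (4 * z)) * m : ℕ) : ℝ) ≤ K * Real.log (I.E.image F).card := by
    rw [hcard, Nat.cast_mul, Nat.cast_pow, Nat.cast_ofNat]
    exact dimension_le hlog (pow_nonneg zero_le_two _) hm2 hl2 hK
  refine ⟨fun ⟨S, hS, hcov⟩ => ⟨_, I.k, I.E.image F, by rwa [hcard], hV.2.2, hdim, hDesc, ?_⟩,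
    fun hsound => ⟨_, I.k, I.E.image F, by rwa [hcard], hV.2.2, hdim, hDesc, fun c σ => ?_⟩⟩
  · obtain ⟨c, σ, h⟩ := exists_cost_le hC hF hzδ hV.2.2 S hS fun T hT => by
      rw [← hcov, CoverageInstance.covUnion, Finset.mem_biUnion] at hT
      obtain ⟨i, -, hi⟩ := hT
      exact ⟨i, (Finset.mem_filter.mp hi).2⟩
    refine ⟨c, σ, h.trans ?_⟩
    rw [hcard]
    exact yes_bound hH0.le hη0.le hE0.le hlog hηm hl2
  · refine le_trans ?_ (le_cost hC hF hzδ hy hyz (by omega) hτ0 hsτ hsδ hsound c σ)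
    rw [hcard, ← hHdef]
    -- The product `A * H` falls short of `H + (1 - α)` by `ε * H ≥ ε`, and the factor `1 + η`
    -- returns at most `η * z = ε / 8`.
    have h1 : A * (H * (1 + η)) ≤ H + (1 - α) - ε / 2 := by
      have h2 : A * H ≤ z := by
        have : 0 ≤ ε * H := by positivity
        linarith
      have h3 : η * (A * H) ≤ ε / 8 := by
        refine (mul_le_mul_of_nonneg_left h2 hη0.le).trans (le_of_eq ?_)
        rw [hη]
        field_simp
      have h4 : ε ≤ ε * H := le_mul_of_one_le_right hε.le hH
      linarith
    have h2 : (I.k : ℝ) * (2 ^ s * (I.n : ℝ) ^ (z - y - 1)) * (H + 1) ≤ ε / 4 * I.E.card := by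
      calc (I.k : ℝ) * (2 ^ s * (I.n : ℝ) ^ (z - y - 1)) * (H + 1) = 2 ^ s * (H + 1) * X := by
            rw [hX]; ring
        _ ≤ 2 ^ s * (z + 1) * X := by gcongr; linarith
        _ ≤ _ := hXE
    exact no_bound hA0 hH0.le hη0.le hE0.le (Nat.cast_nonneg _) hlog hl1 h1 herr h2

section reduction

variable {D q N₀ K₀ : ℕ} {table : Set (List Bool)} {yesWord noWord w : List Bool}

theorem reduction_eq_yesWord (h : ((parse w).2.headD []).length ≤ N₀)
    (h' : K₀ ≤ (parse w).1.length ∨ w ∈ table) :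
    reduction D q N₀ K₀ table yesWord noWord w = yesWord := by
  rcases h' with h' | h' <;> simp only [reduction, h, h', decide_true, Bool.true_or, Bool.or_true,
    cond_true]

theorem reduction_eq_noWord (h : ((parse w).2.headD []).length ≤ N₀)
    (hk : ¬ K₀ ≤ (parse w).1.length) (hw : w ∉ table) :
    reduction D q N₀ K₀ table yesWord noWord w = noWord := by
  simp only [reduction, h, hk, hw, decide_true, decide_false, Bool.or_self, cond_true, cond_false]

theorem reduction_of_not_le (h : ¬ ((parse w).2.headD []).length ≤ N₀) :
    reduction D q N₀ K₀ table yesWord noWord w =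
      (parse w).1 ++ [false] ++ (points D q (parse w).2).flatMap encodeRow := by
  simp only [reduction, h, decide_false, cond_false]

end reduction

theorem kMedianNPHardToApprox_of_johnsonCoverage {α : ℝ} {z y : ℕ} (hα : 0 ≤ α) (hα1 : α < 1)
    (hy : 1 ≤ y) (hyz : y < z) (hard : JohnsonCoverageStarNPHard α z y) {ε : ℝ} (hε : 0 < ε) :
    KMedianNPHardToApprox (1 + (1 - α) / ((z : ℝ) - y) - ε) := by
  -- This makes the factor nonnegative.
  wlog hε1 : ε ≤ 1 generalizing ε
  · exact kMedianNPHardToApprox_mono (by linarith) (this one_pos le_rfl)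
  obtain ⟨g, hg, hard⟩ := hard
  obtain ⟨D, e, K₀, ρ, G, hK₀, hρ, hred⟩ := exists_reduction_of_large hα hα1 hy hyz hε hε1
  set A := 1 + (1 - α) / ((z : ℝ) - y) - ε
  have hlog : 0 < Real.log 2 := Real.log_pos (by norm_num)
  obtain ⟨r, hr⟩ := exists_nat_ge (max 1 (A * (ρ * 2 * Real.log 2)))
  have hr1 : (1 : ℝ) ≤ r := (le_max_left _ _).trans hr
  set K := max K₀ (r / Real.log 2)
  have hKr : r ≤ K * Real.log 2 := by
    rw [← div_le_iff₀ hlog]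
    exact le_max_right _ _
  obtain ⟨yesWord, hyes⟩ := kMedianGap_yes_nonempty (F := A) (hr1.trans hKr) hρ
  obtain ⟨noWord, hno⟩ := kMedianGap_no_nonempty (by exact_mod_cast hr1) hKr
    ((le_max_right _ _).trans hr)
  obtain ⟨N₀, hN₀⟩ := Filter.eventually_atTop.mp (hg.eventually_ge_atTop G)
  -- The length bound is that of a description with at most `N₀` vertices and `k ≤ 2 ^ N₀`.
  set table : Set (List Bool) := {w | w.length ≤ 2 ^ N₀ + 1 + 2 ^ N₀ * (2 * N₀ + 1) ∧
    w ∈ (johnsonCoverage α z y g).yes} with htable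
  have hfin : table.Finite := (List.finite_length_le Bool _).subset fun w hw => hw.1
  refine ⟨K, ρ, lt_max_of_lt_left hK₀, hρ, fun L hL => ?_⟩
  obtain ⟨f, hf, hfL⟩ := hard L hL
  refine ⟨fun x => reduction D (2 ^ e) N₀ (2 ^ N₀) table yesWord noWord (f x),
    hf.comp_polyT (PolyT.reduction D e N₀ _ table hfin yesWord noWord), fun x => ⟨fun hx => ?_,
    fun hx => ?_⟩⟩
  · obtain ⟨I, hV, hdense, hw, hc⟩ := (hfL x).1 hx
    have hn := I.length_headD hV hw
    obtain ⟨pts, -, -, -, hparse⟩ := I.exists_rows hw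
    have hk : (parse (f x)).1.length = I.k := by rw [hparse]; exact List.length_replicate
    by_cases hnN : I.n ≤ N₀
    · refine Set.mem_of_eq_of_mem (reduction_eq_yesWord (hn.trans_le hnN) ?_) hyes
      by_cases hkK : 2 ^ N₀ ≤ I.k
      · exact Or.inl (hk ▸ hkK)
      · refine Or.inr ⟨(I.length_le hw).trans ?_, (hfL x).1 hx⟩
        have h1 : 2 ^ I.n ≤ 2 ^ N₀ := Nat.pow_le_pow_right (by norm_num) hnN
        have h2 := Nat.mul_le_mul h1 (by omega : 2 * I.n + 1 ≤ 2 * N₀ + 1)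
        omega
    · refine Set.mem_of_eq_of_mem (reduction_of_not_le (by rwa [hn])) ?_
      exact (hred K g I (f x) (le_max_left _ _) (hN₀ _ (by omega)) hV hdense hw).1 hc
  · obtain ⟨I, hV, hdense, hw, hs⟩ := (hfL x).2 hx
    have hn := I.length_headD hV hw
    obtain ⟨pts, -, -, -, hparse⟩ := I.exists_rows hw
    have hk : (parse (f x)).1.length = I.k := by rw [hparse]; exact List.length_replicate
    by_cases hnN : I.n ≤ N₀
    · refine Set.mem_of_eq_of_mem (reduction_eq_noWord (hn.trans_le hnN) (fun h => ?_) ?_) hno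
      · rw [hk] at h
        exact (I.complete_of_two_pow_le hV hyz.le
          ((Nat.pow_le_pow_right (by norm_num) hnN).trans h)).not_sound hV hα1 hs
      -- The word determines its valid instance, and for `α < 1` no instance is both complete and
      -- sound.
      · rintro ⟨-, J, hJV, -, hJw, hJc⟩
        obtain rfl := I.eq_of_describedBy hV hJV hw hJw
        exact hJc.not_sound hV hα1 hs
    · refine Set.mem_of_eq_of_mem (reduction_of_not_le (by rwa [hn])) ?_
      exact (hred K g I (f x) (le_max_left _ _) (hN₀ _ (by omega)) hV hdense hw).2 hs

theorem kMedianNPHardToApprox_of_jchStar (h : JCHStar) {ε : ℝ} (hε : 0 < ε) :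
    KMedianNPHardToApprox (1 + 1 / Real.exp 1 - ε) := by
  have he : 0 < 1 / Real.exp 1 := by positivity
  have he1 : 1 / Real.exp 1 ≤ 1 := by
    rw [div_le_one (Real.exp_pos 1)]
    exact Real.one_le_exp zero_le_one
  -- The first bound leaves `ε / 2` for the reduction, the second keeps `α = 1 - 1/e + δ` below `1`.
  set δ := min (ε / 2) (1 / Real.exp 1 / 2)
  have hδ : 0 < δ := lt_min (by linarith) (by linarith)
  have hδε : δ ≤ ε / 2 := min_le_left _ _
  have hδe : δ ≤ 1 / Real.exp 1 / 2 := min_le_right _ _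
  obtain ⟨z, hz, hard⟩ := h δ hδ
  refine kMedianNPHardToApprox_mono ?_ (kMedianNPHardToApprox_of_johnsonCoverage (by linarith)
    (by linarith) (by omega) (by omega) hard (half_pos hε))
  rw [Nat.cast_sub (by omega), Nat.cast_one, sub_sub_cancel, div_one]
  linarith

end KMedianL1

theorem mainTheorem7 :
    (∀ (α : ℝ) (z y : ℕ), 0 ≤ α → α < 1 → 1 ≤ y → y < z →
      JohnsonCoverageStarNPHard α z y →
      ∀ ε : ℝ, 0 < ε → KMedianNPHardToApprox (1 + (1 - α) / ((z : ℝ) - (y : ℝ)) - ε)) ∧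
    (JCHStar → ∀ ε : ℝ, 0 < ε → KMedianNPHardToApprox (1 + 1 / Real.exp 1 - ε)) ∧
    (∀ (d : ℕ) (P : Finset (Fin d → Bool)), ∃ c : Fin d → Bool,
      (∀ i, IsMedian P (fun a => boolPoint a i) (boolPoint c i)) ∧
      ∀ x : L1 d, ∑ a ∈ P, ‖boolPoint a - boolPoint c‖ ≤ ∑ a ∈ P, ‖boolPoint a - x‖) :=
  ⟨fun _ _ _ hα hα1 hy hyz h _ hε =>
      kMedianNPHardToApprox_of_johnsonCoverage hα hα1 hy hyz h hε,
    fun h _ hε => kMedianNPHardToApprox_of_jchStar h hε, exists_bool_median⟩
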